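/- **Theorem (Virial identities).** Work on the line, with $\hat f(\xi)=\tfrac1{\sqrt{2\pi}}\int e^{-i\xi x}f(x)\,dx$, $\langle g,f\rangle=\int\overline g f\,dx$, $\langle x\rangle=\sqrt{1+x^2}$, and $\|f\|_{H^\sigma}^2=\int(|\xi|+1)^{2\sigma}|\hat f(\xi)|^2\,d\xi$. Let $L^2_+=\{f\in L^2(\mathbb R):\hat f=0 \text{ a.e. on }(-\infty,0)\}$, let $H^{1/2}_+=H^{1/2}\cap L^2_+$, let $C_+$ be the Fourier multiplier with symbol $1_{[0,\infty)}$, and put $q_+=C_+q$. For real-valued $q\in L^2(\mathbb R)$ let $\mathcal L=\mathcal L(q)$, formally $\mathcal Lf=-if'-C_+(qf)$, be the operator on $L^2_+$ associated to the quadratic form $f\mapsto\int_0^\infty\xi|\hat f(\xi)|^2\,d\xi-\int q|f|^2\,dx$ with form domain $H^{1/2}_+$. Whenever the inverses exist as bounded operators on $L^2_+$, write $$R(\kappa)=R(\kappa;q)=(\mathcal L+\kappa)^{-1},\qquad m(\kappa;q)=R(\kappa;q)q_+,\qquad \beta(\kappa)=\beta(\kappa;q)=\int q\,m(\kappa;q)\,dx,$$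 and, with $n=m(\varkappa;q)$, $$\mathrm{Cof}\beta(\varkappa)=\mathrm{Cof}\beta(\varkappa;q)=\tfrac12\int x\,q\,(n+\overline n)\,dx .$$ The Poisson bracket is $\{F,G\}=\int\frac{\delta F}{\delta q}\bigl(\frac{\delta G}{\delta q}\bigr)'dx$, where $\frac{\delta F}{\delta q}\in L^2$ is defined by $\frac{d}{d\theta}F(q+\theta f)\big|_{\theta=0}=\int\frac{\delta F}{\delta q}f\,dx$ for all real-valued $f$ with $\langle x\rangle f\in L^2(\mathbb R)$, and $'$ is the weak derivative. Let $-\tfrac12<s<0$ and $A>0$. There is $\kappa_0=\kappa_0(s,A)>0$ such that for every real-valued $q$ with $\langle x\rangle q\in L^2(\mathbb R)$ and $\|q\|_{H^s}\le A$, and for all $\kappa,\varkappa\ge\kappa_0$, the resolvents $R(\kappa)$ and $R(\varkappa)$ exist, the bracket $\{\mathrm{Cof}\beta(\varkappa),\beta(\kappa)\}$ exists at $q$ (the two functional derivatives and the weak derivative exist, all in $L^2$), and $$\bigl\{\mathrm{Cof}\beta(\varkappa),\beta(\kappa)\bigr\}=-\kappa\,\bigl\langle q_+,R(\kappa)R(\varkappa)R(\kappa)q_+\bigr\rangle=-\kappa\,\frac{\partial}{\partial\kappa}\,\frac{\beta(\kappa)-\beta(\varkappa)}{\kappa-\varkappa},$$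 where the derivative exists and, at $\kappa=\varkappa$, the quotient is extended by its limit $\beta'(\varkappa)$. -/

import Mathlib

open MeasureTheory
open scoped ENNReal ContDiff ComplexConjugate FourierTransform

noncomputable section

namespace BenjaminOno

/-- The complex Hilbert space `L²(ℝ)`; `inner ℂ g f = ∫ conj g · f`. -/
abbrev L2 : Type := Lp ℂ 2 (volume : Measure ℝ)

open Classical in
/-- The class in `L²(ℝ)` of a function (only used for square-integrable functions). -/
def toL2 (f : ℝ → ℂ) : L2 :=
  if h : MemLp f 2 (volume : Measure ℝ) then h.toLp f else 0

/-- The Japanese bracket `⟨x⟩ = (1 + x²)^{1/2}`. -/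
def japaneseBracket (x : ℝ) : ℝ := Real.sqrt (1 + x ^ 2)

/-- `⟨x⟩ f ∈ L²(ℝ)` for a real-valued function `f`. -/
def MemWeightedL2 (f : ℝ → ℝ) : Prop :=
  MemLp (fun x => japaneseBracket x * f x) 2 (volume : Measure ℝ)

/-!
Mathlib's Fourier transform is `𝓕 f η = ∫ exp(-2πi x η) f x dx`.  The unitary transform
`f̂ ξ = (2π)^{-1/2} ∫ exp(-i x ξ) f x dx` is `f̂ ξ = (2π)^{-1/2} 𝓕 f (ξ / 2π)`, so that frequency
`ξ` corresponds to `2π η`, and `∫ w ξ ‖f̂ ξ‖² dξ = ∫ w (2πη) ‖𝓕 f η‖² dη`.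
-/

/-- The squared Sobolev norm `‖f‖²_{H^σ} = ∫ (|ξ| + 1)^{2σ} |f̂ ξ|² dξ` of `f ∈ L²(ℝ)`. -/
def sobolevNormSq (σ : ℝ) (f : L2) : ℝ≥0∞ :=
  ∫⁻ η : ℝ, ENNReal.ofReal ((2 * Real.pi * |η| + 1) ^ (2 * σ)) * ‖(𝓕 f : L2) η‖ₑ ^ 2

/-- The Hardy space `L²₊(ℝ)`: functions whose Fourier transform is supported on `[0, ∞)`. -/
def hardy : Submodule ℂ L2 where
  carrier := {f | ∀ᵐ η : ℝ, η < 0 → (𝓕 f : L2) η = 0}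
  zero_mem' := by
    have h0 : (𝓕 (0 : L2) : L2) = 0 := (Lp.fourierTransformₗᵢ ℝ ℂ).map_zero
    change ∀ᵐ η : ℝ, η < 0 → (𝓕 (0 : L2) : L2) η = 0
    rw [h0]
    filter_upwards [Lp.coeFn_zero ℂ 2 (volume : Measure ℝ)] with η h _
    simp
  add_mem' := by
    intro f g hf hg
    change ∀ᵐ η : ℝ, η < 0 → (𝓕 (f + g) : L2) η = 0
    rw [FourierTransform.fourier_add]
    filter_upwards [hf, hg, Lp.coeFn_add (𝓕 f : L2) (𝓕 g : L2)] with η h1 h2 h3 hη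
    rw [h3, Pi.add_apply, h1 hη, h2 hη, add_zero]
  smul_mem' := by
    intro c f hf
    change ∀ᵐ η : ℝ, η < 0 → (𝓕 (c • f) : L2) η = 0
    rw [FourierTransform.fourier_smul]
    filter_upwards [hf, Lp.coeFn_smul c (𝓕 f : L2)] with η h1 h2 hη
    rw [h2, Pi.smul_apply, h1 hη, smul_zero]

theorem memLp_indicator_fourier (f : L2) :
    MemLp (Set.indicator (Set.Ici (0 : ℝ)) (fun η => (𝓕 f : L2) η)) 2 (volume : Measure ℝ) :=
  (Lp.memLp (𝓕 f : L2)).indicator measurableSet_Ici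

/-- The Cauchy–Szegő projection `C₊ : L²(ℝ) → L²₊(ℝ)`, the Fourier multiplier `1_{[0,∞)}`. -/
def szego (f : L2) : hardy :=
  ⟨𝓕⁻ ((memLp_indicator_fourier f).toLp _ : L2), by
    change ∀ᵐ η : ℝ, η < 0 →
      (𝓕 (𝓕⁻ ((memLp_indicator_fourier f).toLp _ : L2)) : L2) η = 0
    rw [FourierTransform.fourier_fourierInv_eq]
    filter_upwards [(memLp_indicator_fourier f).coeFn_toLp] with η h hη
    rw [h]
    exact Set.indicator_of_notMem (by simpa using hη) _⟩

/-- `q₊ = C₊ q` for a real-valued potential `q ∈ L²(ℝ)`. -/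
def qPlus (q : ℝ → ℝ) : hardy := szego (toL2 fun x => (q x : ℂ))

/-- Membership in `H^{1/2}₊`, the form domain of the Lax operator. -/
def MemFormDomain (f : hardy) : Prop := sobolevNormSq (1 / 2) (f : L2) < ⊤

/-- The sesquilinear form `(v, u) ↦ ⟨v, 𝓛₀ u⟩ - ∫ q v̄ u dx` on `H^{1/2}₊`, where `𝓛₀ = -i ∂ₓ` is
multiplication by the frequency. -/
def laxForm (q : ℝ → ℝ) (v u : hardy) : ℂ :=
  (∫ η : ℝ, ((2 * Real.pi * η : ℝ) : ℂ) * (conj ((𝓕 (v : L2) : L2) η) * (𝓕 (u : L2) : L2) η))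
    - ∫ x : ℝ, (q x : ℂ) * (conj ((v : L2) x) * (u : L2) x)

/-- `u` lies in the domain of the Lax operator `𝓛` and `𝓛 u = g`, where `𝓛` is the operator on
`L²₊` associated to the quadratic form `laxForm q` with form domain `H^{1/2}₊`. -/
def LaxGraph (q : ℝ → ℝ) (u g : hardy) : Prop :=
  MemFormDomain u ∧ ∀ v : hardy, MemFormDomain v → laxForm q v u = inner ℂ v g

/-- `T` is the resolvent `(𝓛 + κ)⁻¹`: a bounded operator on `L²₊` such that `T f` is, for each `f`,
the one and only solution `u` of `𝓛 u + κ u = f`. -/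
def IsLaxResolvent (κ : ℝ) (q : ℝ → ℝ) (T : hardy →L[ℂ] hardy) : Prop :=
  ∀ f u : hardy, T f = u ↔ LaxGraph q u (f - (κ : ℂ) • u)

open Classical in
/-- The resolvent `R(κ) = R(κ; q) = (𝓛 + κ)⁻¹`
(zero if `-κ` is in the spectrum of `𝓛`). -/
def laxResolvent (κ : ℝ) (q : ℝ → ℝ) : hardy →L[ℂ] hardy :=
  if h : ∃ T, IsLaxResolvent κ q T then h.choose else 0

/-- `m(κ; q) = R(κ; q) q₊`. -/
def gauge (κ : ℝ) (q : ℝ → ℝ) : hardy := laxResolvent κ q (qPlus q)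

/-- `β(κ; q) = ∫ q m(κ; q) dx`. -/
def beta (κ : ℝ) (q : ℝ → ℝ) : ℂ := ∫ x : ℝ, (q x : ℂ) * (gauge κ q : L2) x

/-- `Cofβ(κ; q) = ½ ∫ x q [m + m̄] dx` with `m = m(κ; q)`. -/
def cofBeta (κ : ℝ) (q : ℝ → ℝ) : ℂ :=
  (1 / 2) * ∫ x : ℝ, (x : ℂ) * (q x : ℂ) * ((gauge κ q : L2) x + conj ((gauge κ q : L2) x))

/-- `g ∈ L²` is the functional derivative `δF/δq` at `q`: for each direction `f` in the weighted
space, `d/dθ F(q + θ f)` exists at `θ = 0` and equals `∫ g f dx`. -/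
def IsFunctionalDeriv (F : (ℝ → ℝ) → ℂ) (q : ℝ → ℝ) (g : ℝ → ℂ) : Prop :=
  MemLp g 2 (volume : Measure ℝ) ∧
    ∀ f : ℝ → ℝ, MemWeightedL2 f →
      HasDerivAt (fun θ : ℝ => F (fun x => q x + θ * f x)) (∫ x : ℝ, g x * (f x : ℂ)) 0

/-- `h ∈ L²` is the weak derivative `g'` of `g`. -/
def IsWeakDeriv (g h : ℝ → ℂ) : Prop :=
  MemLp h 2 (volume : Measure ℝ) ∧
    ∀ φ : ℝ → ℝ, ContDiff ℝ ((⊤ : ℕ∞) : ℕ∞ω) φ → HasCompactSupport φ →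
      ∫ x : ℝ, g x * ((deriv φ x : ℝ) : ℂ) = -∫ x : ℝ, h x * (φ x : ℂ)

/-- The Poisson bracket `{F, G} = ∫ δF/δq · (δG/δq)' dx` exists at `q` and equals `b`. -/
def HasPoissonBracket (F G : (ℝ → ℝ) → ℂ) (q : ℝ → ℝ) (b : ℂ) : Prop :=
  ∃ dF dG dG' : ℝ → ℂ, IsFunctionalDeriv F q dF ∧ IsFunctionalDeriv G q dG ∧
    IsWeakDeriv dG dG' ∧ ∫ x : ℝ, dF x * dG' x = b

end BenjaminOno

end

open MeasureTheory
open scoped ENNReal ContDiff ComplexConjugate FourierTransform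

noncomputable section

namespace BenjaminOno

/-! ### The Fourier transform of square-integrable functions -/

/-! Write `m = R(κ)q₊`, `n = R(ϰ)q₊`, `w = R(ϰ)(xq)₊` and `P = C₊(q(1 + conj m))`. Since `β = ⟨q₊,
R(κ)q₊⟩` and `Cofβ = Re ⟨(xq)₊, R(ϰ)q₊⟩`, differentiating the resolvent in `q` gives `δβ/δq = m +
conj m + |m|²` and `δCofβ/δq = Re (xn + w + conj w · n)`. As `q` is real, `C₊(q(1 + m)) = q(1 + m) -
conj P`; with this form of the equation for `m`, the derivative of `δβ/δq` is the real function `h =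
i[(1 + m)P - conj((1 + m)P) - κ(m - conj m)]`, in which `q` survives only through `P`.

The function `xn` need not be square-integrable, since `n` may have a tail `iν/x` with `ν = ∫ q(1 +
n) / (2πϰ)` real. One has `xn = X + iν`, where `X = R(ϰ)[(xq)₊ + iν q₊ - i n]` is a Hardy function
(`IsLaxResolvent.coord_mul`). This rests on the commutator `[x, C₊]g = (i/2π) ∫ g`
(`coord_mul_cplus`). On Hardy functions with tails `a/x` and `b/x`, multiplication by `x` fails to
be symmetric by exactly `-2πi · conj a · b` (`coord_symm_defect`). Both facts are proved by dividing
by `x + i`, because the Cauchy kernel `1/(x + i)` is itself a Hardy function.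

The bracket is the real part of `∫ h (X + conj w (1 + n))`. Its second term is `⟨(xq)₊, R(ϰ) C₊(h(1
+ n))⟩`, and the Lax structure evaluates it: `b = (1 + m) C₊((1 + conj m) n)` solves `(𝓛 + ϰ) b = -i
C₊(h(1 + n)) + κ m` (`GaugeEq.commutator`). Moving `x` across the remaining pairings leaves `iκ(⟨m,
X⟩ - ⟨w, m⟩)` and explicit tail terms (`GaugeEq.integral_gradient_mul`). A second use of the
symmetry defect, for `m` and `n` with `xm = Y + iμ`, cancels the tail terms. What remains comes from
the summand `-i R(κ)² q₊` of `Y` and equals `-κ ⟨q₊, R(κ)R(ϰ)R(κ) q₊⟩` (`exists_bracket`). The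
second equality is the resolvent identity, differentiated in `κ` (`hasDerivAt_dslope_beta`).

On the analytic side, put `A = (-i∂ₓ + κ)^(-1/2)`. A Hilbert–Schmidt estimate bounds `A q A` by a
negative power of `κ` times the `H^s` norm of `q` (`enorm_integral_potential_le`, `norm_potOp_le`),
so for large `κ` a Neumann series gives `R(κ) = A (1 - A q A)⁻¹ A`. A second Neumann series, in
`L²`, shows that the resolvent maps into `H¹` (`IsLaxResolvent.hasD`); this makes `m` and `n`
bounded and justifies the products above. -/

theorem toL2_eq {f : ℝ → ℂ} (hf : MemLp f 2 volume) : toL2 f = hf.toLp f := dif_pos hf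

theorem coeFn_toL2 {f : ℝ → ℂ} (hf : MemLp f 2 volume) : (toL2 f : ℝ → ℂ) =ᵐ[volume] f := by
  rw [toL2_eq hf]; exact hf.coeFn_toLp

theorem toL2_coeFn (f : L2) : toL2 (f : ℝ → ℂ) = f := by
  rw [toL2_eq (Lp.memLp f)]; exact Lp.toLp_coeFn f _

theorem toL2_congr {f g : ℝ → ℂ} (h : f =ᵐ[volume] g) : toL2 f = toL2 g := by
  by_cases hf : MemLp f 2 volume
  · rw [toL2_eq hf, toL2_eq (hf.ae_eq h)]
    exact (MemLp.toLp_eq_toLp_iff _ _).2 h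
  · have hg : ¬ MemLp g 2 volume := fun hg => hf (hg.ae_eq h.symm)
    rw [toL2, toL2, dif_neg hf, dif_neg hg]

theorem toL2_add {f g : ℝ → ℂ} (hf : MemLp f 2 volume) (hg : MemLp g 2 volume) :
    toL2 (f + g) = toL2 f + toL2 g := by
  rw [toL2_eq hf, toL2_eq hg, toL2_eq (hf.add hg)]; rfl

theorem toL2_smul {f : ℝ → ℂ} (c : ℂ) (hf : MemLp f 2 volume) :
    toL2 (c • f) = c • toL2 f := by
  rw [toL2_eq hf, toL2_eq (hf.const_smul c)]; rfl

/-- The `L²` Fourier transform of a square-integrable function. -/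
def FT (f : ℝ → ℂ) : ℝ → ℂ := ((𝓕 (toL2 f) : L2) : ℝ → ℂ)

theorem memLp_FT (f : ℝ → ℂ) : MemLp (FT f) 2 volume := Lp.memLp _

theorem FT_congr {f g : ℝ → ℂ} (h : f =ᵐ[volume] g) : FT f = FT g := by
  rw [FT, FT, toL2_congr h]

theorem FT_coeFn (f : L2) : FT f = ((𝓕 f : L2) : ℝ → ℂ) := by rw [FT, toL2_coeFn]

theorem FT_add {f g : ℝ → ℂ} (hf : MemLp f 2 volume) (hg : MemLp g 2 volume) :
    FT (f + g) =ᵐ[volume] FT f + FT g := by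
  rw [FT, toL2_add hf hg, FourierTransform.fourier_add]
  exact Lp.coeFn_add _ _

theorem FT_smul {f : ℝ → ℂ} (c : ℂ) (hf : MemLp f 2 volume) :
    FT (c • f) =ᵐ[volume] c • FT f := by
  rw [FT, toL2_smul c hf, FourierTransform.fourier_smul]
  exact Lp.coeFn_smul _ _

theorem FT_sub {f g : ℝ → ℂ} (hf : MemLp f 2 volume) (hg : MemLp g 2 volume) :
    FT (f - g) =ᵐ[volume] FT f - FT g := by
  have h : f - g = f + (-1 : ℂ) • g := by
    funext x; simp [sub_eq_add_neg]
  rw [h]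
  filter_upwards [FT_add hf (hg.const_smul (-1 : ℂ)), FT_smul (-1 : ℂ) hg] with x h1 h2
  rw [h1, Pi.add_apply, h2]
  simp [sub_eq_add_neg]

theorem ae_eq_of_FT_ae_eq {f g : ℝ → ℂ} (hf : MemLp f 2 volume) (hg : MemLp g 2 volume)
    (h : FT f =ᵐ[volume] FT g) : f =ᵐ[volume] g := by
  have h1 : (𝓕 (toL2 f) : L2) = 𝓕 (toL2 g) := Lp.ext h
  have h2 : toL2 f = toL2 g := (Lp.fourierTransformₗᵢ ℝ ℂ).injective h1
  exact (coeFn_toL2 hf).symm.trans (h2 ▸ coeFn_toL2 hg)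

/-- The inverse `L²` Fourier transform of a square-integrable function. -/
def IFT (f : ℝ → ℂ) : ℝ → ℂ := ((𝓕⁻ (toL2 f) : L2) : ℝ → ℂ)

theorem memLp_IFT (f : ℝ → ℂ) : MemLp (IFT f) 2 volume := Lp.memLp _

theorem FT_IFT {f : ℝ → ℂ} (hf : MemLp f 2 volume) : FT (IFT f) =ᵐ[volume] f := by
  rw [IFT, FT_coeFn, FourierTransform.fourier_fourierInv_eq]
  exact coeFn_toL2 hf

theorem inner_eq_integral (f g : L2) : inner ℂ f g = ∫ x, conj (f x) * g x := by
  rw [L2.inner_def]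
  refine integral_congr_ae (Filter.Eventually.of_forall fun x => ?_)
  simp [mul_comm]

theorem inner_toL2 {f g : ℝ → ℂ} (hf : MemLp f 2 volume) (hg : MemLp g 2 volume) :
    inner ℂ (toL2 f) (toL2 g) = ∫ x, conj (f x) * g x := by
  rw [inner_eq_integral]
  refine integral_congr_ae ?_
  filter_upwards [coeFn_toL2 hf, coeFn_toL2 hg] with x h1 h2
  rw [h1, h2]

theorem plancherel {f g : ℝ → ℂ} (hf : MemLp f 2 volume) (hg : MemLp g 2 volume) :
    ∫ x, conj (f x) * g x = ∫ η, conj (FT f η) * FT g η := by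
  rw [← inner_toL2 hf hg, ← Lp.inner_fourier_eq, inner_eq_integral]; rfl

/-- For Schwartz `f` this is how the Fourier transform of a tempered distribution is defined. Both
sides are continuous in `f`, so density of Schwartz functions finishes the proof. -/
theorem integral_fourier_mul (f g : L2) :
    ∫ x, (𝓕 f : L2) x * g x = ∫ x, f x * (𝓕 g : L2) x := by
  have hB : ∀ u v : L2, (ContinuousLinearMap.mul ℂ ℂ).lpPairing volume 2 2 u v
      = ∫ x, u x * v x := fun u v => by
    rw [ContinuousLinearMap.lpPairing_eq_integral]; rfl
  refine DenseRange.induction_on (p := fun f : L2 => ∫ x, (𝓕 f : L2) x * g x =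
    ∫ x, f x * (𝓕 g : L2) x)
    (SchwartzMap.denseRange_toLpCLM (E := ℝ) (F := ℂ) (μ := volume) (p := 2)
      ENNReal.ofNat_ne_top) f ?_ ?_
  · simp_rw [← hB]
    refine isClosed_eq ?_ ?_
    · exact (((ContinuousLinearMap.mul ℂ ℂ).lpPairing volume 2 2).flip g).continuous.comp
        (ContinuousFourier.continuous_fourier)
    · exact (((ContinuousLinearMap.mul ℂ ℂ).lpPairing volume 2 2).flip (𝓕 g)).continuous
  · intro φ
    have h := congrArg (fun T => T φ) (Lp.fourier_toTemperedDistribution_eq g)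
    simp only [TemperedDistribution.fourier_apply, Lp.toTemperedDistribution_apply,
      smul_eq_mul] at h
    rw [SchwartzMap.toLpCLM_apply, SchwartzMap.toLp_fourier_eq]
    refine Eq.trans ?_ (h.trans ?_) <;> refine integral_congr_ae ?_
    · filter_upwards [(𝓕 φ).coeFn_toLp 2 volume] with x hx
      rw [hx]
    · filter_upwards [φ.coeFn_toLp 2 volume] with x hx
      rw [hx]

theorem integral_FT_mul {f g : ℝ → ℂ} (hf : MemLp f 2 volume) (hg : MemLp g 2 volume) :
    ∫ x, FT f x * g x = ∫ x, f x * FT g x := by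
  have h := integral_fourier_mul (toL2 f) (toL2 g)
  refine Eq.trans ?_ (h.trans ?_) <;> refine integral_congr_ae ?_
  · filter_upwards [coeFn_toL2 hg] with x hx
    rw [hx]; rfl
  · filter_upwards [coeFn_toL2 hf] with x hx
    rw [hx]; rfl

theorem FT_schwartz (φ : SchwartzMap ℝ ℂ) : FT φ =ᵐ[volume] 𝓕 (φ : ℝ → ℂ) := by
  have h : toL2 φ = φ.toLp 2 := toL2_eq (φ.memLp 2)
  rw [FT, h, SchwartzMap.toLp_fourier_eq]
  filter_upwards [(𝓕 φ).coeFn_toLp 2 volume] with x hx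
  rw [hx, SchwartzMap.fourier_coe]

theorem MemLp.locallyIntegrable_two {f : ℝ → ℂ} (hf : MemLp f 2 volume) :
    LocallyIntegrable f volume := hf.locallyIntegrable (by norm_num)

/-- The device behind the rules for `FT`: the `L²` transform has no pointwise formula, so an
identity is tested against Schwartz functions, with `integral_FT_mul` moving the transform onto
them. -/
theorem ae_eq_of_integral_schwartz {f g : ℝ → ℂ} (hf : LocallyIntegrable f volume)
    (hg : LocallyIntegrable g volume)
    (h : ∀ φ : SchwartzMap ℝ ℂ, ∫ x, φ x * f x = ∫ x, φ x * g x) : f =ᵐ[volume] g := by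
  refine ae_eq_of_integral_contDiff_smul_eq hf hg fun ψ hψ hc => ?_
  have h1 : HasCompactSupport fun x => (ψ x : ℂ) := hc.comp_left (g := fun r : ℝ => (r : ℂ)) rfl
  have h2 : ContDiff ℝ ∞ fun x => (ψ x : ℂ) := Complex.ofRealCLM.contDiff.comp hψ
  have := h (h1.toSchwartzMap h2)
  simpa [Complex.real_smul] using this

/-- On `L¹ ∩ L²` the two Fourier transforms coincide. -/
theorem FT_eq_fourier {f : ℝ → ℂ} (hf : MemLp f 2 volume) (hf1 : Integrable f) :
    FT f =ᵐ[volume] 𝓕 f := by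
  have hcont : Continuous (𝓕 f) :=
    VectorFourier.fourierIntegral_continuous Real.continuous_fourierChar
      (by exact continuous_inner) hf1
  refine ae_eq_of_integral_schwartz (MemLp.locallyIntegrable_two (memLp_FT f))
    hcont.locallyIntegrable fun φ => ?_
  rw [← integral_FT_mul (φ.memLp 2) hf]
  have h2 := VectorFourier.integral_fourierIntegral_smul_eq_flip (L := innerₗ ℝ)
      Real.continuous_fourierChar continuous_inner (φ.integrable (μ := volume)) hf1
  refine Eq.trans (integral_congr_ae ?_) (h2.trans ?_)
  · filter_upwards [FT_schwartz φ] with x hx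
    rw [hx, smul_eq_mul]; rfl
  · simp only [smul_eq_mul, flip_innerₗ]; rfl

theorem MemLp.conj {f : ℝ → ℂ} {p : ℝ≥0∞} (hf : MemLp f p volume) :
    MemLp (fun x => conj (f x)) p volume := hf.star

theorem MemLp.comp_neg {f : ℝ → ℂ} {p : ℝ≥0∞} (hf : MemLp f p volume) :
    MemLp (fun x => f (-x)) p volume :=
  hf.comp_measurePreserving (Measure.measurePreserving_neg _)

theorem MemLp.comp_add_right {f : ℝ → ℂ} {p : ℝ≥0∞} (hf : MemLp f p volume) (t : ℝ) :
    MemLp (fun x => f (x + t)) p volume :=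
  hf.comp_measurePreserving (measurePreserving_add_right _ t)

theorem MemLp.integrable_mul_two {f g : ℝ → ℂ} (hf : MemLp f 2 volume) (hg : MemLp g 2 volume) :
    Integrable (fun x => f x * g x) := hf.integrable_mul hg

theorem fourier_conj_comp_neg (f : ℝ → ℂ) (x : ℝ) :
    𝓕 (fun y => conj (f (-y))) x = conj (𝓕 f x) := by
  rw [Real.fourier_real_eq_integral_exp_smul, Real.fourier_real_eq_integral_exp_smul,
    ← integral_conj, ← integral_neg_eq_self]
  refine integral_congr_ae (Filter.Eventually.of_forall fun y => ?_)
  simp only [smul_eq_mul, map_mul, neg_neg, ← Complex.exp_conj]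
  congr 2
  simp [map_ofNat (starRingEnd ℂ) 2]

theorem FT_conj {f : ℝ → ℂ} (hf : MemLp f 2 volume) :
    FT (fun x => conj (f x)) =ᵐ[volume] fun η => conj (FT f (-η)) := by
  refine ae_eq_of_integral_schwartz (MemLp.locallyIntegrable_two (memLp_FT _))
    (MemLp.locallyIntegrable_two (MemLp.comp_neg (MemLp.conj (memLp_FT f)))) fun φ => ?_
  have hψ : MemLp (fun y => conj (φ (-y))) 2 volume := MemLp.comp_neg (MemLp.conj (φ.memLp 2))
  have hψ1 : Integrable (fun y => conj (φ (-y))) := by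
    have h := MemLp.comp_neg (MemLp.conj (φ.memLp 1 (μ := volume)))
    exact memLp_one_iff_integrable.1 h
  have h4 : ∫ x, φ x * conj (FT f (-x)) = ∫ x, φ (-x) * conj (FT f x) := by
    rw [← integral_neg_eq_self]; simp
  rw [← integral_FT_mul (φ.memLp 2) (MemLp.conj hf), h4]
  have h3 := congrArg conj (integral_FT_mul hψ hf)
  rw [← integral_conj, ← integral_conj] at h3
  simp only [map_mul, Complex.conj_conj] at h3
  rw [← h3]
  refine integral_congr_ae ?_
  filter_upwards [FT_schwartz φ, FT_eq_fourier hψ hψ1] with x h1 h2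
  rw [h1, h2, fourier_conj_comp_neg φ, Complex.conj_conj]

theorem FT_modulate {f : ℝ → ℂ} (hf : MemLp f 2 volume) (t : ℝ) :
    FT (fun x => (Real.fourierChar (-(x * t)) : ℂ) * f x) =ᵐ[volume] fun η => FT f (η + t) := by
  have hm : MemLp (fun x => (Real.fourierChar (-(x * t)) : ℂ) * f x) 2 volume := by
    refine hf.of_le (AEStronglyMeasurable.mul ?_ hf.1) (Filter.Eventually.of_forall fun x => ?_)
    · exact (by fun_prop : Continuous fun x : ℝ =>
        (Real.fourierChar (-(x * t)) : ℂ)).aestronglyMeasurable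
    · rw [norm_mul, Circle.norm_coe, one_mul]
  refine ae_eq_of_integral_schwartz (MemLp.locallyIntegrable_two (memLp_FT _))
    (MemLp.locallyIntegrable_two (MemLp.comp_add_right (memLp_FT f) t)) fun φ => ?_
  have hψ : MemLp (fun y => φ (y + -t)) 2 volume := MemLp.comp_add_right (φ.memLp 2) _
  have hψ1 : Integrable (fun y => φ (y + -t)) := (φ.integrable (μ := volume)).comp_add_right _
  have h4 : ∫ x, φ x * FT f (x + t) = ∫ x, φ (x + -t) * FT f x := by
    rw [← integral_add_right_eq_self (fun x => φ (x + -t) * FT f x) t]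
    simp
  rw [← integral_FT_mul (φ.memLp 2) hm, h4, ← integral_FT_mul hψ hf]
  refine integral_congr_ae ?_
  filter_upwards [FT_schwartz φ, FT_eq_fourier hψ hψ1] with x h1 h2
  have h5 : 𝓕 (fun y => φ (y + -t)) x = (Real.fourierChar (-(x * t)) : ℂ) * 𝓕 φ x := by
    have := congrFun (Fourier.fourierIntegral_comp_add_right Real.fourierChar volume φ (-t)) x
    simp only [Fourier.fourierIntegral_def] at this
    rw [Real.fourier_real_eq]
    have h6 : ∫ v, Real.fourierChar (-(v * x)) • φ (v + -t) =
      ∫ v, Real.fourierChar (-(v * x)) • (φ ∘ fun v => v + -t) v := rfl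
    rw [h6, this, SchwartzMap.fourier_coe, Real.fourier_real_eq, Circle.smul_def, smul_eq_mul]
    congr 4
    ring
  rw [h1, h2, h5, SchwartzMap.fourier_coe]
  ring

/-- The Fourier transform of a product of two square-integrable functions is the convolution of
their Fourier transforms. -/
theorem fourier_mul {f g : ℝ → ℂ} (hf : MemLp f 2 volume) (hg : MemLp g 2 volume) (η : ℝ) :
    𝓕 (fun x => f x * g x) η = ∫ ζ, FT f ζ * FT g (η - ζ) := by
  have hm : MemLp (fun x => (Real.fourierChar (-(x * η)) : ℂ) * g x) 2 volume := by
    refine hg.of_le (AEStronglyMeasurable.mul ?_ hg.1) (Filter.Eventually.of_forall fun x => ?_)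
    · exact (by fun_prop : Continuous fun x : ℝ =>
        (Real.fourierChar (-(x * η)) : ℂ)).aestronglyMeasurable
    · rw [norm_mul, Circle.norm_coe, one_mul]
  -- The value at `η` is the inner product of `conj f` with `g` modulated by `η`; modulation becomes
  -- translation on the Fourier side.
  have h := plancherel (MemLp.conj hf) hm
  rw [Real.fourier_real_eq, ← integral_neg_eq_self (fun ζ => FT f ζ * FT g (η - ζ))]
  refine Eq.trans (integral_congr_ae (Filter.Eventually.of_forall fun x => ?_))
    (h.trans (integral_congr_ae ?_))
  · simp only [Circle.smul_def, smul_eq_mul, Complex.conj_conj]; ring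
  · filter_upwards [FT_conj hf, FT_modulate hg η] with x h1 h2
    rw [h1, h2, Complex.conj_conj, sub_neg_eq_add, add_comm η]

theorem FT_mul {f g : ℝ → ℂ} (hf : MemLp f 2 volume) (hg : MemLp g 2 volume)
    (hfg : MemLp (fun x => f x * g x) 2 volume) :
    FT (fun x => f x * g x) =ᵐ[volume] fun η => ∫ ζ, FT f ζ * FT g (η - ζ) := by
  filter_upwards [FT_eq_fourier hfg (MemLp.integrable_mul_two hf hg)] with η h
  rw [h, fourier_mul hf hg]

/-- A square-integrable function with integrable Fourier transform is bounded. -/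
theorem norm_le_integral_FT {f : ℝ → ℂ} (hf : MemLp f 2 volume) (h : Integrable (FT f)) :
    ∀ᵐ x, ‖f x‖ ≤ ∫ η, ‖FT f η‖ := by
  -- Fourier inversion: since `FT f` is integrable, `f` is recovered from its classical transform,
  -- reflected.
  have key : f =ᵐ[volume] fun x => 𝓕 (FT f) (-x) := by
    have hcont : Continuous (𝓕 (FT f)) :=
      VectorFourier.fourierIntegral_continuous Real.continuous_fourierChar
        (by exact continuous_inner) h
    refine ae_eq_of_integral_schwartz (MemLp.locallyIntegrable_two hf)
      (hcont.comp continuous_neg).locallyIntegrable fun φ => ?_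
    let ψ : SchwartzMap ℝ ℂ := 𝓕⁻ φ
    have hψ : 𝓕 ψ = φ := FourierTransform.fourier_fourierInv_eq φ
    have h1 : ∫ x, φ x * f x = ∫ x, ψ x * FT f x := by
      rw [← integral_FT_mul (ψ.memLp 2) hf]
      refine integral_congr_ae ?_
      filter_upwards [FT_schwartz ψ] with x hx
      rw [hx, ← SchwartzMap.fourier_coe, hψ]
    rw [h1, ← integral_neg_eq_self]
    have h2 := VectorFourier.integral_fourierIntegral_smul_eq_flip (L := innerₗ ℝ)
      Real.continuous_fourierChar continuous_inner (φ.integrable (μ := volume)) h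
    simp only [smul_eq_mul, flip_innerₗ] at h2
    have h3 : ∫ x, φ x * 𝓕 (FT f) (-x) = ∫ x, φ (-x) * 𝓕 (FT f) x := by
      rw [← integral_neg_eq_self]; simp
    rw [h3]
    have h4 := VectorFourier.integral_fourierIntegral_smul_eq_flip (L := innerₗ ℝ)
      Real.continuous_fourierChar continuous_inner (φ.integrable (μ := volume)).comp_neg h
    simp only [smul_eq_mul, flip_innerₗ] at h4
    refine Eq.trans ?_ h4
    rw [← integral_neg_eq_self]
    refine integral_congr_ae (Filter.Eventually.of_forall fun x => ?_)
    have h5 : ψ x = 𝓕 (fun y => φ (-y)) x := by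
      rw [← Real.fourierInv_eq_fourier_comp_neg, ← SchwartzMap.fourierInv_coe]
    simp only [neg_neg]
    rw [h5]; rfl
  filter_upwards [key] with x hx
  rw [hx]
  exact VectorFourier.norm_fourierIntegral_le_integral_norm _ _ _ _ _

/-- Pointwise complex conjugation. -/
def cj (f : ℝ → ℂ) : ℝ → ℂ := fun x => conj (f x)

@[simp] theorem cj_apply (f : ℝ → ℂ) (x : ℝ) : cj f x = conj (f x) := rfl

theorem MemLp.cj {f : ℝ → ℂ} {p : ℝ≥0∞} (hf : MemLp f p volume) : MemLp (cj f) p volume :=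
  MemLp.conj hf

theorem MemLp.mul_top {f g : ℝ → ℂ} (hf : MemLp f 2 volume) (hg : MemLp g ⊤ volume) :
    MemLp (f * g) 2 volume := MemLp.mul (p := 2) (q := ⊤) (r := 2) hg hf

theorem MemLp.top_mul {f g : ℝ → ℂ} (hf : MemLp f ⊤ volume) (hg : MemLp g 2 volume) :
    MemLp (f * g) 2 volume := by rw [mul_comm]; exact MemLp.mul_top hg hf

theorem MemLp.comp_const_sub {f : ℝ → ℂ} {p : ℝ≥0∞} (hf : MemLp f p volume) (t : ℝ) :
    MemLp (fun x => f (t - x)) p volume :=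
  hf.comp_measurePreserving (Measure.measurePreserving_sub_left _ t)

theorem ae_comp_neg {p : ℝ → Prop} (h : ∀ᵐ x, p x) : ∀ᵐ x : ℝ, p (-x) :=
  (Measure.measurePreserving_neg (volume : Measure ℝ)).quasiMeasurePreserving.ae h

theorem ae_comp_const_sub {p : ℝ → Prop} (h : ∀ᵐ x, p x) (t : ℝ) : ∀ᵐ x : ℝ, p (t - x) :=
  (Measure.measurePreserving_sub_left (volume : Measure ℝ) t).quasiMeasurePreserving.ae h

theorem fourier_zero_eq_integral (f : ℝ → ℂ) : 𝓕 f (0 : ℝ) = ∫ x, f x := by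
  rw [Real.fourier_real_eq]; simp

/-! ### Functions in the Hardy space -/

/-- Square-integrable functions with Fourier transform supported on the positive half-line. -/
def Har (f : ℝ → ℂ) : Prop := MemLp f 2 volume ∧ ∀ᵐ η : ℝ, η < 0 → FT f η = 0

theorem har_coe (f : hardy) : Har ((f : L2) : ℝ → ℂ) :=
  ⟨Lp.memLp _, by rw [FT_coeFn]; exact f.2⟩

theorem Har.mem {f : ℝ → ℂ} (hf : Har f) : toL2 f ∈ hardy := hf.2

theorem Har.congr {f g : ℝ → ℂ} (hf : Har f) (h : f =ᵐ[volume] g) : Har g :=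
  ⟨hf.1.ae_eq h, by rw [← FT_congr h]; exact hf.2⟩

theorem Har.add {f g : ℝ → ℂ} (hf : Har f) (hg : Har g) : Har (f + g) := by
  refine ⟨hf.1.add hg.1, ?_⟩
  filter_upwards [hf.2, hg.2, FT_add hf.1 hg.1] with η h1 h2 h3 hη
  rw [h3, Pi.add_apply, h1 hη, h2 hη, add_zero]

theorem Har.smul {f : ℝ → ℂ} (c : ℂ) (hf : Har f) : Har (c • f) := by
  refine ⟨hf.1.const_smul c, ?_⟩
  filter_upwards [hf.2, FT_smul c hf.1] with η h1 h3 hη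
  rw [h3, Pi.smul_apply, h1 hη, smul_zero]

theorem Har.sub {f g : ℝ → ℂ} (hf : Har f) (hg : Har g) : Har (f - g) := by
  refine ⟨hf.1.sub hg.1, ?_⟩
  filter_upwards [hf.2, hg.2, FT_sub hf.1 hg.1] with η h1 h2 h3 hη
  rw [h3, Pi.sub_apply, h1 hη, h2 hη, sub_zero]

/-- For `η < 0` every `ζ` has `ζ < 0` or `η - ζ < 0`, so the convolution integrand vanishes. -/
theorem Har.mul {f g : ℝ → ℂ} (hf : Har f) (hg : Har g) (hfg : MemLp (f * g) 2 volume) :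
    Har (f * g) := by
  refine ⟨hfg, ?_⟩
  filter_upwards [FT_mul hf.1 hg.1 hfg] with η h hη
  have h' : FT (f * g) η = ∫ ζ, FT f ζ * FT g (η - ζ) := h
  rw [h']
  refine integral_eq_zero_of_ae ?_
  filter_upwards [hf.2, ae_comp_const_sub hg.2 η] with ζ h1 h2
  rcases lt_or_ge ζ 0 with h3 | h3
  · simp [h1 h3]
  · simp [h2 (by linarith)]

/-- The integral is the convolution of the two transforms at frequency `0`, where the supports meet
only in the null set `ζ = 0`. This is Cauchy's theorem in the upper half-plane. -/
theorem Har.integral_mul_eq_zero {f g : ℝ → ℂ} (hf : Har f) (hg : Har g) :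
    ∫ x, f x * g x = 0 := by
  rw [← fourier_zero_eq_integral, fourier_mul hf.1 hg.1]
  refine integral_eq_zero_of_ae ?_
  filter_upwards [hf.2, ae_comp_const_sub hg.2 0, Measure.ae_ne volume 0] with ζ h1 h2 h4
  rcases lt_or_gt_of_ne h4 with h3 | h3
  · simp [h1 h3]
  · have : FT g (0 - ζ) = 0 := h2 (by linarith)
    simp only [this, mul_zero, Pi.zero_apply]

/-- The Cauchy–Szegő projection, on functions. -/
def cplus (f : ℝ → ℂ) : ℝ → ℂ := ((szego (toL2 f) : L2) : ℝ → ℂ)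

theorem cplus_congr {f g : ℝ → ℂ} (h : f =ᵐ[volume] g) : cplus f = cplus g := by
  rw [cplus, cplus, toL2_congr h]

theorem har_cplus (f : ℝ → ℂ) : Har (cplus f) := har_coe _

theorem FT_cplus (f : ℝ → ℂ) :
    FT (cplus f) =ᵐ[volume] Set.indicator (Set.Ici (0 : ℝ)) (FT f) := by
  rw [cplus, FT_coeFn, szego]
  simp only [FourierTransform.fourier_fourierInv_eq]
  exact (memLp_indicator_fourier (toL2 f)).coeFn_toLp

theorem FT_cplus_apply (f : ℝ → ℂ) :
    ∀ᵐ η : ℝ, (0 < η → FT (cplus f) η = FT f η) ∧ (η < 0 → FT (cplus f) η = 0) := by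
  filter_upwards [FT_cplus f] with η h
  rw [h]
  exact ⟨fun h0 => Set.indicator_of_mem (Set.mem_Ici.2 h0.le) _,
    fun h0 => Set.indicator_of_notMem (by simpa using h0) _⟩

/-- A Hardy function is determined by its Fourier transform at positive frequencies. -/
theorem Har.ae_eq {f g : ℝ → ℂ} (hf : Har f) (hg : Har g)
    (h : ∀ᵐ η : ℝ, 0 < η → FT f η = FT g η) : f =ᵐ[volume] g := by
  refine ae_eq_of_FT_ae_eq hf.1 hg.1 ?_
  filter_upwards [hf.2, hg.2, h, Measure.ae_ne volume 0] with η h1 h2 h3 h4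
  rcases lt_or_gt_of_ne h4 with h0 | h0
  · rw [h1 h0, h2 h0]
  · exact h3 h0

theorem cplus_of_har {f : ℝ → ℂ} (hf : Har f) : cplus f =ᵐ[volume] f := by
  refine (har_cplus f).ae_eq hf ?_
  filter_upwards [FT_cplus_apply f] with η h h0 using h.1 h0

theorem cplus_add {f g : ℝ → ℂ} (hf : MemLp f 2 volume) (hg : MemLp g 2 volume) :
    cplus (f + g) =ᵐ[volume] cplus f + cplus g := by
  refine (har_cplus _).ae_eq ((har_cplus f).add (har_cplus g)) ?_
  filter_upwards [FT_cplus_apply f, FT_cplus_apply g, FT_cplus_apply (f + g),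
    FT_add (har_cplus f).1 (har_cplus g).1, FT_add hf hg] with η h1 h2 h3 h4 h5 h0
  rw [h3.1 h0, h4, h5, Pi.add_apply, Pi.add_apply, h1.1 h0, h2.1 h0]

theorem cplus_smul {f : ℝ → ℂ} (c : ℂ) (hf : MemLp f 2 volume) :
    cplus (c • f) =ᵐ[volume] c • cplus f := by
  refine (har_cplus _).ae_eq ((har_cplus f).smul c) ?_
  filter_upwards [FT_cplus_apply f, FT_cplus_apply (c • f),
    FT_smul c (har_cplus f).1, FT_smul c hf] with η h1 h3 h4 h5 h0
  rw [h3.1 h0, h4, h5, Pi.smul_apply, Pi.smul_apply, h1.1 h0]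

theorem cplus_sub {f g : ℝ → ℂ} (hf : MemLp f 2 volume) (hg : MemLp g 2 volume) :
    cplus (f - g) =ᵐ[volume] cplus f - cplus g := by
  refine (har_cplus _).ae_eq ((har_cplus f).sub (har_cplus g)) ?_
  filter_upwards [FT_cplus_apply f, FT_cplus_apply g, FT_cplus_apply (f - g),
    FT_sub (har_cplus f).1 (har_cplus g).1, FT_sub hf hg] with η h1 h2 h3 h4 h5 h0
  rw [h3.1 h0, h4, h5, Pi.sub_apply, Pi.sub_apply, h1.1 h0, h2.1 h0]

theorem har_zero : Har 0 :=
  ⟨MemLp.zero, by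
    have h := FT_smul (f := 0) 0 MemLp.zero
    simp only [zero_smul] at h
    filter_upwards [h] with η h _ using by simpa using h⟩

theorem cplus_cj_of_har {f : ℝ → ℂ} (hf : Har f) : cplus (cj f) =ᵐ[volume] 0 := by
  refine (har_cplus _).ae_eq har_zero ?_
  have h := FT_smul (f := 0) 0 MemLp.zero
  simp only [zero_smul] at h
  filter_upwards [FT_cplus_apply (cj f), FT_conj hf.1, ae_comp_neg hf.2, h] with η h1 h2 h3 h4 h0
  have h2' : FT (cj f) η = conj (FT f (-η)) := h2
  rw [h1.1 h0, h2', h3 (by linarith), h4, map_zero]; rfl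

/-- The negative frequencies of `f` are the reflected positive frequencies of `conj f`. -/
theorem cplus_add_cj_cplus_cj {f : ℝ → ℂ} (hf : MemLp f 2 volume) :
    cplus f + cj (cplus (cj f)) =ᵐ[volume] f := by
  refine ae_eq_of_FT_ae_eq ((har_cplus f).1.add (MemLp.cj (har_cplus _).1)) hf ?_
  filter_upwards [FT_cplus_apply f, ae_comp_neg (FT_cplus_apply (cj f)),
    FT_conj (har_cplus (cj f)).1, ae_comp_neg (FT_conj hf), Measure.ae_ne volume 0,
    FT_add (har_cplus f).1 (MemLp.cj (har_cplus (cj f)).1)] with η h1 h2 h3 h4 h5 h6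
  have h3' : FT (cj (cplus (cj f))) η = conj (FT (cplus (cj f)) (-η)) := h3
  have h4' : FT (cj f) (-η) = conj (FT f (- -η)) := h4
  rw [h6, Pi.add_apply, h3']
  rcases lt_or_gt_of_ne h5 with h0 | h0
  · rw [h1.2 h0, h2.1 (by linarith), h4']; simp
  · rw [h1.1 h0, h2.2 (by linarith)]; simp

theorem integral_cj_har_mul_cplus {f g : ℝ → ℂ} (hf : Har f) (hg : MemLp g 2 volume) :
    ∫ x, conj (f x) * cplus g x = ∫ x, conj (f x) * g x := by
  rw [plancherel hf.1 (har_cplus g).1, plancherel hf.1 hg]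
  refine integral_congr_ae ?_
  filter_upwards [hf.2, FT_cplus_apply g, Measure.ae_ne volume 0] with η h1 h2 h3
  rcases lt_or_gt_of_ne h3 with h0 | h0
  · simp [h1 h0]
  · simp [h2.1 h0]

/-! ### Weak derivatives in `L²` -/

/-- `f` and its weak derivative `g` are square-integrable. -/
def HasD (f g : ℝ → ℂ) : Prop :=
  MemLp f 2 volume ∧ MemLp g 2 volume ∧
    ∀ᵐ η : ℝ, FT g η = 2 * Real.pi * Complex.I * η * FT f η

theorem HasD.congr {f f' g g' : ℝ → ℂ} (h : HasD f g) (hf : f =ᵐ[volume] f')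
    (hg : g =ᵐ[volume] g') : HasD f' g' :=
  ⟨h.1.ae_eq hf, h.2.1.ae_eq hg, by rw [← FT_congr hf, ← FT_congr hg]; exact h.2.2⟩

theorem HasD.add {f f' g g' : ℝ → ℂ} (hf : HasD f f') (hg : HasD g g') :
    HasD (f + g) (f' + g') := by
  refine ⟨hf.1.add hg.1, hf.2.1.add hg.2.1, ?_⟩
  filter_upwards [hf.2.2, hg.2.2, FT_add hf.1 hg.1, FT_add hf.2.1 hg.2.1] with η h1 h2 h3 h4
  rw [h3, h4, Pi.add_apply, Pi.add_apply, h1, h2]; ring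

theorem HasD.sub {f f' g g' : ℝ → ℂ} (hf : HasD f f') (hg : HasD g g') :
    HasD (f - g) (f' - g') := by
  refine ⟨hf.1.sub hg.1, hf.2.1.sub hg.2.1, ?_⟩
  filter_upwards [hf.2.2, hg.2.2, FT_sub hf.1 hg.1, FT_sub hf.2.1 hg.2.1] with η h1 h2 h3 h4
  rw [h3, h4, Pi.sub_apply, Pi.sub_apply, h1, h2]; ring

theorem HasD.smul {f f' : ℝ → ℂ} (c : ℂ) (hf : HasD f f') : HasD (c • f) (c • f') := by
  refine ⟨hf.1.const_smul c, hf.2.1.const_smul c, ?_⟩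
  filter_upwards [hf.2.2, FT_smul c hf.1, FT_smul c hf.2.1] with η h1 h3 h4
  rw [h3, h4, Pi.smul_apply, Pi.smul_apply, h1, smul_eq_mul, smul_eq_mul]; ring

theorem HasD.cj {f f' : ℝ → ℂ} (hf : HasD f f') : HasD (cj f) (cj f') := by
  refine ⟨MemLp.cj hf.1, MemLp.cj hf.2.1, ?_⟩
  filter_upwards [ae_comp_neg hf.2.2, FT_conj hf.1, FT_conj hf.2.1] with η h1 h2 h3
  have h2' : FT (BenjaminOno.cj f) η = conj (FT f (-η)) := h2
  have h3' : FT (BenjaminOno.cj f') η = conj (FT f' (-η)) := h3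
  rw [h3', h2', h1]
  simp [map_ofNat (starRingEnd ℂ) 2]

theorem HasD.cplus {f f' : ℝ → ℂ} (hf : HasD f f') : HasD (cplus f) (cplus f') := by
  refine ⟨(har_cplus f).1, (har_cplus f').1, ?_⟩
  filter_upwards [hf.2.2, FT_cplus_apply f, FT_cplus_apply f', Measure.ae_ne volume 0]
    with η h1 h2 h3 h4
  rcases lt_or_gt_of_ne h4 with h0 | h0
  · rw [h3.2 h0, h2.2 h0, mul_zero]
  · rw [h3.1 h0, h2.1 h0, h1]

theorem memLp_inv_one_add_abs : MemLp (fun η : ℝ => ((1 + |η| : ℝ) : ℂ)⁻¹) 2 volume := by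
  have hpos : ∀ η : ℝ, (1 + |η|) ≠ 0 := fun η => by positivity
  have hc : Continuous fun η : ℝ => ((1 + |η| : ℝ) : ℂ)⁻¹ :=
    Continuous.inv₀ (by fun_prop) fun η => by exact_mod_cast hpos η
  rw [memLp_two_iff_integrable_sq_norm hc.aestronglyMeasurable]
  refine (integrable_inv_one_add_sq).mono'
    (by fun_prop) (Filter.Eventually.of_forall fun η => ?_)
  rw [Real.norm_eq_abs, abs_of_nonneg (by positivity), norm_inv, Complex.norm_real, inv_pow,
    Real.norm_of_nonneg (by positivity)]
  gcongr
  nlinarith [abs_nonneg η, sq_abs η]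

/-- Cauchy–Schwarz: `(1 + |η|) |FT f|` is at most `|FT f| + |FT f'|`, which is square-integrable,
and so is `1 / (1 + |η|)`. With Fourier inversion this embeds `H¹` in `L^∞`. -/
theorem HasD.integrable_FT {f f' : ℝ → ℂ} (hf : HasD f f') : Integrable (FT f) := by
  have h := ((memLp_FT f).norm.add (memLp_FT f').norm)
  have h2 := h.integrable_mul memLp_inv_one_add_abs.norm
  refine h2.mono' (memLp_FT f).1 ?_
  filter_upwards [hf.2.2] with η h1
  have h3 : ‖FT f' η‖ = 2 * Real.pi * |η| * ‖FT f η‖ := by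
    rw [h1]; simp [abs_of_pos Real.pi_pos]
  simp only [Pi.mul_apply, Pi.add_apply, norm_inv, Complex.norm_real, h3]
  rw [Real.norm_of_nonneg (by positivity : 0 ≤ 1 + |η|), ← div_eq_mul_inv,
    le_div_iff₀ (by positivity)]
  have h4 := Real.pi_gt_three
  have h5 : 0 ≤ |η| * ‖FT f η‖ := by positivity
  nlinarith

theorem HasD.memLp_top {f f' : ℝ → ℂ} (hf : HasD f f') : MemLp f ⊤ volume :=
  memLp_top_of_bound hf.1.1 _ (norm_le_integral_FT hf.1 hf.integrable_FT)

/-- Leibniz's rule on the Fourier side: inside the convolution, `η = ζ + (η - ζ)`. Boundedness of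
`H¹` functions keeps all three products in `L²`. -/
theorem HasD.mul {f f' g g' : ℝ → ℂ} (hf : HasD f f') (hg : HasD g g') :
    HasD (f * g) (f' * g + f * g') := by
  have h1 := MemLp.mul_top hf.1 hg.memLp_top
  have h2 := MemLp.mul_top hf.2.1 hg.memLp_top
  have h3 := MemLp.top_mul hf.memLp_top hg.2.1
  refine ⟨h1, h2.add h3, ?_⟩
  filter_upwards [FT_add h2 h3, FT_mul hf.1 hg.1 h1, FT_mul hf.2.1 hg.1 h2,
    FT_mul hf.1 hg.2.1 h3] with η e0 e1 e2 e3
  have e1' : FT (f * g) η = _ := e1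
  have e2' : FT (f' * g) η = _ := e2
  have e3' : FT (f * g') η = _ := e3
  rw [e0, Pi.add_apply, e1', e2', e3', ← integral_add, ← integral_const_mul]
  · refine integral_congr_ae ?_
    filter_upwards [hf.2.2, ae_comp_const_sub hg.2.2 η] with ζ k1 k2
    rw [k1, k2]; push_cast; ring
  · exact MemLp.integrable_mul_two (memLp_FT f') (MemLp.comp_const_sub (memLp_FT g) η)
  · exact MemLp.integrable_mul_two (memLp_FT f) (MemLp.comp_const_sub (memLp_FT g') η)

theorem HasD.integral_mul {f f' g g' : ℝ → ℂ} (hf : HasD f f') (hg : HasD g g') :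
    ∫ x, f x * g' x = -∫ x, f' x * g x := by
  rw [← fourier_zero_eq_integral, ← fourier_zero_eq_integral, fourier_mul hf.1 hg.2.1,
    fourier_mul hf.2.1 hg.1, ← integral_neg]
  refine integral_congr_ae ?_
  filter_upwards [hf.2.2, ae_comp_const_sub hg.2.2 0] with ζ k1 k2
  rw [k1, k2]; push_cast; ring

theorem hasD_test {φ : ℝ → ℝ} (hφ : ContDiff ℝ ((⊤ : ℕ∞) : ℕ∞ω) φ) (hc : HasCompactSupport φ) :
    HasD (fun x => (φ x : ℂ)) (fun x => ((deriv φ x : ℝ) : ℂ)) := by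
  have hd : ∀ x, HasDerivAt (fun x => (φ x : ℂ)) ((deriv φ x : ℝ) : ℂ) x := fun x =>
    ((hφ.differentiable (by simp)) x).hasDerivAt.ofReal_comp
  have hcφ : Continuous fun x => (φ x : ℂ) := Complex.continuous_ofReal.comp hφ.continuous
  have hcφ' : Continuous fun x => ((deriv φ x : ℝ) : ℂ) :=
    Complex.continuous_ofReal.comp (hφ.continuous_deriv (by simp))
  have hs : HasCompactSupport fun x => (φ x : ℂ) := hc.comp_left (g := fun r : ℝ => (r : ℂ)) rfl
  have hs' : HasCompactSupport fun x => ((deriv φ x : ℝ) : ℂ) :=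
    hc.deriv.comp_left (g := fun r : ℝ => (r : ℂ)) rfl
  have i1 := hcφ.integrable_of_hasCompactSupport hs (μ := volume)
  have i2 := hcφ'.integrable_of_hasCompactSupport hs' (μ := volume)
  have m1 : MemLp (fun x => (φ x : ℂ)) 2 volume := hcφ.memLp_of_hasCompactSupport hs
  have m2 : MemLp (fun x => ((deriv φ x : ℝ) : ℂ)) 2 volume := hcφ'.memLp_of_hasCompactSupport hs'
  refine ⟨m1, m2, ?_⟩
  have e : deriv (fun x => (φ x : ℂ)) = fun x => ((deriv φ x : ℝ) : ℂ) :=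
    funext fun x => (hd x).deriv
  have h := Real.fourier_deriv i1 (fun x => (hd x).differentiableAt) (by rw [e]; exact i2)
  rw [e] at h
  filter_upwards [FT_eq_fourier m1 i1, FT_eq_fourier m2 i2] with η h1 h2
  rw [h1, h2, h]; rfl

theorem HasD.isWeakDeriv {f f' : ℝ → ℂ} (hf : HasD f f') : IsWeakDeriv f f' :=
  ⟨hf.2.1, fun _ hφ hc => hf.integral_mul (hasD_test hφ hc)⟩

/-! ### The Cauchy kernel -/

/-- Inversion in the form needed for the Cauchy kernel, which is not integrable although its
transform is. -/
theorem FT_eq_of_FT_eq_comp_neg {f g : ℝ → ℂ} (hf : MemLp f 2 volume) (hg : MemLp g 2 volume)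
    (h : FT g =ᵐ[volume] fun x => f (-x)) : FT f =ᵐ[volume] g := by
  refine ae_eq_of_integral_schwartz (MemLp.locallyIntegrable_two (memLp_FT f))
    (MemLp.locallyIntegrable_two hg) fun φ => ?_
  let ψ : SchwartzMap ℝ ℂ := 𝓕⁻ φ
  have hψ : 𝓕 ψ = φ := FourierTransform.fourier_fourierInv_eq φ
  have h1 : ∫ x, φ x * g x = ∫ x, ψ (-x) * f x := by
    have h2 : ∫ x, φ x * g x = ∫ x, FT ψ x * g x := by
      refine integral_congr_ae ?_
      filter_upwards [FT_schwartz ψ] with x hx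
      rw [hx, ← SchwartzMap.fourier_coe, hψ]
    rw [h2, integral_FT_mul (ψ.memLp 2) hg, ← integral_neg_eq_self]
    refine integral_congr_ae ?_
    filter_upwards [ae_comp_neg h] with x hx
    rw [hx, neg_neg]
  rw [h1, ← integral_FT_mul (φ.memLp 2) hf]
  refine integral_congr_ae ?_
  filter_upwards [FT_schwartz φ] with x hx
  have h5 : ψ (-x) = 𝓕 (φ : ℝ → ℂ) x := by
    have : ψ (-x) = 𝓕⁻ (φ : ℝ → ℂ) (-x) := by rw [← SchwartzMap.fourierInv_coe]
    rw [this, Real.fourierInv_eq_fourier_neg, neg_neg]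
  rw [hx, h5]

/-- The Cauchy kernel `1 / (x + i)`. -/
def cauchy : ℝ → ℂ := fun x => ((x : ℂ) + Complex.I)⁻¹

theorem add_I_ne_zero (x : ℝ) : (x : ℂ) + Complex.I ≠ 0 := fun h => by
  have := congrArg Complex.im h
  simp at this

theorem cauchy_mul (x : ℝ) : cauchy x * ((x : ℂ) + Complex.I) = 1 :=
  inv_mul_cancel₀ (add_I_ne_zero x)

theorem continuous_cauchy : Continuous cauchy :=
  Continuous.inv₀ (by fun_prop) add_I_ne_zero

theorem normSq_cauchy (x : ℝ) : ‖cauchy x‖ ^ 2 = (1 + x ^ 2)⁻¹ := by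
  rw [cauchy, norm_inv, inv_pow, ← Complex.normSq_eq_norm_sq, Complex.normSq_apply]
  simp; ring

theorem norm_cauchy_le (x : ℝ) : ‖cauchy x‖ ≤ 1 := by
  have h := normSq_cauchy x
  have h2 : (1 + x ^ 2)⁻¹ ≤ 1 := inv_le_one_of_one_le₀ (by nlinarith [sq_nonneg x])
  nlinarith [norm_nonneg (cauchy x)]

theorem memLp_cauchy_top : MemLp cauchy ⊤ volume :=
  memLp_top_of_bound continuous_cauchy.aestronglyMeasurable 1
    (Filter.Eventually.of_forall norm_cauchy_le)

theorem memLp_cauchy : MemLp cauchy 2 volume := by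
  rw [memLp_two_iff_integrable_sq_norm continuous_cauchy.aestronglyMeasurable]
  simp_rw [normSq_cauchy]
  exact integrable_inv_one_add_sq

/-- The Fourier transform of the Cauchy kernel. -/
def cauchyHat : ℝ → ℂ :=
  Set.indicator (Set.Ioi 0) fun η : ℝ => -2 * Real.pi * Complex.I * Complex.exp (-2 * Real.pi * η)

theorem integrable_cauchyHat : Integrable cauchyHat := by
  rw [cauchyHat, integrable_indicator_iff measurableSet_Ioi]
  refine Integrable.const_mul ?_ _
  exact integrableOn_exp_mul_complex_Ioi (a := -2 * Real.pi) (by simp [Real.pi_pos]) 0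

theorem memLp_cauchyHat : MemLp cauchyHat 2 volume := by
  have hm := integrable_cauchyHat.1
  have hb : ∀ η, ‖cauchyHat η‖ ≤ 2 * Real.pi := fun η => by
    by_cases h : 0 < η
    · rw [cauchyHat, Set.indicator_of_mem (Set.mem_Ioi.2 h)]
      have h2 : ‖Complex.exp (-2 * Real.pi * η)‖ ≤ 1 := by
        rw [Complex.norm_exp]
        refine Real.exp_le_one_iff.2 ?_
        have : (-2 * Real.pi * η : ℂ).re = -(2 * Real.pi * η) := by simp
        rw [this]; have := Real.pi_pos; nlinarith [mul_pos this h]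
      rw [norm_mul]
      have h3 : ‖(-2 * Real.pi * Complex.I : ℂ)‖ = 2 * Real.pi := by
        simp [abs_of_pos Real.pi_pos]
      rw [h3]
      exact mul_le_of_le_one_right (by positivity) h2
    · rw [cauchyHat, Set.indicator_of_notMem (by simpa using h), norm_zero]; positivity
  rw [memLp_two_iff_integrable_sq_norm hm]
  refine (integrable_cauchyHat.norm.const_mul (2 * Real.pi)).mono' (hm.norm.pow 2)
    (Filter.Eventually.of_forall fun η => ?_)
  rw [Real.norm_of_nonneg (by positivity), sq]
  exact mul_le_mul_of_nonneg_right (hb η) (norm_nonneg _)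

theorem FT_cauchy : FT cauchy =ᵐ[volume] cauchyHat := by
  refine FT_eq_of_FT_eq_comp_neg memLp_cauchy memLp_cauchyHat ?_
  filter_upwards [FT_eq_fourier memLp_cauchyHat integrable_cauchyHat] with x hx
  rw [hx, Real.fourier_real_eq_integral_exp_smul]
  have h1 : (fun v : ℝ => Complex.exp (↑(-2 * Real.pi * v * x) * Complex.I) • cauchyHat v) =
      Set.indicator (Set.Ioi 0) fun v : ℝ => -2 * Real.pi * Complex.I *
        Complex.exp (-2 * Real.pi * (1 + x * Complex.I) * v) := by
    funext v
    by_cases h : 0 < v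
    · rw [cauchyHat, Set.indicator_of_mem (Set.mem_Ioi.2 h),
        Set.indicator_of_mem (Set.mem_Ioi.2 h), smul_eq_mul, mul_left_comm, ← Complex.exp_add]
      congr 2; push_cast; ring
    · rw [cauchyHat, Set.indicator_of_notMem (by simpa using h),
        Set.indicator_of_notMem (by simpa using h), smul_zero]
  rw [h1, integral_indicator measurableSet_Ioi, integral_const_mul,
    integral_exp_mul_complex_Ioi (by simp [Real.pi_pos])]
  have h2 : (1 + x * Complex.I : ℂ) ≠ 0 := fun h => by
    have := congrArg Complex.re h; simp at this
  have h3 : ((-x : ℝ) + Complex.I : ℂ) ≠ 0 := add_I_ne_zero (-x)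
  have hpi : (Real.pi : ℂ) ≠ 0 := by exact_mod_cast Real.pi_ne_zero
  have h4 : ((-x : ℝ) + Complex.I : ℂ) = Complex.I * (1 + x * Complex.I) := by
    push_cast; linear_combination (-x : ℂ) * Complex.I_sq
  rw [cauchy, eq_comm, h4]
  refine inv_eq_of_mul_eq_one_right ?_
  simp only [Complex.ofReal_zero, mul_zero, Complex.exp_zero]
  clear h1 h3 h4 hx
  generalize (1 + x * Complex.I : ℂ) = z at h2 ⊢
  field_simp
  linear_combination -Complex.I_sq

theorem har_cauchy : Har cauchy := by
  refine ⟨memLp_cauchy, ?_⟩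
  filter_upwards [FT_cauchy] with η h h0
  rw [h, cauchyHat, Set.indicator_of_notMem (by simpa using h0.le)]

/-- The transform of the square is a convolution of two one-sided exponentials; its integrand is
constant on `(0, η)`, and the length of that interval produces the factor `η` of a derivative. -/
theorem hasD_cauchy : HasD cauchy (-(cauchy * cauchy)) := by
  have hm := MemLp.mul_top memLp_cauchy memLp_cauchy_top
  refine ⟨memLp_cauchy, hm.neg, ?_⟩
  have e : -(cauchy * cauchy) = (-1 : ℂ) • (cauchy * cauchy) := by simp
  rw [e]
  filter_upwards [FT_smul (-1) hm, FT_mul memLp_cauchy memLp_cauchy hm, FT_cauchy] with η h1 h2 h3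
  have h2' : FT (cauchy * cauchy) η = _ := h2
  rw [h1, Pi.smul_apply, h2', h3]
  have h4 : ∫ ζ, FT cauchy ζ * FT cauchy (η - ζ) = ∫ ζ, Set.indicator (Set.Ioo 0 η)
      (fun _ => (-2 * Real.pi * Complex.I) ^ 2 * Complex.exp (-2 * Real.pi * η)) ζ := by
    refine integral_congr_ae ?_
    filter_upwards [FT_cauchy, ae_comp_const_sub FT_cauchy η] with ζ k1 k2
    rw [k1, k2]
    by_cases hz : 0 < ζ
    · by_cases hz' : ζ < η
      · rw [cauchyHat, Set.indicator_of_mem (Set.mem_Ioi.2 hz),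
          Set.indicator_of_mem (Set.mem_Ioi.2 (by linarith)),
          Set.indicator_of_mem (Set.mem_Ioo.2 ⟨hz, hz'⟩)]
        have : Complex.exp (-2 * Real.pi * η) = Complex.exp (-2 * Real.pi * ζ) *
          Complex.exp (-2 * Real.pi * (η - ζ : ℝ)) := by
          rw [← Complex.exp_add]; congr 1; push_cast; ring
        rw [this]; ring
      · rw [cauchyHat, Set.indicator_of_notMem (a := η - ζ) (by simp; linarith),
          mul_zero,
          Set.indicator_of_notMem (fun h => hz' h.2)]
    · rw [cauchyHat, Set.indicator_of_notMem (a := ζ) (by simpa using hz),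
          zero_mul,
          Set.indicator_of_notMem (fun h => hz h.1)]
  rw [h4, integral_indicator measurableSet_Ioo, setIntegral_const]
  by_cases h0 : 0 < η
  · rw [cauchyHat, Set.indicator_of_mem (Set.mem_Ioi.2 h0), Real.volume_real_Ioo_of_le h0.le]
    simp only [sub_zero, Complex.real_smul, smul_eq_mul]
    ring
  · have : Set.Ioo 0 η = ∅ := Set.Ioo_eq_empty h0
    rw [this, cauchyHat, Set.indicator_of_notMem (by simpa using h0)]
    simp

/-! ### Multiplication by `x` on Hardy functions. -/

/-- The coordinate function. -/
def coord : ℝ → ℂ := fun x => (x : ℂ)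

/-- Only negative frequencies `ζ` of `conj g` contribute, and there the exponential `cauchyHat (η -
ζ)` factors as `exp (-2πη)` times `cauchyHat (0 - ζ)`. The output is thus a multiple of the kernel;
`i/(2π)` is the reciprocal of the amplitude `-2πi` of its transform. -/
theorem cplus_cauchy_mul_cj {g : ℝ → ℂ} (hg : Har g) :
    cplus (cauchy * cj g) =ᵐ[volume]
      (Complex.I / (2 * Real.pi) * ∫ x, cauchy x * conj (g x)) • cauchy := by
  have hcg : MemLp (cj g) 2 volume := MemLp.cj hg.1
  have hm : MemLp (cauchy * cj g) 2 volume := MemLp.top_mul memLp_cauchy_top hcg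
  have hm' : MemLp (cj g * cauchy) 2 volume := by rw [mul_comm]; exact hm
  refine (har_cplus _).ae_eq (har_cauchy.smul _) ?_
  filter_upwards [FT_cplus_apply (cauchy * cj g), FT_smul (Complex.I / (2 * Real.pi) *
    ∫ x, cauchy x * conj (g x)) memLp_cauchy, FT_mul hcg memLp_cauchy hm', FT_cauchy]
    with η h1 h2 h3 h4 h0
  have h3' : FT (cauchy * cj g) η = ∫ ζ, FT (cj g) ζ * FT cauchy (η - ζ) := by
    rw [mul_comm]; exact h3
  rw [h1.1 h0, h2, Pi.smul_apply, h3', h4, cauchyHat, Set.indicator_of_mem (Set.mem_Ioi.2 h0)]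
  have h5 : ∫ x, cauchy x * conj (g x) = ∫ ζ, FT (cj g) ζ * FT cauchy (0 - ζ) := by
    rw [← fourier_mul hcg memLp_cauchy, fourier_zero_eq_integral]
    simp only [cj_apply, mul_comm]
  have h6 : ∫ ζ, FT (cj g) ζ * FT cauchy (η - ζ) =
      ∫ ζ, Complex.exp (-2 * Real.pi * η) * (FT (cj g) ζ * FT cauchy (0 - ζ)) := by
    refine integral_congr_ae ?_
    filter_upwards [FT_conj hg.1, ae_comp_neg hg.2, ae_comp_const_sub FT_cauchy η,
      ae_comp_const_sub FT_cauchy 0, Measure.ae_ne volume 0] with ζ k1 k2 k3 k4 k5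
    have k1' : FT (cj g) ζ = conj (FT g (-ζ)) := k1
    rcases lt_or_gt_of_ne k5 with hz | hz
    · rw [k3, k4, cauchyHat, Set.indicator_of_mem (Set.mem_Ioi.2 (by linarith)),
        Set.indicator_of_mem (Set.mem_Ioi.2 (by linarith))]
      have : Complex.exp (-2 * Real.pi * (η - ζ : ℝ)) = Complex.exp (-2 * Real.pi * η) *
          Complex.exp (-2 * Real.pi * (0 - ζ : ℝ)) := by
        rw [← Complex.exp_add]; congr 1; push_cast; ring
      rw [this]; ring
    · rw [k1', k2 (by linarith)]; simp
  rw [h6, integral_const_mul, h5, smul_eq_mul]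
  have hpi : (Real.pi : ℂ) ≠ 0 := by exact_mod_cast Real.pi_ne_zero
  field_simp
  simp only [Complex.I_sq]
  ring

/-- The commutator of the Szegő projection with multiplication by `x`. -/
theorem coord_mul_cplus {g : ℝ → ℂ} (hg : MemLp g 2 volume) (hxg : MemLp (coord * g) 2 volume) :
    coord * cplus g =ᵐ[volume]
      fun x => cplus (coord * g) x + Complex.I / (2 * Real.pi) * ∫ y, g y := by
  -- Writing `g = f / (x + i)` turns the unbounded factor `x` into the Cauchy kernel.
  set f : ℝ → ℂ := coord * g + Complex.I • g with hf
  have hfm : MemLp f 2 volume := hxg.add (hg.const_smul _)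
  have hgf : g = cauchy * f := by
    funext x
    have := cauchy_mul x
    simp only [hf, Pi.mul_apply, Pi.add_apply, Pi.smul_apply, coord, smul_eq_mul]
    linear_combination (-g x) * this
  set f₁ := cplus f with hf1
  set f₂ := cplus (cj f) with hf2
  have h1 : Har f₁ := har_cplus _
  have h2 : Har f₂ := har_cplus _
  -- The kernel times `f₁` is Hardy and is fixed by `C₊`; the kernel times `conj f₂` projects to a
  -- multiple of the kernel, and that multiple is the source of the constant `∫ g`.
  have hdec : f₁ + cj f₂ =ᵐ[volume] f := cplus_add_cj_cplus_cj hfm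
  have m1 : MemLp (cauchy * f₁) 2 volume := MemLp.top_mul memLp_cauchy_top h1.1
  have m2 : MemLp (cauchy * cj f₂) 2 volume := MemLp.top_mul memLp_cauchy_top (MemLp.cj h2.1)
  have hg' : g =ᵐ[volume] cauchy * f₁ + cauchy * cj f₂ := by
    filter_upwards [hdec] with x hx
    rw [hgf, Pi.mul_apply, ← hx]
    simp only [Pi.add_apply, Pi.mul_apply]; ring
  have hint : ∫ y, g y = ∫ y, cauchy y * conj (f₂ y) := by
    rw [integral_congr_ae hg']
    have i1 : Integrable (cauchy * f₁) := MemLp.integrable_mul_two memLp_cauchy h1.1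
    have i2 : Integrable (cauchy * cj f₂) := MemLp.integrable_mul_two memLp_cauchy (MemLp.cj h2.1)
    have h0 : ∫ x, (cauchy * f₁) x = 0 := har_cauchy.integral_mul_eq_zero h1
    rw [integral_add' i1 i2, h0, zero_add]; rfl
  have hc := cplus_congr hg'
  filter_upwards [cplus_add m1 m2, cplus_of_har (har_cauchy.mul h1 m1), cplus_cauchy_mul_cj h2,
    cplus_sub hfm (hg.const_smul Complex.I), cplus_smul Complex.I hg] with x k1 k2 k3 k4 k5
  have e : coord * g = f - Complex.I • g := by rw [hf]; ring
  rw [e, k4, Pi.sub_apply, k5, Pi.smul_apply, Pi.mul_apply, hc, k1, Pi.add_apply, k2, k3, hint]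
  have := cauchy_mul x
  simp only [Pi.mul_apply, Pi.smul_apply, smul_eq_mul, coord]
  linear_combination (f₁ x + (Complex.I / (2 * Real.pi) * ∫ y, cauchy y * conj (f₂ y))) * this

/-- Multiplying `f - a/(x + i)` by `x + i` gives a Hardy function, so this difference is a product
of two Hardy functions. It removes the tail `a/x`, which is not integrable. -/
theorem integrable_and_integral_eq_zero {f : ℝ → ℂ} (a : ℂ) (hf : Har f)
    (hxf : Har (fun x => coord x * f x - a)) :
    Integrable (f - a • cauchy) ∧ ∫ x, (f - a • cauchy) x = 0 := by
  have h1 : Har ((fun x => coord x * f x - a) + Complex.I • f) := hxf.add (hf.smul _)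
  have e : f - a • cauchy = fun x => cauchy x * ((fun x => coord x * f x - a) + Complex.I • f) x := by
    funext x
    have := cauchy_mul x
    simp only [coord, Pi.add_apply, Pi.sub_apply, Pi.smul_apply, smul_eq_mul]
    linear_combination (-f x) * this
  rw [e]
  exact ⟨MemLp.integrable_mul_two memLp_cauchy h1.1, har_cauchy.integral_mul_eq_zero h1⟩

/-- Failure of symmetry of multiplication by `x` on Hardy functions with a `1 / x` tail. -/
theorem coord_symm_defect {f g : ℝ → ℂ} {a b : ℂ} (hf : Har f)
    (hxf : Har (fun x => coord x * f x - a)) (hg : Har g)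
    (hxg : Har (fun x => coord x * g x - b)) :
    (∫ x, conj (f x) * (coord x * g x - b)) - ∫ x, conj (coord x * f x - a) * g x =
      -(2 * Real.pi * Complex.I) * (conj a * b) := by
  obtain ⟨if0, zf0⟩ := integrable_and_integral_eq_zero a hf hxf
  obtain ⟨ig0, zg0⟩ := integrable_and_integral_eq_zero b hg hxg
  rw [← integral_sub (MemLp.integrable_mul_two (MemLp.conj hf.1) hxg.1)
    (MemLp.integrable_mul_two (MemLp.conj hxf.1) hg.1)]
  have icj : Integrable (fun x => conj ((f - a • cauchy) x)) := (LinearIsometryEquiv.integrable_comp_iff Complex.conjLIE).2 if0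
  have zcj : ∫ x, conj ((f - a • cauchy) x) = 0 := by rw [integral_conj, zf0, map_zero]
  -- The two copies of `x · conj f · g` cancel. Removing the tails from the rest leaves a multiple
  -- of `1/(x + i) - 1/(x - i) = -2i/(1 + x²)`, whose integral is `-2πi`.
  have e : (fun x => conj (f x) * (coord x * g x - b) - conj (coord x * f x - a) * g x) =
      fun x => conj a * (g - b • cauchy) x - b * conj ((f - a • cauchy) x) +
        (-2 * Complex.I * (conj a * b)) * (((1 + x ^ 2)⁻¹ : ℝ) : ℂ) := by
    funext x
    have h1 : ((x : ℂ) + Complex.I) * ((x : ℂ) - Complex.I) = 1 + x ^ 2 := by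
      ring_nf; rw [Complex.I_sq]; ring
    have h2 : (x : ℂ) - Complex.I ≠ 0 := fun h => by
      have := congrArg Complex.im h; simp at this
    have h3 : cauchy x - conj (cauchy x) = -2 * Complex.I * (((1 + x ^ 2)⁻¹ : ℝ) : ℂ) := by
      have h4 : conj (cauchy x) = ((x : ℂ) - Complex.I)⁻¹ := by
        simp [cauchy, sub_eq_add_neg]
      rw [h4, cauchy]
      push_cast
      rw [← h1]
      have := add_I_ne_zero x
      field_simp
      ring
    simp only [coord, map_sub, map_mul, Complex.conj_ofReal, Pi.sub_apply, Pi.smul_apply,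
      smul_eq_mul]
    linear_combination (conj a * b) * h3
  have i3 : Integrable (fun x => conj a * (g - b • cauchy) x -
      b * conj ((f - a • cauchy) x)) := (ig0.const_mul _).sub (icj.const_mul _)
  have i4 : Integrable (fun x : ℝ => (-2 * Complex.I * (conj a * b)) *
      (((1 + x ^ 2)⁻¹ : ℝ) : ℂ)) := integrable_inv_one_add_sq.ofReal.const_mul _
  rw [e, integral_add i3 i4,
    integral_sub (ig0.const_mul _) (icj.const_mul _), integral_const_mul, integral_const_mul,
    zg0, zcj, integral_const_mul, integral_complex_ofReal, integral_univ_inv_one_add_sq]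
  ring

/-! ### The free resolvent and the `1/x` tail of its image. -/

/-- The free resolvent `(-i∂ₓ + κ)⁻¹` maps Hardy functions to differentiable ones. -/
theorem exists_free_resolvent {κ : ℝ} (hκ : 0 < κ) {g : ℝ → ℂ} (hg : Har g) :
    ∃ u u' : ℝ → ℂ, Har u ∧ HasD u u' ∧ (-Complex.I • u' + (κ : ℂ) • u =ᵐ[volume] g) ∧
      ∀ᵐ η : ℝ, 0 < η → FT u η = ((2 * Real.pi * η + κ : ℝ) : ℂ)⁻¹ * FT g η := by
  set w : ℝ → ℂ := Set.indicator (Set.Ioi 0) fun η : ℝ => ((2 * Real.pi * η + κ : ℝ) : ℂ)⁻¹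
    with hw
  have hpi := Real.pi_pos
  have hwm : Measurable w := by
    refine Measurable.indicator ?_ measurableSet_Ioi
    fun_prop
  have hpos : ∀ η : ℝ, 0 < η → 0 < 2 * Real.pi * η + κ := fun η h => by positivity
  have hwb : MemLp w ⊤ volume := by
    refine memLp_top_of_bound hwm.aestronglyMeasurable κ⁻¹ (Filter.Eventually.of_forall fun η => ?_)
    by_cases h : 0 < η
    · rw [hw, Set.indicator_of_mem (Set.mem_Ioi.2 h), norm_inv, Complex.norm_real,
        Real.norm_of_nonneg (hpos η h).le]
      refine inv_anti₀ hκ ?_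
      have : 0 ≤ 2 * Real.pi * η := by positivity
      linarith
    · rw [hw, Set.indicator_of_notMem (by simpa using h), norm_zero]; positivity
  -- The symbol of the derivative of the free resolvent; on `η > 0` its modulus is `2πη / (2πη + κ)
  -- ≤ 1`.
  set v : ℝ → ℂ := fun η => 2 * Real.pi * Complex.I * η * w η with hv
  have hvb : MemLp v ⊤ volume := by
    refine memLp_top_of_bound (by fun_prop) 1 (Filter.Eventually.of_forall fun η => ?_)
    by_cases h : 0 < η
    · simp only [hv, hw]
      rw [Set.indicator_of_mem (Set.mem_Ioi.2 h), norm_mul, norm_inv, Complex.norm_real,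
        Real.norm_of_nonneg (hpos η h).le, ← div_eq_mul_inv, div_le_one (hpos η h)]
      simp only [norm_mul, Complex.norm_I, Complex.norm_real, Complex.norm_ofNat,
        Real.norm_of_nonneg hpi.le, Real.norm_of_nonneg h.le]
      linarith
    · simp only [hv, hw]
      rw [Set.indicator_of_notMem (by simpa using h), mul_zero, norm_zero]; positivity
  have m1 : MemLp (w * FT g) 2 volume := MemLp.top_mul hwb (memLp_FT g)
  have m2 : MemLp (v * FT g) 2 volume := MemLp.top_mul hvb (memLp_FT g)
  have f1 := FT_IFT m1
  have f2 := FT_IFT m2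
  refine ⟨IFT (w * FT g), IFT (v * FT g), ⟨memLp_IFT _, ?_⟩, ⟨memLp_IFT _, memLp_IFT _, ?_⟩, ?_, ?_⟩
  · filter_upwards [f1] with η h h0
    rw [h, Pi.mul_apply, hw, Set.indicator_of_notMem (by simpa using h0.le), zero_mul]
  · filter_upwards [f1, f2] with η h1 h2
    rw [h1, h2, Pi.mul_apply, Pi.mul_apply, hv]; ring
  · have p1 : MemLp (-Complex.I • IFT (v * FT g)) 2 volume := (memLp_IFT _).const_smul _
    have p2 : MemLp ((κ : ℂ) • IFT (w * FT g)) 2 volume := (memLp_IFT _).const_smul _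
    refine ae_eq_of_FT_ae_eq (p1.add p2) hg.1 ?_
    filter_upwards [f1, f2, FT_add p1 p2, FT_smul (-Complex.I) (memLp_IFT (v * FT g)),
      FT_smul (κ : ℂ) (memLp_IFT (w * FT g)), hg.2, Measure.ae_ne volume 0]
      with η h1 h2 h3 h4 h5 h6 h7
    rw [h3, Pi.add_apply, h4, h5, Pi.smul_apply, Pi.smul_apply, h1, h2, Pi.mul_apply,
      Pi.mul_apply]
    rcases lt_or_gt_of_ne h7 with h0 | h0
    · rw [h6 h0]; simp
    · simp only [hv, hw]
      rw [Set.indicator_of_mem (Set.mem_Ioi.2 h0)]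
      have : ((2 * Real.pi * η + κ : ℝ) : ℂ) ≠ 0 := by exact_mod_cast (hpos η h0).ne'
      simp only [smul_eq_mul]
      field_simp
      push_cast
      ring_nf
      rw [Complex.I_sq]; ring
  · filter_upwards [f1] with η h h0
    rw [h, Pi.mul_apply, hw, Set.indicator_of_mem (Set.mem_Ioi.2 h0)]

theorem Har.re_integral_momentum_nonneg {f f' : ℝ → ℂ} (hf : Har f) (hd : HasD f f') :
    0 ≤ (∫ x, conj (f x) * (-Complex.I • f') x).re := by
  rw [plancherel hd.1 (hd.2.1.const_smul _)]
  have h : ∫ η, conj (FT f η) * FT (-Complex.I • f') η =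
      ∫ η, (((2 * Real.pi * η * ‖FT f η‖ ^ 2 : ℝ)) : ℂ) := by
    refine integral_congr_ae ?_
    filter_upwards [hd.2.2, FT_smul (-Complex.I) hd.2.1] with η h1 h2
    rw [h2, Pi.smul_apply, h1, smul_eq_mul]
    push_cast
    rw [← Complex.conj_mul']
    linear_combination (-(conj (FT f η) * FT f η * (2 * Real.pi * η))) * Complex.I_sq
  rw [h, integral_complex_ofReal, Complex.ofReal_re]
  refine integral_nonneg_of_ae ?_
  filter_upwards [hf.2] with η h1
  rcases lt_or_ge η 0 with h0 | h0
  · simp [h1 h0]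
  · have := Real.pi_pos
    positivity

/-- Pair with `f` and take real parts: the momentum term is nonnegative and `|1/(x + i)| ≤ 1`, so `κ
‖f‖² ≤ ‖f‖²`. This is where `κ > 1` is used. -/
theorem eq_zero_of_momentum_eq {κ : ℝ} (hκ : 1 < κ) {f f' : ℝ → ℂ} (hf : Har f) (hd : HasD f f')
    (h : -Complex.I • f' + (κ : ℂ) • f =ᵐ[volume] Complex.I • (cauchy * f)) : f =ᵐ[volume] 0 := by
  have hpos := hf.re_integral_momentum_nonneg hd
  have hm : MemLp (cauchy * f) 2 volume := MemLp.top_mul memLp_cauchy_top hf.1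
  have i1 : Integrable (fun x => conj (f x) * (Complex.I • (cauchy * f)) x) :=
    MemLp.integrable_mul_two (MemLp.conj hf.1) (hm.const_smul _)
  have i2 : Integrable (fun x => conj (f x) * ((κ : ℂ) • f) x) :=
    MemLp.integrable_mul_two (MemLp.conj hf.1) (hf.1.const_smul _)
  have isq : Integrable (fun x => ‖f x‖ ^ 2) := (memLp_two_iff_integrable_sq_norm hf.1.1).1 hf.1
  have e1 : ∫ x, conj (f x) * (-Complex.I • f') x =
      (∫ x, conj (f x) * (Complex.I • (cauchy * f)) x) - ∫ x, conj (f x) * ((κ : ℂ) • f) x := by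
    rw [← integral_sub i1 i2]
    refine integral_congr_ae ?_
    filter_upwards [h] with x hx
    rw [← hx, Pi.add_apply]; ring
  have e2 : (∫ x, conj (f x) * ((κ : ℂ) • f) x).re = κ * ∫ x, ‖f x‖ ^ 2 := by
    have : ∀ x, conj (f x) * ((κ : ℂ) • f) x = ((κ * ‖f x‖ ^ 2 : ℝ) : ℂ) := fun x => by
      push_cast; rw [← Complex.conj_mul']; simp; ring
    simp_rw [this]
    rw [integral_complex_ofReal, Complex.ofReal_re, integral_const_mul]
  have e3 : (∫ x, conj (f x) * (Complex.I • (cauchy * f)) x).re ≤ ∫ x, ‖f x‖ ^ 2 := by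
    refine (Complex.re_le_norm _).trans ((norm_integral_le_integral_norm _).trans ?_)
    refine integral_mono i1.norm isq fun x => ?_
    simp only [Pi.smul_apply, Pi.mul_apply, smul_eq_mul, norm_mul, Complex.norm_I, one_mul,
      RCLike.norm_conj]
    nlinarith [norm_cauchy_le x, sq_nonneg ‖f x‖, norm_nonneg (cauchy x)]
  rw [e1, Complex.sub_re, e2] at hpos
  have h0 : 0 ≤ ∫ x, ‖f x‖ ^ 2 := integral_nonneg fun x => by positivity
  have hz : ∫ x, ‖f x‖ ^ 2 = 0 := by nlinarith
  have := (integral_eq_zero_iff_of_nonneg (fun x => by positivity) isq).1 hz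
  filter_upwards [this] with x hx
  simpa using hx

/-- A Hardy function solving `-i n' + κ n = C₊ g` with `x g ∈ L²` equals `i ν / x` plus a
differentiable Hardy function divided by `x`. -/
theorem coord_mul_of_free_equation {κ : ℝ} (hκ : 1 < κ) {n n' g u u' : ℝ → ℂ}
    (hn : Har n) (hdn : HasD n n') (hg : MemLp g 2 volume) (hxg : MemLp (coord * g) 2 volume)
    (eqn : -Complex.I • n' + (κ : ℂ) • n =ᵐ[volume] cplus g)
    (hu : Har u) (hdu : HasD u u')
    (equ : -Complex.I • u' + (κ : ℂ) • u =ᵐ[volume] cplus (coord * g) - Complex.I • n) :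
    coord * n =ᵐ[volume] fun x => u x + Complex.I * ((∫ y, g y) / (2 * Real.pi * κ)) := by
  set ν : ℂ := (∫ y, g y) / (2 * Real.pi * κ) with hν
  have hpi : (Real.pi : ℂ) ≠ 0 := by exact_mod_cast Real.pi_ne_zero
  have hκ0 : (κ : ℂ) ≠ 0 := by exact_mod_cast (by linarith : κ ≠ 0)
  have hc : Complex.I / (2 * Real.pi) * ∫ y, g y = Complex.I * κ * ν := by
    rw [hν]; field_simp
  have hs : HasD (u + Complex.I • n) (u' + Complex.I • n') := hdu.add (hdn.smul _)
  have hD := ((hasD_cauchy.mul hs).add (hasD_cauchy.smul (Complex.I * ν))).sub hdn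
  have hH : Har (cauchy * (u + Complex.I • n) + (Complex.I * ν) • cauchy - n) :=
    ((har_cauchy.mul (hu.add (hn.smul _)) (hasD_cauchy.mul hs).1).add
      (har_cauchy.smul (Complex.I * ν))).sub hn
  -- The claim is equivalent to `D = (u + i n + iν)/(x + i) - n` vanishing. The commutator formula
  -- for `C₊` reduces the two equations to `-i D' + κ D = i D/(x + i)`, provided that `iκν = (i/2π)
  -- ∫ g`; this fixes `ν`.
  have hz := eq_zero_of_momentum_eq hκ hH hD (by
    filter_upwards [eqn, equ, coord_mul_cplus hg hxg] with x h1 h2 h3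
    rw [hc] at h3
    have h4 := cauchy_mul x
    simp only [Pi.add_apply, Pi.sub_apply, Pi.mul_apply, Pi.smul_apply, Pi.neg_apply,
      smul_eq_mul, coord] at h1 h2 h3 ⊢
    linear_combination (cauchy x) * h2 + (Complex.I * cauchy x - 1) * h1 - cauchy x * h3 +
      cplus g x * h4)
  filter_upwards [hz] with x hx
  have h4 := cauchy_mul x
  simp only [Pi.add_apply, Pi.sub_apply, Pi.mul_apply, Pi.smul_apply, smul_eq_mul, coord,
    Pi.zero_apply] at hx ⊢
  linear_combination (u x + Complex.I * n x + Complex.I * ν) * h4 - ((x : ℂ) + Complex.I) * hx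

/-! ### Fourier multipliers on the Hardy space -/

/-- Multiplication by a bounded function on `L²`. -/
def mulL {w : ℝ → ℂ} (hw : MemLp w ⊤ volume) : L2 →L[ℂ] L2 :=
  (ContinuousLinearMap.mul ℂ ℂ).holderL volume ⊤ 2 2 (hw.toLp w)

theorem coeFn_mulL {w : ℝ → ℂ} (hw : MemLp w ⊤ volume) (f : L2) :
    (mulL hw f : ℝ → ℂ) =ᵐ[volume] w * f := by
  have h := ContinuousLinearMap.coeFn_holder (r := 2) (ContinuousLinearMap.mul ℂ ℂ) (hw.toLp w) f
  filter_upwards [h, hw.coeFn_toLp] with x h1 h2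
  rw [Pi.mul_apply, ← h2]
  exact h1

/-- The Fourier multiplier with bounded symbol `w`. -/
def multL {w : ℝ → ℂ} (hw : MemLp w ⊤ volume) : L2 →L[ℂ] L2 :=
  (FourierTransform.fourierInvCLM ℂ L2).comp
    ((mulL hw).comp (FourierTransform.fourierCLM ℂ L2))

theorem FT_multL {w : ℝ → ℂ} (hw : MemLp w ⊤ volume) (f : L2) :
    FT (multL hw f) =ᵐ[volume] w * FT f := by
  have h : multL hw f = 𝓕⁻ (mulL hw (𝓕 f)) := rfl
  rw [FT_coeFn, h, FourierTransform.fourier_fourierInv_eq]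
  filter_upwards [coeFn_mulL hw (𝓕 f : L2)] with x h1
  rw [h1, Pi.mul_apply, Pi.mul_apply, FT_coeFn]

theorem isClosed_hardy : IsClosed (hardy : Set L2) := by
  have hw : MemLp (Set.indicator (Set.Ici (0 : ℝ)) fun _ => (1 : ℂ)) ⊤ volume := by
    refine memLp_top_of_bound
      ((measurable_const.indicator measurableSet_Ici).aestronglyMeasurable) 1
      (Filter.Eventually.of_forall fun x => ?_)
    by_cases h : 0 ≤ x <;> simp [h]
  have e : (hardy : Set L2) = {f | multL hw f = f} := by
    ext f
    constructor
    · intro hf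
      refine Lp.ext (ae_eq_of_FT_ae_eq (Lp.memLp _) (Lp.memLp _) ?_)
      have hf' := (har_coe ⟨f, hf⟩).2
      filter_upwards [FT_multL hw f, hf'] with η h1 h2
      rw [h1, Pi.mul_apply]
      by_cases h : 0 ≤ η
      · simp [h]
      · simp only [Set.mem_Ici, h, not_false_eq_true, Set.indicator_of_notMem, zero_mul]
        exact (h2 (by simpa using h)).symm
    · intro hf
      have hf' : multL hw f = f := hf
      have h := FT_multL hw f
      rw [hf'] at h
      change ∀ᵐ η : ℝ, η < 0 → (𝓕 f : L2) η = 0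
      rw [← FT_coeFn]
      filter_upwards [h] with η h1 h2
      rw [h1, Pi.mul_apply, Set.indicator_of_notMem (by simpa using h2), zero_mul]
  rw [e]
  exact isClosed_eq (multL hw).continuous continuous_id

instance : CompleteSpace hardy := isClosed_hardy.completeSpace_coe

/-- The symbol `(2πη + κ)^{-1/2}`, cut off to positive frequencies. -/
def halfSymbol (κ : ℝ) : ℝ → ℂ :=
  Set.indicator (Set.Ioi 0) fun η : ℝ => ((Real.sqrt (2 * Real.pi * η + κ))⁻¹ : ℝ)

theorem halfSymbol_of_pos {κ η : ℝ} (h : 0 < η) :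
    halfSymbol κ η = ((Real.sqrt (2 * Real.pi * η + κ))⁻¹ : ℝ) :=
  Set.indicator_of_mem (Set.mem_Ioi.2 h) _

theorem halfSymbol_of_nonpos {κ η : ℝ} (h : η ≤ 0) : halfSymbol κ η = 0 :=
  Set.indicator_of_notMem (by simpa using h) _

theorem conj_halfSymbol (κ η : ℝ) : conj (halfSymbol κ η) = halfSymbol κ η := by
  rcases lt_or_ge 0 η with h | h
  · rw [halfSymbol_of_pos h, Complex.conj_ofReal]
  · rw [halfSymbol_of_nonpos h, map_zero]

theorem symbol_pos {κ η : ℝ} (hκ : 0 < κ) (h : 0 < η) : 0 < 2 * Real.pi * η + κ := by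
  have := Real.pi_pos; positivity

theorem halfSymbol_mul_self {κ η : ℝ} (hκ : 0 < κ) (h : 0 < η) :
    halfSymbol κ η * halfSymbol κ η = ((2 * Real.pi * η + κ : ℝ) : ℂ)⁻¹ := by
  rw [halfSymbol_of_pos h, ← Complex.ofReal_mul, ← mul_inv,
    Real.mul_self_sqrt (symbol_pos hκ h).le, Complex.ofReal_inv]

theorem measurable_halfSymbol (κ : ℝ) : Measurable (halfSymbol κ) := by
  refine Measurable.indicator ?_ measurableSet_Ioi
  fun_prop

theorem memLp_halfSymbol {κ : ℝ} (hκ : 0 < κ) : MemLp (halfSymbol κ) ⊤ volume := by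
  refine memLp_top_of_bound (measurable_halfSymbol κ).aestronglyMeasurable (Real.sqrt κ)⁻¹
    (Filter.Eventually.of_forall fun η => ?_)
  rcases lt_or_ge 0 η with h | h
  · rw [halfSymbol_of_pos h, Complex.norm_real, Real.norm_of_nonneg (by positivity)]
    refine inv_anti₀ (Real.sqrt_pos.2 hκ) (Real.sqrt_le_sqrt ?_)
    have := Real.pi_pos
    have : 0 ≤ 2 * Real.pi * η := by positivity
    linarith
  · rw [halfSymbol_of_nonpos h, norm_zero]; positivity

theorem multL_halfSymbol_mem {κ : ℝ} (hκ : 0 < κ) (f : L2) :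
    multL (memLp_halfSymbol hκ) f ∈ hardy := by
  change ∀ᵐ η : ℝ, η < 0 → (𝓕 (multL (memLp_halfSymbol hκ) f) : L2) η = 0
  rw [← FT_coeFn]
  filter_upwards [FT_multL (memLp_halfSymbol hκ) f] with η h h0
  rw [h, Pi.mul_apply, halfSymbol_of_nonpos h0.le, zero_mul]

/-- The square root of the free resolvent, `(-i∂ₓ + κ)^{-1/2}`, on the Hardy space. -/
def halfRes {κ : ℝ} (hκ : 0 < κ) : hardy →L[ℂ] hardy :=
  ((multL (memLp_halfSymbol hκ)).comp hardy.subtypeL).codRestrict hardy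
    fun f => multL_halfSymbol_mem hκ f

theorem FT_halfRes {κ : ℝ} (hκ : 0 < κ) (f : hardy) :
    FT (halfRes hκ f : L2) =ᵐ[volume] halfSymbol κ * FT (f : L2) :=
  FT_multL (memLp_halfSymbol hκ) (f : L2)

theorem inner_hardy (f g : hardy) : inner ℂ f g = ∫ x, conj ((f : L2) x) * (g : L2) x := by
  rw [Submodule.coe_inner, inner_eq_integral]

theorem inner_hardy_FT (f g : hardy) :
    inner ℂ f g = ∫ η, conj (FT (f : L2) η) * FT (g : L2) η := by
  rw [inner_hardy, plancherel (Lp.memLp _) (Lp.memLp _)]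

theorem halfRes_symm {κ : ℝ} (hκ : 0 < κ) (f g : hardy) :
    inner ℂ (halfRes hκ f) g = inner ℂ f (halfRes hκ g) := by
  rw [inner_hardy_FT, inner_hardy_FT]
  refine integral_congr_ae ?_
  filter_upwards [FT_halfRes hκ f, FT_halfRes hκ g] with η h1 h2
  rw [h1, h2, Pi.mul_apply, Pi.mul_apply, map_mul, conj_halfSymbol]
  ring

/-- `f` as an element of the Hardy space. -/
def Har.toHardy {f : ℝ → ℂ} (hf : Har f) : hardy := ⟨toL2 f, hf.mem⟩

theorem Har.coeFn_toHardy {f : ℝ → ℂ} (hf : Har f) : ((hf.toHardy : L2) : ℝ → ℂ) =ᵐ[volume] f :=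
  coeFn_toL2 hf.1

theorem hardy_ext {f g : hardy} (h : ((f : L2) : ℝ → ℂ) =ᵐ[volume] (g : L2)) : f = g :=
  Subtype.ext (Lp.ext h)

/-- On positive frequencies `2πη + 1` and `2πη + κ` are comparable. Form-domain functions can thus
be written `A u'` with `u'` in `L²₊`, where form equations become equations between bounded
operators. -/
theorem memFormDomain_iff {κ : ℝ} (hκ : 0 < κ) (u : hardy) :
    MemFormDomain u ↔ ∃ u' : hardy, halfRes hκ u' = u := by
  have hpi := Real.pi_pos
  have hs : sobolevNormSq (1 / 2) (u : L2) =
      ∫⁻ η : ℝ, ENNReal.ofReal ((2 * Real.pi * |η| + 1) * ‖FT (u : L2) η‖ ^ 2) := by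
    refine lintegral_congr fun η => ?_
    rw [FT_coeFn, ENNReal.ofReal_mul (by positivity), ENNReal.ofReal_pow (norm_nonneg _),
      ofReal_norm]
    norm_num
  have hmeas : AEStronglyMeasurable
      (fun η => (2 * Real.pi * |η| + 1) * ‖FT (u : L2) η‖ ^ 2) volume :=
    AEStronglyMeasurable.mul (by fun_prop) ((memLp_FT _).1.norm.pow 2)
  have hint : MemFormDomain u ↔
      Integrable (fun η => (2 * Real.pi * |η| + 1) * ‖FT (u : L2) η‖ ^ 2) := by
    rw [MemFormDomain, hs]
    constructor
    · intro h
      refine ⟨hmeas, ?_⟩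
      rw [hasFiniteIntegral_iff_ofReal (Filter.Eventually.of_forall fun η => by positivity)]
      exact h
    · intro h
      have := h.2
      rwa [hasFiniteIntegral_iff_ofReal (Filter.Eventually.of_forall fun η => by positivity)]
        at this
  rw [hint]
  constructor
  · intro h
    set G : ℝ → ℂ := fun η => (Real.sqrt (2 * Real.pi * |η| + κ) : ℂ) * FT (u : L2) η with hG
    have hGm : AEStronglyMeasurable G volume := by
      refine AEStronglyMeasurable.mul ?_ (memLp_FT _).1
      exact (by fun_prop : Measurable fun η : ℝ =>
        (Real.sqrt (2 * Real.pi * |η| + κ) : ℂ)).aestronglyMeasurable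
    have hG2 : MemLp G 2 volume := by
      rw [memLp_two_iff_integrable_sq_norm hGm]
      refine (h.const_mul (1 + κ)).mono' (hGm.norm.pow 2) (Filter.Eventually.of_forall fun η => ?_)
      simp only [hG]
      rw [Real.norm_of_nonneg (by positivity), norm_mul, Complex.norm_real,
        Real.norm_of_nonneg (by positivity), mul_pow, Real.sq_sqrt (by positivity), ← mul_assoc]
      refine mul_le_mul_of_nonneg_right ?_ (by positivity)
      have : 0 ≤ 2 * Real.pi * |η| := by positivity
      nlinarith
    have hH : Har (IFT G) := by
      refine ⟨memLp_IFT _, ?_⟩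
      filter_upwards [FT_IFT hG2, (har_coe u).2] with η h1 h2 h0
      rw [h1, hG]; simp only; rw [h2 h0, mul_zero]
    refine ⟨hH.toHardy, hardy_ext ((har_coe _).ae_eq (har_coe _) ?_)⟩
    filter_upwards [FT_halfRes hκ hH.toHardy, FT_IFT hG2] with η h1 h2 h0
    rw [h1, Pi.mul_apply, FT_congr hH.coeFn_toHardy, h2, halfSymbol_of_pos h0, hG]
    simp only
    rw [abs_of_pos h0, ← mul_assoc, ← Complex.ofReal_mul, inv_mul_cancel₀, Complex.ofReal_one,
      one_mul]
    exact (Real.sqrt_pos.2 (symbol_pos hκ h0)).ne'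
  · rintro ⟨u', rfl⟩
    have hI := (memLp_two_iff_integrable_sq_norm (memLp_FT (u' : L2)).1).1 (memLp_FT (u' : L2))
    refine (hI.const_mul (1 + κ⁻¹)).mono' hmeas ?_
    filter_upwards [FT_halfRes hκ u'] with η h1
    rw [h1, Pi.mul_apply, Real.norm_of_nonneg (by positivity), norm_mul, mul_pow, ← mul_assoc]
    refine mul_le_mul_of_nonneg_right ?_ (by positivity)
    rcases lt_or_ge 0 η with h0 | h0
    · rw [halfSymbol_of_pos h0, Complex.norm_real, Real.norm_of_nonneg (by positivity), inv_pow,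
        Real.sq_sqrt (symbol_pos hκ h0).le, abs_of_pos h0, ← div_eq_mul_inv,
        div_le_iff₀ (symbol_pos hκ h0)]
      have h2 : 0 ≤ 2 * Real.pi * η := by positivity
      have h3 : 0 < κ⁻¹ := by positivity
      have h4 : κ⁻¹ * κ = 1 := inv_mul_cancel₀ hκ.ne'
      nlinarith [mul_nonneg h3.le h2]
    · rw [halfSymbol_of_nonpos h0]; simp; positivity

theorem kinetic_halfRes {κ : ℝ} (hκ : 0 < κ) (v u : hardy) :
    (∫ η : ℝ, ((2 * Real.pi * η : ℝ) : ℂ) * (conj ((𝓕 (halfRes hκ v : L2) : L2) η) *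
      (𝓕 (halfRes hκ u : L2) : L2) η)) + κ * inner ℂ (halfRes hκ v) (halfRes hκ u) =
        inner ℂ v u := by
  have hpi := Real.pi_pos
  rw [inner_hardy_FT v u, inner_hardy_FT, ← integral_const_mul, ← FT_coeFn, ← FT_coeFn]
  have key : ∀ᵐ η : ℝ, ((2 * Real.pi * η : ℝ) : ℂ) * (conj (FT (halfRes hκ v : L2) η) *
      FT (halfRes hκ u : L2) η) + κ * (conj (FT (halfRes hκ v : L2) η) *
      FT (halfRes hκ u : L2) η) = conj (FT (v : L2) η) * FT (u : L2) η := by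
    filter_upwards [FT_halfRes hκ v, FT_halfRes hκ u, (har_coe v).2, Measure.ae_ne volume 0]
      with η h1 h2 h3 h4
    rw [h1, h2, Pi.mul_apply, Pi.mul_apply, map_mul, conj_halfSymbol]
    rcases lt_or_gt_of_ne h4 with h0 | h0
    · rw [h3 h0]; simp
    · have h5 := halfSymbol_mul_self hκ h0
      have h6 : ((2 * Real.pi * η + κ : ℝ) : ℂ) ≠ 0 := by exact_mod_cast (symbol_pos hκ h0).ne'
      have h7 : ((2 * Real.pi * η + κ : ℝ) : ℂ) * (halfSymbol κ η * halfSymbol κ η) = 1 := by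
        rw [h5, mul_inv_cancel₀ h6]
      push_cast at h7 ⊢
      linear_combination (conj (FT (v : L2) η) * FT (u : L2) η) * h7
  have i2 : Integrable (fun η => (κ : ℂ) * (conj (FT (halfRes hκ v : L2) η) *
      FT (halfRes hκ u : L2) η)) :=
    (MemLp.integrable_mul_two (MemLp.conj (memLp_FT _)) (memLp_FT _)).const_mul _
  have i3 : Integrable (fun η => conj (FT (v : L2) η) * FT (u : L2) η) :=
    MemLp.integrable_mul_two (MemLp.conj (memLp_FT _)) (memLp_FT _)
  have i1 : Integrable (fun η : ℝ => ((2 * Real.pi * η : ℝ) : ℂ) *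
      (conj (FT (halfRes hκ v : L2) η) * FT (halfRes hκ u : L2) η)) := by
    refine (i3.sub i2).congr ?_
    filter_upwards [key] with η h
    rw [Pi.sub_apply, ← h]; ring
  rw [← integral_add i1 i2]
  exact integral_congr_ae key

/-! ### The Hilbert–Schmidt bound for the potential -/

/-- The free resolvent symbol. -/
def resSymbol (κ : ℝ) : ℝ → ℝ≥0∞ :=
  Set.indicator (Set.Ioi 0) fun η : ℝ => ENNReal.ofReal ((2 * Real.pi * η + κ)⁻¹)

theorem measurable_resSymbol (κ : ℝ) : Measurable (resSymbol κ) := by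
  refine Measurable.indicator ?_ measurableSet_Ioi
  fun_prop

theorem resSymbol_ne_top (κ η : ℝ) : resSymbol κ η ≠ ⊤ := by
  by_cases h : 0 < η <;> simp [resSymbol, h]

theorem enorm_halfSymbol_sq {κ : ℝ} (hκ : 0 < κ) (η : ℝ) :
    ‖halfSymbol κ η‖ₑ ^ (2 : ℝ) = resSymbol κ η := by
  rcases lt_or_ge 0 η with h | h
  · rw [halfSymbol_of_pos h, resSymbol, Set.indicator_of_mem (Set.mem_Ioi.2 h), ← ofReal_norm,
      Complex.norm_real, Real.norm_of_nonneg (by positivity), ENNReal.rpow_two,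
      ← ENNReal.ofReal_pow (by positivity), inv_pow, Real.sq_sqrt (symbol_pos hκ h).le]
  · rw [halfSymbol_of_nonpos h, resSymbol, Set.indicator_of_notMem (by simpa using h)]
    simp

/-- The tail symbol `(2πη + κ)^{-1-a}`. -/
def tailSymbol (κ a : ℝ) : ℝ → ℝ≥0∞ :=
  Set.indicator (Set.Ioi 0) fun η : ℝ => ENNReal.ofReal ((2 * Real.pi * η + κ) ^ (-(1 + a)))

theorem measurable_tailSymbol (κ a : ℝ) : Measurable (tailSymbol κ a) := by
  refine Measurable.indicator ?_ measurableSet_Ioi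
  fun_prop

theorem lintegral_tailSymbol {κ a : ℝ} (hκ : 0 < κ) (ha : 0 < a) :
    ∫⁻ η, tailSymbol κ a η = ENNReal.ofReal (κ ^ (-a) / (2 * Real.pi * a)) := by
  have hpi := Real.pi_pos
  set g : ℝ → ℝ := fun η => -((2 * Real.pi * η + κ) ^ (-a) / (2 * Real.pi * a)) with hg
  have hpos : ∀ η : ℝ, 0 ≤ η → 0 < 2 * Real.pi * η + κ := fun η h => by positivity
  have hderiv : ∀ η ∈ Set.Ici (0 : ℝ), HasDerivAt g ((2 * Real.pi * η + κ) ^ (-(1 + a))) η := by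
    intro η hη
    have h1 : HasDerivAt (fun η : ℝ => 2 * Real.pi * η + κ) (2 * Real.pi) η := by
      simpa using ((hasDerivAt_id η).const_mul (2 * Real.pi)).add_const κ
    have h2 := h1.rpow_const (p := -a) (Or.inl (hpos η hη).ne')
    have h3 := (h2.div_const (2 * Real.pi * a)).neg
    refine h3.congr_deriv ?_
    have : -a - 1 = -(1 + a) := by ring
    rw [this]
    field_simp
  have hlim : Filter.Tendsto g Filter.atTop (nhds 0) := by
    have h1 : Filter.Tendsto (fun η : ℝ => 2 * Real.pi * η + κ) Filter.atTop Filter.atTop :=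
      Filter.tendsto_atTop_add_const_right _ _
        (Filter.tendsto_id.const_mul_atTop (by positivity))
    have h2 := ((tendsto_rpow_neg_atTop ha).comp h1).div_const (2 * Real.pi * a)
    simpa [hg] using h2.neg
  have hnn : ∀ η ∈ Set.Ioi (0 : ℝ), 0 ≤ (2 * Real.pi * η + κ) ^ (-(1 + a)) := fun η hη =>
    Real.rpow_nonneg (hpos η (le_of_lt hη)).le _
  have hi := integrableOn_Ioi_deriv_of_nonneg' hderiv hnn hlim
  have hv := integral_Ioi_of_hasDerivAt_of_nonneg' hderiv hnn hlim
  rw [tailSymbol, lintegral_indicator measurableSet_Ioi, ← ofReal_integral_eq_lintegral_ofReal hi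
    ((ae_restrict_iff' measurableSet_Ioi).2 (Filter.Eventually.of_forall hnn)), hv]
  simp [hg]

theorem inv_mul_inv_le {A B D a : ℝ} (hB : 0 < B) (hD : 0 < D) (hBA : B ≤ A) (hDA : D ≤ A)
    (ha : 0 < a) (ha1 : a < 1) : A⁻¹ * B⁻¹ ≤ D ^ (-(1 - a)) * B ^ (-(1 + a)) := by
  have hA : 0 < A := hB.trans_le hBA
  have h1 : A⁻¹ = A ^ (-(1 - a)) * A ^ (-a) := by
    rw [← Real.rpow_add hA, ← Real.rpow_neg_one]; congr 1; ring
  have h2 : B ^ (-(1 + a)) = B ^ (-a) * B⁻¹ := by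
    rw [← Real.rpow_neg_one, ← Real.rpow_add hB]; congr 1; ring
  rw [h1, h2, ← mul_assoc]
  refine mul_le_mul_of_nonneg_right ?_ (inv_nonneg.2 hB.le)
  exact mul_le_mul (Real.rpow_le_rpow_of_nonpos hD hDA (by linarith))
    (Real.rpow_le_rpow_of_nonpos hB hBA (by linarith)) (Real.rpow_nonneg hA.le _)
    (Real.rpow_nonneg hD.le _)

/-- When both factors are nonzero, the larger of `2πη + κ` and `2π(η - t) + κ` is at least `2π|t| +
κ`, which yields the decay in `t`. Its leftover power `-a` is moved onto the smaller one, making the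
exponent `-(1 + a)` integrable. The sum on the right covers both signs of `t`. -/
theorem resSymbol_mul_le {κ a : ℝ} (hκ : 0 < κ) (ha : 0 < a) (ha1 : a < 1) (t η : ℝ) :
    resSymbol κ η * resSymbol κ (η - t) ≤ ENNReal.ofReal ((2 * Real.pi * |t| + κ) ^ (-(1 - a))) *
      (tailSymbol κ a η + tailSymbol κ a (η - t)) := by
  have hpi := Real.pi_pos
  rcases le_or_gt η 0 with h | h
  · rw [resSymbol, Set.indicator_of_notMem (by simpa using h), zero_mul]; exact zero_le
  rcases le_or_gt (η - t) 0 with h' | h'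
  · rw [resSymbol, Set.indicator_of_notMem (a := η - t) (by simpa using h'), mul_zero]
    exact zero_le
  have hD : 0 < 2 * Real.pi * |t| + κ := by positivity
  simp only [resSymbol, tailSymbol]
  rw [Set.indicator_of_mem (Set.mem_Ioi.2 h), Set.indicator_of_mem (Set.mem_Ioi.2 h'),
    Set.indicator_of_mem (Set.mem_Ioi.2 h), Set.indicator_of_mem (Set.mem_Ioi.2 h'),
    ← ENNReal.ofReal_mul (inv_nonneg.2 (symbol_pos hκ h).le), mul_add,
    ← ENNReal.ofReal_mul (Real.rpow_nonneg hD.le _), ← ENNReal.ofReal_mul (Real.rpow_nonneg hD.le _)]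
  rcases le_total 0 t with ht | ht
  · refine le_add_of_nonneg_of_le zero_le (ENNReal.ofReal_le_ofReal ?_)
    refine inv_mul_inv_le (symbol_pos hκ h') hD ?_ ?_ ha ha1
    · nlinarith [mul_nonneg hpi.le ht]
    · rw [abs_of_nonneg ht]; nlinarith [mul_pos hpi h']
  · refine le_add_of_le_of_nonneg (ENNReal.ofReal_le_ofReal ?_) zero_le
    rw [mul_comm]
    refine inv_mul_inv_le (symbol_pos hκ h) hD ?_ ?_ ha ha1
    · nlinarith [mul_nonneg hpi.le (neg_nonneg.2 ht)]
    · rw [abs_of_nonpos ht]; nlinarith [mul_pos hpi h]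

theorem lintegral_resSymbol_mul_le {κ a : ℝ} (hκ : 0 < κ) (ha : 0 < a) (ha1 : a < 1) (t : ℝ) :
    ∫⁻ η, resSymbol κ η * resSymbol κ (η - t) ≤
      ENNReal.ofReal (κ ^ (-a) / (Real.pi * a)) *
        ENNReal.ofReal ((2 * Real.pi * |t| + κ) ^ (-(1 - a))) := by
  have hpi := Real.pi_pos
  have hc : 0 ≤ κ ^ (-a) / (2 * Real.pi * a) := by positivity
  refine (lintegral_mono (resSymbol_mul_le hκ ha ha1 t)).trans ?_
  rw [lintegral_const_mul' _ _ ENNReal.ofReal_ne_top,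
    lintegral_add_left (measurable_tailSymbol κ a),
    lintegral_sub_right_eq_self (fun η => tailSymbol κ a η) t, lintegral_tailSymbol hκ ha,
    ← ENNReal.ofReal_add hc hc, mul_comm]
  refine le_of_eq ?_
  congr 2
  field_simp; ring

theorem enorm_hardy (u : hardy) :
    ‖u‖ₑ = (∫⁻ η, ‖FT (u : L2) η‖ₑ ^ (2 : ℝ)) ^ (1 / 2 : ℝ) := by
  have h : ‖u‖ₑ = ‖(𝓕 (u : L2) : L2)‖ₑ := by
    rw [← ofReal_norm, ← ofReal_norm, Lp.norm_fourier_eq]; rfl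
  rw [h, Lp.enorm_def, eLpNorm_eq_lintegral_rpow_enorm_toReal (by norm_num) (by norm_num)]
  simp [FT_coeFn]

theorem measurable_FT (f : ℝ → ℂ) : Measurable (FT f) :=
  (Lp.stronglyMeasurable (𝓕 (toL2 f) : L2)).measurable

/-- On the Fourier side the form has kernel `h(η) Q̂(η - ζ) h(ζ)`, where `h²` is the free resolvent
symbol; the first factor on the right is its Hilbert–Schmidt norm. Two applications of
Cauchy–Schwarz give the bound. Boundedness of `Q` serves only to make `Q` times an `L²` function
square-integrable, and is removed later by truncation. -/
theorem enorm_integral_potential_le {κ : ℝ} (hκ : 0 < κ) {Q : ℝ → ℂ} (hQ : MemLp Q 2 volume)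
    (hQb : MemLp Q ⊤ volume) (v u : hardy) :
    ‖∫ x, Q x * (conj ((halfRes hκ v : L2) x) * (halfRes hκ u : L2) x)‖ₑ ≤
      (∫⁻ t, ‖FT Q t‖ₑ ^ (2 : ℝ) * ∫⁻ η, resSymbol κ η * resSymbol κ (η - t)) ^ (1 / 2 : ℝ) *
        (‖v‖ₑ * ‖u‖ₑ) := by
  set F : ℝ → ℝ≥0∞ := fun η => ‖FT Q η‖ₑ with hF
  set h : ℝ → ℝ≥0∞ := fun η => ‖halfSymbol κ η‖ₑ with hh
  set U : ℝ → ℝ≥0∞ := fun η => ‖FT (u : L2) η‖ₑ with hU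
  set V : ℝ → ℝ≥0∞ := fun η => ‖FT (v : L2) η‖ₑ with hV
  have mF : Measurable F := (measurable_FT Q).enorm
  have mh : Measurable h := (measurable_halfSymbol κ).enorm
  have mU : Measurable U := (measurable_FT _).enorm
  have mV : Measurable V := (measurable_FT _).enorm
  set S : ℝ → ℝ≥0∞ := fun η => ∫⁻ ζ, (F (η - ζ) * h ζ) ^ (2 : ℝ) with hS
  have mS : Measurable S := by
    refine Measurable.lintegral_prod_right' (f := fun p : ℝ × ℝ => (F (p.1 - p.2) * h p.2) ^ (2 : ℝ)) ?_
    exact ((mF.comp (measurable_fst.sub measurable_snd)).mul (mh.comp measurable_snd)).pow_const _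
  have hpq : Real.HolderConjugate 2 2 := Real.HolderConjugate.two_two
  have hQu : MemLp (Q * ((halfRes hκ u : L2) : ℝ → ℂ)) 2 volume := MemLp.top_mul hQb (Lp.memLp _)
  have hQu' : MemLp (((halfRes hκ u : L2) : ℝ → ℂ) * Q) 2 volume := by rw [mul_comm]; exact hQu
  have e1 : ∫ x, Q x * (conj ((halfRes hκ v : L2) x) * (halfRes hκ u : L2) x) =
      ∫ η, conj (FT (halfRes hκ v : L2) η) * FT (Q * ((halfRes hκ u : L2) : ℝ → ℂ)) η := by
    rw [← plancherel (Lp.memLp _) hQu]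
    refine integral_congr_ae (Filter.Eventually.of_forall fun x => ?_)
    simp only [Pi.mul_apply]; ring
  have e2 : ∀ᵐ η, ‖conj (FT (halfRes hκ v : L2) η) * FT (Q * ((halfRes hκ u : L2) : ℝ → ℂ)) η‖ₑ ≤
      V η * (h η * S η ^ (1 / 2 : ℝ)) * ‖u‖ₑ := by
    filter_upwards [FT_mul (Lp.memLp _) hQ hQu', FT_halfRes hκ v] with η h1 h2
    have h1' : FT (Q * ((halfRes hκ u : L2) : ℝ → ℂ)) η =
        ∫ ζ, FT (halfRes hκ u : L2) ζ * FT Q (η - ζ) := by rw [mul_comm]; exact h1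
    rw [h1', h2, enorm_mul, Pi.mul_apply]
    have h3 : ‖∫ ζ, FT (halfRes hκ u : L2) ζ * FT Q (η - ζ)‖ₑ ≤ S η ^ (1 / 2 : ℝ) * ‖u‖ₑ := by
      refine (enorm_integral_le_lintegral_enorm _).trans ?_
      have h4 : ∫⁻ ζ, ‖FT (halfRes hκ u : L2) ζ * FT Q (η - ζ)‖ₑ =
          ∫⁻ ζ, ((fun ζ => F (η - ζ) * h ζ) * U) ζ := by
        refine lintegral_congr_ae ?_
        filter_upwards [FT_halfRes hκ u] with ζ k
        rw [k]; simp only [Pi.mul_apply, enorm_mul, hF, hh, hU]; ring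
      rw [h4, enorm_hardy u]
      exact ENNReal.lintegral_mul_le_Lp_mul_Lq volume hpq
        (((mF.comp (measurable_const.sub measurable_id)).mul mh).aemeasurable) mU.aemeasurable
    have h5 : ‖conj (halfSymbol κ η * FT (v : L2) η)‖ₑ = h η * V η := by
      rw [RCLike.enorm_conj, enorm_mul]
    rw [h5]
    calc h η * V η * _ ≤ h η * V η * (S η ^ (1 / 2 : ℝ) * ‖u‖ₑ) := by gcongr
      _ = _ := by ring
  rw [e1]
  refine (enorm_integral_le_lintegral_enorm _).trans ((lintegral_mono_ae e2).trans ?_)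
  rw [lintegral_mul_const' _ _ enorm_ne_top, ← mul_assoc]
  gcongr
  have e3 := ENNReal.lintegral_mul_le_Lp_mul_Lq volume hpq mV.aemeasurable
    (mh.mul (mS.pow_const (1 / 2 : ℝ))).aemeasurable
  refine e3.trans ?_
  rw [enorm_hardy v, mul_comm]
  refine mul_le_mul_left (ENNReal.rpow_le_rpow ?_ (by norm_num)) _
  have e4 : ∀ η, (h * fun x => S x ^ (1 / 2 : ℝ)) η ^ (2 : ℝ) =
      ∫⁻ t, resSymbol κ η * (F t ^ (2 : ℝ) * resSymbol κ (η - t)) := by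
    intro η
    rw [Pi.mul_apply, ENNReal.mul_rpow_of_nonneg _ _ (by norm_num), ← ENNReal.rpow_mul]
    norm_num
    rw [lintegral_const_mul' _ _ (resSymbol_ne_top κ η)]
    have e5 : h η ^ 2 = resSymbol κ η := by
      rw [← enorm_halfSymbol_sq hκ, ENNReal.rpow_two]
    rw [e5, hS]
    congr 1
    rw [← lintegral_sub_left_eq_self _ η]
    refine lintegral_congr fun t => ?_
    rw [ENNReal.mul_rpow_of_nonneg _ _ (by norm_num), enorm_halfSymbol_sq hκ, sub_sub_cancel]
    norm_num
  simp_rw [e4]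
  rw [lintegral_lintegral_swap]
  · refine lintegral_mono fun t => ?_
    rw [← lintegral_const_mul' _ _ (ENNReal.rpow_ne_top_of_nonneg (by norm_num) enorm_ne_top)]
    refine le_of_eq (lintegral_congr fun η => ?_)
    ring
  · refine Measurable.aemeasurable ?_
    exact ((measurable_resSymbol κ).comp measurable_fst).mul
      (((mF.comp measurable_snd).pow_const _).mul
        ((measurable_resSymbol κ).comp (measurable_fst.sub measurable_snd)))

theorem sobolevNormSq_le {s : ℝ} (hs : s < 0) {Q : ℝ → ℂ} (hQ : MemLp Q 2 volume) :
    sobolevNormSq s (toL2 Q) ≤ ENNReal.ofReal (∫ x, ‖Q x‖ ^ 2) := by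
  have hi := (memLp_two_iff_integrable_sq_norm (memLp_FT Q).1).1 (memLp_FT Q)
  have h1 : ∫ x, ‖Q x‖ ^ 2 = ∫ η, ‖FT Q η‖ ^ 2 := by
    have h := plancherel hQ hQ
    simp_rw [Complex.conj_mul', ← Complex.ofReal_pow] at h
    rw [integral_complex_ofReal, integral_complex_ofReal] at h
    exact_mod_cast h
  rw [h1, ofReal_integral_eq_lintegral_ofReal hi (Filter.Eventually.of_forall fun η => by positivity)]
  refine lintegral_mono fun η => ?_
  have h2 : ENNReal.ofReal ((2 * Real.pi * |η| + 1) ^ (2 * s)) ≤ 1 := by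
    rw [ENNReal.ofReal_le_one]
    have := Real.pi_pos
    refine Real.rpow_le_one_of_one_le_of_nonpos ?_ (by linarith)
    have : 0 ≤ 2 * Real.pi * |η| := by positivity
    linarith
  refine (mul_le_mul_left h2 _).trans ?_
  rw [one_mul, ENNReal.ofReal_pow (norm_nonneg _), ofReal_norm]
  rfl

/-- The constant in the bound for the potential relative to the free operator. -/
def potConst (s κ : ℝ) : ℝ := Real.sqrt (κ ^ (-(1 + 2 * s)) / (Real.pi * (1 + 2 * s)))

theorem norm_integral_potential_le {s κ : ℝ} (hs : -(1 / 2) < s) (hs' : s < 0) (hκ : 1 ≤ κ)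
    {Q : ℝ → ℂ} (hQ : MemLp Q 2 volume) (hQb : MemLp Q ⊤ volume) (v u : hardy) :
    ‖∫ x, Q x * (conj ((halfRes (zero_lt_one.trans_le hκ) v : L2) x) *
      (halfRes (zero_lt_one.trans_le hκ) u : L2) x)‖ ≤
      potConst s κ * Real.sqrt (sobolevNormSq s (toL2 Q)).toReal * (‖v‖ * ‖u‖) := by
  have hκ0 := zero_lt_one.trans_le hκ
  have hpi := Real.pi_pos
  have h := enorm_integral_potential_le hκ0 hQ hQb v u
  have hfin : sobolevNormSq s (toL2 Q) ≠ ⊤ :=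
    ((sobolevNormSq_le hs' hQ).trans_lt ENNReal.ofReal_lt_top).ne
  set c : ℝ := κ ^ (-(1 + 2 * s)) / (Real.pi * (1 + 2 * s)) with hc
  have hc0 : 0 ≤ c := by
    have : 0 < 1 + 2 * s := by linarith
    positivity
  have h2 : ∫⁻ t, ‖FT Q t‖ₑ ^ (2 : ℝ) * ∫⁻ η, resSymbol κ η * resSymbol κ (η - t) ≤
      ENNReal.ofReal c * sobolevNormSq s (toL2 Q) := by
    rw [sobolevNormSq, ← lintegral_const_mul' _ _ ENNReal.ofReal_ne_top]
    refine lintegral_mono fun t => ?_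
    -- With `a = 1 + 2s` the decay in `t` is `(2π|t| + κ)^(2s)`, which the `H^s` weight dominates
    -- because `κ ≥ 1` and `s < 0`.
    have h3 := lintegral_resSymbol_mul_le hκ0 (by linarith : 0 < 1 + 2 * s) (by linarith) t
    have h4 : ENNReal.ofReal ((2 * Real.pi * |t| + κ) ^ (-(1 - (1 + 2 * s)))) ≤
        ENNReal.ofReal ((2 * Real.pi * |t| + 1) ^ (2 * s)) := by
      refine ENNReal.ofReal_le_ofReal ?_
      have : -(1 - (1 + 2 * s)) = 2 * s := by ring
      rw [this]
      exact Real.rpow_le_rpow_of_nonpos (by positivity) (by linarith) (by linarith)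
    calc ‖FT Q t‖ₑ ^ (2 : ℝ) * _ ≤ ‖FT Q t‖ₑ ^ (2 : ℝ) * (ENNReal.ofReal c *
          ENNReal.ofReal ((2 * Real.pi * |t| + 1) ^ (2 * s))) :=
          mul_le_mul_right (h3.trans (mul_le_mul_right h4 _)) _
      _ = _ := by
        rw [ENNReal.rpow_two]
        change ‖FT Q t‖ₑ ^ 2 * _ = ENNReal.ofReal c * (_ * ‖FT Q t‖ₑ ^ 2)
        ring
  have h5 := h.trans (mul_le_mul_left (ENNReal.rpow_le_rpow h2 (by norm_num : (0 : ℝ) ≤ 1 / 2)) _)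
  have h6 : (ENNReal.ofReal c * sobolevNormSq s (toL2 Q)) ^ (1 / 2 : ℝ) * (‖v‖ₑ * ‖u‖ₑ) =
      ENNReal.ofReal (potConst s κ * Real.sqrt (sobolevNormSq s (toL2 Q)).toReal *
        (‖v‖ * ‖u‖)) := by
    rw [ENNReal.ofReal_mul (by unfold potConst; positivity), ENNReal.ofReal_mul (norm_nonneg _), ofReal_norm,
      ofReal_norm, potConst, ← hc, ← Real.sqrt_mul hc0, Real.sqrt_eq_rpow,
      ← ENNReal.ofReal_rpow_of_nonneg (by positivity) (by norm_num), ENNReal.ofReal_mul hc0,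
      ENNReal.ofReal_toReal hfin]
  rw [h6, ← ofReal_norm] at h5
  exact (ENNReal.ofReal_le_ofReal_iff (by unfold potConst; positivity)).1 h5

/-! ### The potential as a bounded form on the form domain -/

/-- A real function viewed as complex-valued. -/
def cx (q : ℝ → ℝ) : ℝ → ℂ := fun x => (q x : ℂ)

/-- Truncation of a real function at height `k`. -/
def clamp (q : ℝ → ℝ) (k : ℕ) : ℝ → ℝ := fun x => max (-(k : ℝ)) (min (k : ℝ) (q x))

theorem abs_clamp_le (q : ℝ → ℝ) (k : ℕ) (x : ℝ) : |clamp q k x| ≤ k := by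
  have : (0 : ℝ) ≤ k := k.cast_nonneg
  rw [abs_le, clamp]
  exact ⟨le_max_left _ _, max_le (by linarith) (min_le_left _ _)⟩

theorem abs_clamp_le_abs (q : ℝ → ℝ) (k : ℕ) (x : ℝ) : |clamp q k x| ≤ |q x| := by
  have hk : (0 : ℝ) ≤ k := k.cast_nonneg
  rw [clamp]
  rcases le_total 0 (q x) with h | h
  · rw [abs_of_nonneg h, abs_le]
    exact ⟨(by linarith : -(q x) ≤ 0).trans (le_max_of_le_right (le_min hk h)),
      max_le (by linarith) (min_le_right _ _)⟩
  · rw [abs_of_nonpos h, abs_le]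
    have h2 : min (k : ℝ) (q x) = q x := min_eq_right (by linarith)
    rw [h2, neg_neg]
    exact ⟨le_max_right _ _, max_le (by linarith) (by linarith)⟩

theorem clamp_eventually_eq (q : ℝ → ℝ) (x : ℝ) :
    ∀ᶠ k : ℕ in Filter.atTop, clamp q k x = q x := by
  obtain ⟨N, hN⟩ := exists_nat_ge |q x|
  filter_upwards [Filter.eventually_ge_atTop N] with k hk
  have h : |q x| ≤ k := hN.trans (by exact_mod_cast hk)
  rw [abs_le] at h
  rw [clamp, min_eq_right h.2, max_eq_right h.1]

theorem aestronglyMeasurable_real {q : ℝ → ℝ} (hq : MemLp (cx q) 2 volume) :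
    AEStronglyMeasurable q volume := by
  have h := Complex.continuous_re.comp_aestronglyMeasurable hq.1
  exact h.congr (Filter.Eventually.of_forall fun x => by simp [cx])

theorem memLp_cx_of_abs_le {q r : ℝ → ℝ} (hq : MemLp (cx q) 2 volume)
    (hr : AEStronglyMeasurable r volume) (h : ∀ x, |r x| ≤ |q x|) : MemLp (cx r) 2 volume :=
  hq.of_le (Complex.continuous_ofReal.comp_aestronglyMeasurable hr)
    (Filter.Eventually.of_forall fun x => by simpa [cx] using h x)

theorem memLp_clamp {q : ℝ → ℝ} (hq : MemLp (cx q) 2 volume) (k : ℕ) :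
    MemLp (cx (clamp q k)) 2 volume := by
  refine memLp_cx_of_abs_le hq ?_ (abs_clamp_le_abs q k)
  have h := aestronglyMeasurable_real hq
  exact (aestronglyMeasurable_const (b := -(k : ℝ))).sup
    ((aestronglyMeasurable_const (b := (k : ℝ))).inf h)

theorem memLp_clamp_top {q : ℝ → ℝ} (hq : MemLp (cx q) 2 volume) (k : ℕ) :
    MemLp (cx (clamp q k)) ⊤ volume :=
  memLp_top_of_bound (memLp_clamp hq k).1 k
    (Filter.Eventually.of_forall fun x => by simpa [cx] using abs_clamp_le q k x)

theorem tendsto_clamp_sub {q : ℝ → ℝ} (hq : MemLp (cx q) 2 volume) :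
    Filter.Tendsto (fun k : ℕ => ∫ x, ‖(cx (clamp q k) - cx q) x‖ ^ 2) Filter.atTop (nhds 0) := by
  have hi := (memLp_two_iff_integrable_sq_norm hq.1).1 hq
  have h := tendsto_integral_of_dominated_convergence
    (F := fun (k : ℕ) x => ‖(cx (clamp q k) - cx q) x‖ ^ 2) (f := fun _ => (0 : ℝ))
    (fun x => 4 * ‖cx q x‖ ^ 2) (fun k => ((memLp_clamp hq k).sub hq).1.norm.pow 2)
    (hi.const_mul 4) (fun k => Filter.Eventually.of_forall fun x => ?_)
    (Filter.Eventually.of_forall fun x => ?_) (μ := volume)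
  · simpa using h
  · have h1 : ‖(cx (clamp q k) - cx q) x‖ ≤ 2 * ‖cx q x‖ := by
      refine (norm_sub_le _ _).trans ?_
      have : ‖cx (clamp q k) x‖ ≤ ‖cx q x‖ := by simpa [cx] using abs_clamp_le_abs q k x
      linarith
    rw [Real.norm_of_nonneg (by positivity)]
    calc _ ≤ (2 * ‖cx q x‖) ^ 2 := by gcongr
      _ = _ := by ring
  · refine tendsto_const_nhds.congr' ?_
    filter_upwards [clamp_eventually_eq q x] with k hk
    simp [cx, hk]

theorem sobolevNormSq_le_add {s : ℝ} {f g : ℝ → ℂ} (hf : MemLp f 2 volume)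
    (hg : MemLp g 2 volume) : sobolevNormSq s (toL2 f) ≤
      2 * sobolevNormSq s (toL2 g) + 2 * sobolevNormSq s (toL2 (f - g)) := by
  have hm : Measurable fun η : ℝ => ENNReal.ofReal ((2 * Real.pi * |η| + 1) ^ (2 * s)) := by
    fun_prop
  simp only [sobolevNormSq]
  have hmg : Measurable fun η : ℝ => 2 * (ENNReal.ofReal ((2 * Real.pi * |η| + 1) ^ (2 * s)) *
      ‖(𝓕 (toL2 g) : L2) η‖ₑ ^ 2) :=
    (hm.mul ((measurable_FT g).enorm.pow_const 2)).const_mul 2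
  rw [← lintegral_const_mul' _ _ (by norm_num), ← lintegral_const_mul' _ _ (by norm_num),
    ← lintegral_add_left hmg]
  refine lintegral_mono_ae ?_
  filter_upwards [FT_sub hf hg] with η h
  change _ * ‖FT f η‖ₑ ^ 2 ≤ 2 * (_ * ‖FT g η‖ₑ ^ 2) + 2 * (_ * ‖FT (f - g) η‖ₑ ^ 2)
  have h1 : FT f η = FT g η + FT (f - g) η := by rw [h, Pi.sub_apply]; ring
  have h2 : ‖FT f η‖ₑ ^ 2 ≤ 2 * (‖FT g η‖ₑ ^ 2 + ‖FT (f - g) η‖ₑ ^ 2) := by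
    rw [h1]
    have h3 := ENNReal.rpow_add_le_mul_rpow_add_rpow ‖FT g η‖ₑ ‖FT (f - g) η‖ₑ
      (p := 2) (by norm_num)
    norm_num at h3
    refine le_trans ?_ h3
    gcongr
    exact enorm_add_le _ _
  calc _ ≤ ENNReal.ofReal ((2 * Real.pi * |η| + 1) ^ (2 * s)) *
        (2 * (‖FT g η‖ₑ ^ 2 + ‖FT (f - g) η‖ₑ ^ 2)) := mul_le_mul_right h2 _
    _ = _ := by ring

theorem sobolevNormSq_ne_top {s : ℝ} (hs : s < 0) {Q : ℝ → ℂ} (hQ : MemLp Q 2 volume) :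
    sobolevNormSq s (toL2 Q) ≠ ⊤ :=
  ((sobolevNormSq_le hs hQ).trans_lt ENNReal.ofReal_lt_top).ne

/-- Truncations of `|q|` obey the form bound uniformly, since the negative-order norm is dominated
by the `L²` norm; Fatou's lemma passes to the limit. The order `-1/4` is an arbitrary choice in
`(-1/2, 0)`. -/
theorem integrable_abs_mul_halfRes {κ : ℝ} (hκ : 1 ≤ κ) {q : ℝ → ℝ} (hq : MemLp (cx q) 2 volume)
    (u : hardy) : Integrable
      (fun x => |q x| * ‖(halfRes (zero_lt_one.trans_le hκ) u : L2) x‖ ^ 2) := by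
  set a : ℝ → ℝ := fun x => |q x| with ha
  set w : ℝ → ℂ := ((halfRes (zero_lt_one.trans_le hκ) u : L2) : ℝ → ℂ) with hw
  have hwm : MemLp w 2 volume := Lp.memLp _
  have hwi := (memLp_two_iff_integrable_sq_norm hwm.1).1 hwm
  have haM : MemLp (cx a) 2 volume :=
    memLp_cx_of_abs_le hq (aestronglyMeasurable_real hq).norm fun x => by simp [ha]
  have hbnn : ∀ k x, 0 ≤ clamp a k x := fun k x =>
    le_max_of_le_right (le_min k.cast_nonneg (abs_nonneg _))
  have hi : ∀ k : ℕ, Integrable (fun x => clamp a k x * ‖w x‖ ^ 2) := fun k =>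
    hwi.bdd_mul (c := k) (aestronglyMeasurable_real (memLp_clamp haM k))
      (Filter.Eventually.of_forall fun x => abs_clamp_le a k x)
  set C : ℝ := potConst (-(1 / 4)) κ * Real.sqrt (∫ x, ‖cx a x‖ ^ 2) * (‖u‖ * ‖u‖) with hC
  have hiA := (memLp_two_iff_integrable_sq_norm haM.1).1 haM
  have hb : ∀ k : ℕ, ∫ x, clamp a k x * ‖w x‖ ^ 2 ≤ C := fun k => by
    have h1 := norm_integral_potential_le (s := -(1 / 4)) (by norm_num) (by norm_num) hκ
      (memLp_clamp haM k) (memLp_clamp_top haM k) u u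
    have h2 : ∫ x, cx (clamp a k) x * (conj (w x) * w x) =
        ((∫ x, clamp a k x * ‖w x‖ ^ 2 : ℝ) : ℂ) := by
      rw [← integral_complex_ofReal]
      refine integral_congr_ae (Filter.Eventually.of_forall fun x => ?_)
      simp only [cx]
      rw [Complex.conj_mul']; push_cast; rfl
    rw [← hw, h2, Complex.norm_real] at h1
    refine (Real.le_norm_self _).trans (h1.trans ?_)
    rw [hC]
    refine mul_le_mul_of_nonneg_right (mul_le_mul_of_nonneg_left ?_ (Real.sqrt_nonneg _))
      (by positivity)
    refine Real.sqrt_le_sqrt ?_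
    have h3 := ENNReal.toReal_mono ENNReal.ofReal_ne_top
      (sobolevNormSq_le (s := -(1 / 4)) (by norm_num) (memLp_clamp haM k))
    rw [ENNReal.toReal_ofReal (integral_nonneg fun x => by positivity)] at h3
    refine h3.trans (integral_mono ((memLp_two_iff_integrable_sq_norm (memLp_clamp haM k).1).1
      (memLp_clamp haM k)) hiA fun x => ?_)
    have : ‖cx (clamp a k) x‖ ≤ ‖cx a x‖ := by simpa [cx] using abs_clamp_le_abs a k x
    simp only
    gcongr
  refine integrable_of_tendsto (G := fun k x => clamp a k x * ‖w x‖ ^ 2)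
    (Filter.Eventually.of_forall fun x => ?_) (fun k => (hi k).1) ?_
  · refine tendsto_const_nhds.congr' ?_
    filter_upwards [clamp_eventually_eq a x] with k hk
    rw [hk]
  · have h4 : ∀ k : ℕ, ∫⁻ x, ‖clamp a k x * ‖w x‖ ^ 2‖ₑ ≤ ENNReal.ofReal C := fun k => by
      refine le_trans (le_of_eq ?_) (ENNReal.ofReal_le_ofReal (hb k))
      rw [ofReal_integral_eq_lintegral_ofReal (hi k)
        (Filter.Eventually.of_forall fun x => mul_nonneg (hbnn k x) (by positivity))]
      refine lintegral_congr fun x => ?_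
      rw [← ofReal_norm, Real.norm_of_nonneg (mul_nonneg (hbnn k x) (by positivity))]
    refine ((Filter.liminf_le_liminf (Filter.Eventually.of_forall h4)).trans_lt ?_).ne
    simp

theorem integrable_potential {κ : ℝ} (hκ : 1 ≤ κ) {q : ℝ → ℝ} (hq : MemLp (cx q) 2 volume)
    (v u : hardy) : Integrable (fun x => |q x| *
      (‖(halfRes (zero_lt_one.trans_le hκ) v : L2) x‖ *
        ‖(halfRes (zero_lt_one.trans_le hκ) u : L2) x‖)) := by
  refine ((integrable_abs_mul_halfRes hκ hq v).add (integrable_abs_mul_halfRes hκ hq u)).mono'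
    ((aestronglyMeasurable_real hq).norm.mul ((Lp.memLp _).1.norm.mul (Lp.memLp _).1.norm))
    (Filter.Eventually.of_forall fun x => ?_)
  rw [Real.norm_of_nonneg (by positivity), Pi.add_apply, ← mul_add]
  refine mul_le_mul_of_nonneg_left ?_ (abs_nonneg _)
  nlinarith [sq_nonneg (‖(halfRes (zero_lt_one.trans_le hκ) v : L2) x‖ -
    ‖(halfRes (zero_lt_one.trans_le hκ) u : L2) x‖), sq_nonneg
    ‖(halfRes (zero_lt_one.trans_le hκ) v : L2) x‖, sq_nonneg
    ‖(halfRes (zero_lt_one.trans_le hκ) u : L2) x‖]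

theorem integrable_potential_mul {κ : ℝ} (hκ : 1 ≤ κ) {q : ℝ → ℝ} (hq : MemLp (cx q) 2 volume)
    (v u : hardy) : Integrable (fun x => cx q x *
      (conj ((halfRes (zero_lt_one.trans_le hκ) v : L2) x) *
        (halfRes (zero_lt_one.trans_le hκ) u : L2) x)) := by
  refine (integrable_potential hκ hq v u).mono'
    (hq.1.mul ((MemLp.conj (Lp.memLp _)).1.mul (Lp.memLp _).1))
    (Filter.Eventually.of_forall fun x => ?_)
  simp [cx]

/-- Truncation need not decrease an `H^s` norm of negative order, so the truncated norm is compared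
with that of `q` up to an `L²` error tending to zero. The factor `2` comes from `|a + b|² ≤ 2|a|² +
2|b|²`. -/
theorem norm_integral_potential_real_le {s κ : ℝ} (hs : -(1 / 2) < s) (hs' : s < 0) (hκ : 1 ≤ κ)
    {q : ℝ → ℝ} (hq : MemLp (cx q) 2 volume) (v u : hardy) :
    ‖∫ x, cx q x * (conj ((halfRes (zero_lt_one.trans_le hκ) v : L2) x) *
      (halfRes (zero_lt_one.trans_le hκ) u : L2) x)‖ ≤
      potConst s κ * Real.sqrt (2 * (sobolevNormSq s (toL2 (cx q))).toReal) * (‖v‖ * ‖u‖) := by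
  set V : ℝ → ℂ := ((halfRes (zero_lt_one.trans_le hκ) v : L2) : ℝ → ℂ) with hV
  set U : ℝ → ℂ := ((halfRes (zero_lt_one.trans_le hκ) u : L2) : ℝ → ℂ) with hU
  have hVm : MemLp V 2 volume := Lp.memLp _
  have hUm : MemLp U 2 volume := Lp.memLp _
  have h1 : Filter.Tendsto (fun k : ℕ => ∫ x, cx (clamp q k) x * (conj (V x) * U x)) Filter.atTop
      (nhds (∫ x, cx q x * (conj (V x) * U x))) := by
    refine tendsto_integral_of_dominated_convergence _
      (fun k => (memLp_clamp hq k).1.mul ((MemLp.conj hVm).1.mul hUm.1))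
      (integrable_potential hκ hq v u)
      (fun k => Filter.Eventually.of_forall fun x => ?_)
      (Filter.Eventually.of_forall fun x => ?_)
    · rw [norm_mul, norm_mul, RCLike.norm_conj]
      have : ‖cx (clamp q k) x‖ ≤ |q x| := by simpa [cx] using abs_clamp_le_abs q k x
      gcongr
    · refine tendsto_const_nhds.congr' ?_
      filter_upwards [clamp_eventually_eq q x] with k hk
      simp [cx, hk]
  have hN := sobolevNormSq_ne_top hs' hq
  have h2 : ∀ k : ℕ, ‖∫ x, cx (clamp q k) x * (conj (V x) * U x)‖ ≤ potConst s κ *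
      Real.sqrt (2 * (sobolevNormSq s (toL2 (cx q))).toReal +
        2 * ∫ x, ‖(cx (clamp q k) - cx q) x‖ ^ 2) * (‖v‖ * ‖u‖) := fun k => by
    refine (norm_integral_potential_le hs hs' hκ (memLp_clamp hq k)
      (memLp_clamp_top hq k) v u).trans ?_
    refine mul_le_mul_of_nonneg_right (mul_le_mul_of_nonneg_left ?_ (Real.sqrt_nonneg _))
      (by positivity)
    refine Real.sqrt_le_sqrt ?_
    have hd := (memLp_clamp hq k).sub hq
    have h3 := sobolevNormSq_le_add (s := s) (memLp_clamp hq k) hq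
    have h4 := sobolevNormSq_le hs' hd
    have h5 : 0 ≤ ∫ x, ‖(cx (clamp q k) - cx q) x‖ ^ 2 := integral_nonneg fun x => by positivity
    have h6 := h3.trans (add_le_add_right (mul_le_mul_right h4 2) _)
    have h7 : 2 * sobolevNormSq s (toL2 (cx q)) +
        2 * ENNReal.ofReal (∫ x, ‖(cx (clamp q k) - cx q) x‖ ^ 2) =
        ENNReal.ofReal (2 * (sobolevNormSq s (toL2 (cx q))).toReal +
        2 * ∫ x, ‖(cx (clamp q k) - cx q) x‖ ^ 2) := by
      rw [ENNReal.ofReal_add (by positivity) (by positivity), ENNReal.ofReal_mul (by norm_num),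
        ENNReal.ofReal_mul (by norm_num), ENNReal.ofReal_toReal hN]
      norm_num
    rw [h7] at h6
    exact ENNReal.toReal_le_of_le_ofReal (by positivity) h6
  have h3 : Filter.Tendsto (fun k : ℕ => potConst s κ *
      Real.sqrt (2 * (sobolevNormSq s (toL2 (cx q))).toReal +
        2 * ∫ x, ‖(cx (clamp q k) - cx q) x‖ ^ 2) * (‖v‖ * ‖u‖)) Filter.atTop
      (nhds (potConst s κ * Real.sqrt (2 * (sobolevNormSq s (toL2 (cx q))).toReal + 2 * 0) *
        (‖v‖ * ‖u‖))) :=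
    (((Real.continuous_sqrt.tendsto _).comp
      (((tendsto_clamp_sub hq).const_mul 2).const_add _)).const_mul _).mul_const _
  rw [mul_zero, add_zero] at h3
  exact le_of_tendsto_of_tendsto' h1.norm h3 h2

/-- The potential conjugated by the half-resolvent, as a bounded sesquilinear form. -/
def potFormL {κ : ℝ} (hκ : 1 ≤ κ) {q : ℝ → ℝ} (hq : MemLp (cx q) 2 volume) :
    hardy →L⋆[ℂ] hardy →L[ℂ] ℂ :=
  LinearMap.mkContinuous₂ (LinearMap.mk₂'ₛₗ (starRingEnd ℂ) (RingHom.id ℂ)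
    (fun v u : hardy => ∫ x, cx q x * (conj ((halfRes (zero_lt_one.trans_le hκ) v : L2) x) *
      (halfRes (zero_lt_one.trans_le hκ) u : L2) x))
    (fun v₁ v₂ u => by
      rw [← integral_add (integrable_potential_mul hκ hq v₁ u) (integrable_potential_mul hκ hq v₂ u)]
      refine integral_congr_ae ?_
      rw [map_add]
      filter_upwards [Lp.coeFn_add (halfRes (zero_lt_one.trans_le hκ) v₁ : L2)
        (halfRes (zero_lt_one.trans_le hκ) v₂ : L2)] with x hx
      rw [Submodule.coe_add, hx, Pi.add_apply, map_add]; ring)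
    (fun c v u => by
      rw [smul_eq_mul, ← integral_const_mul]
      refine integral_congr_ae ?_
      rw [map_smul]
      filter_upwards [Lp.coeFn_smul c (halfRes (zero_lt_one.trans_le hκ) v : L2)] with x hx
      rw [Submodule.coe_smul, hx, Pi.smul_apply, smul_eq_mul, map_mul]; ring)
    (fun v u₁ u₂ => by
      rw [← integral_add (integrable_potential_mul hκ hq v u₁) (integrable_potential_mul hκ hq v u₂)]
      refine integral_congr_ae ?_
      rw [map_add]
      filter_upwards [Lp.coeFn_add (halfRes (zero_lt_one.trans_le hκ) u₁ : L2)
        (halfRes (zero_lt_one.trans_le hκ) u₂ : L2)] with x hx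
      rw [Submodule.coe_add, hx, Pi.add_apply]; ring)
    (fun c v u => by
      rw [RingHom.id_apply, smul_eq_mul, ← integral_const_mul]
      refine integral_congr_ae ?_
      rw [map_smul]
      filter_upwards [Lp.coeFn_smul c (halfRes (zero_lt_one.trans_le hκ) u : L2)] with x hx
      rw [Submodule.coe_smul, hx, Pi.smul_apply, smul_eq_mul]; ring))
    -- Any order in `(-1/2, 0)` serves to define the operator; `norm_potOp_le` recovers the bound
    -- for every such `s`.
    (potConst (-(1 / 4)) κ * Real.sqrt (2 * (sobolevNormSq (-(1 / 4)) (toL2 (cx q))).toReal))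
    (fun v u => by
      rw [mul_assoc]
      exact norm_integral_potential_real_le (by norm_num) (by norm_num) hκ hq v u)

/-- The potential conjugated by the half-resolvent, `(-i∂ₓ+κ)^{-1/2} q (-i∂ₓ+κ)^{-1/2}`. -/
def potOp {κ : ℝ} (hκ : 1 ≤ κ) {q : ℝ → ℝ} (hq : MemLp (cx q) 2 volume) : hardy →L[ℂ] hardy :=
  InnerProductSpace.continuousLinearMapOfBilin (potFormL hκ hq)

theorem potOp_inner {κ : ℝ} (hκ : 1 ≤ κ) {q : ℝ → ℝ} (hq : MemLp (cx q) 2 volume) (v u : hardy) :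
    inner ℂ (potOp hκ hq v) u =
      ∫ x, cx q x * (conj ((halfRes (zero_lt_one.trans_le hκ) v : L2) x) *
        (halfRes (zero_lt_one.trans_le hκ) u : L2) x) :=
  InnerProductSpace.continuousLinearMapOfBilin_apply _ _ _

theorem inner_potOp {κ : ℝ} (hκ : 1 ≤ κ) {q : ℝ → ℝ} (hq : MemLp (cx q) 2 volume) (v u : hardy) :
    inner ℂ v (potOp hκ hq u) =
      ∫ x, cx q x * (conj ((halfRes (zero_lt_one.trans_le hκ) v : L2) x) *
        (halfRes (zero_lt_one.trans_le hκ) u : L2) x) := by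
  rw [← inner_conj_symm (𝕜 := ℂ) v _, potOp_inner, ← integral_conj]
  refine integral_congr_ae (Filter.Eventually.of_forall fun x => ?_)
  simp only [map_mul, Complex.conj_conj, cx, Complex.conj_ofReal]
  ring

theorem potOp_symm {κ : ℝ} (hκ : 1 ≤ κ) {q : ℝ → ℝ} (hq : MemLp (cx q) 2 volume) (v u : hardy) :
    inner ℂ (potOp hκ hq v) u = inner ℂ v (potOp hκ hq u) := by
  rw [potOp_inner, inner_potOp]

theorem norm_potOp_le {s κ : ℝ} (hs : -(1 / 2) < s) (hs' : s < 0) (hκ : 1 ≤ κ)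
    {q : ℝ → ℝ} (hq : MemLp (cx q) 2 volume) :
    ‖potOp hκ hq‖ ≤
      potConst s κ * Real.sqrt (2 * (sobolevNormSq s (toL2 (cx q))).toReal) := by
  have hc : 0 ≤ potConst s κ * Real.sqrt (2 * (sobolevNormSq s (toL2 (cx q))).toReal) :=
    mul_nonneg (Real.sqrt_nonneg _) (Real.sqrt_nonneg _)
  refine ContinuousLinearMap.opNorm_le_bound _ hc fun u => ?_
  have h1 := norm_integral_potential_real_le hs hs' hκ hq (potOp hκ hq u) u
  have h2 : inner ℂ (potOp hκ hq u) (potOp hκ hq u) = ((‖potOp hκ hq u‖ ^ 2 : ℝ) : ℂ) := by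
    rw [Complex.ofReal_pow]
    exact inner_self_eq_norm_sq_to_K (𝕜 := ℂ) (potOp hκ hq u)
  rw [← inner_potOp hκ hq, h2, Complex.norm_real, Real.norm_of_nonneg (by positivity)] at h1
  rcases eq_or_lt_of_le (norm_nonneg (potOp hκ hq u)) with h | h
  · rw [← h]; positivity
  · refine le_of_mul_le_mul_left ?_ h
    nlinarith

theorem potOp_add_smul {κ : ℝ} (hκ : 1 ≤ κ) {q f r : ℝ → ℝ} (hq : MemLp (cx q) 2 volume)
    (hf : MemLp (cx f) 2 volume) (hr : MemLp (cx r) 2 volume) (θ : ℝ)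
    (h : r = fun x => q x + θ * f x) : potOp hκ hr = potOp hκ hq + (θ : ℂ) • potOp hκ hf := by
  refine ContinuousLinearMap.ext fun u => ext_inner_left ℂ fun v => ?_
  rw [add_apply, smul_apply, inner_add_right,
    inner_smul_right, inner_potOp, inner_potOp, inner_potOp, ← integral_const_mul,
    ← integral_add (integrable_potential_mul hκ hq v u)
      ((integrable_potential_mul hκ hf v u).const_mul _)]
  refine integral_congr_ae (Filter.Eventually.of_forall fun x => ?_)
  simp only [cx, h]
  push_cast; ring

/-! ### The resolvent of the Lax operator -/

theorem hardy_inner_conj_symm (u v : hardy) : conj (inner ℂ u v : ℂ) = inner ℂ v u :=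
  inner_conj_symm (𝕜 := ℂ) (E := hardy) v u

theorem hardy_inner_sub_left (u v w : hardy) :
    (inner ℂ (u - v) w : ℂ) = inner ℂ u w - inner ℂ v w :=
  inner_sub_left (𝕜 := ℂ) (E := hardy) u v w

theorem hardy_inner_sub_right (u v w : hardy) :
    (inner ℂ u (v - w) : ℂ) = inner ℂ u v - inner ℂ u w :=
  inner_sub_right (𝕜 := ℂ) (E := hardy) u v w

theorem hardy_inner_add_left (u v w : hardy) :
    (inner ℂ (u + v) w : ℂ) = inner ℂ u w + inner ℂ v w :=
  inner_add_left (𝕜 := ℂ) (E := hardy) u v w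

theorem hardy_inner_add_right (u v w : hardy) :
    (inner ℂ u (v + w) : ℂ) = inner ℂ u v + inner ℂ u w :=
  inner_add_right (𝕜 := ℂ) (E := hardy) u v w

theorem hardy_inner_smul_left (c : ℂ) (u v : hardy) :
    (inner ℂ (c • u) v : ℂ) = conj c * inner ℂ u v :=
  inner_smul_left (𝕜 := ℂ) (E := hardy) u v c

theorem hardy_inner_smul_right (c : ℂ) (u v : hardy) :
    (inner ℂ u (c • v) : ℂ) = c * inner ℂ u v :=
  inner_smul_right (𝕜 := ℂ) (E := hardy) u v c

theorem conj_laxForm (q : ℝ → ℝ) (v u : hardy) : conj (laxForm q v u) = laxForm q u v := by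
  rw [laxForm, laxForm, map_sub, ← integral_conj, ← integral_conj]
  congr 1 <;> refine integral_congr_ae (Filter.Eventually.of_forall fun x => ?_)
  · simp only [map_mul, Complex.conj_conj, Complex.conj_ofReal]; ring
  · simp only [map_mul, Complex.conj_conj, Complex.conj_ofReal]; ring

theorem IsLaxResolvent.graph {κ : ℝ} {q : ℝ → ℝ} {T : hardy →L[ℂ] hardy}
    (h : IsLaxResolvent κ q T) (f : hardy) : LaxGraph q (T f) (f - (κ : ℂ) • T f) :=
  (h f (T f)).1 rfl

theorem IsLaxResolvent.unique {κ : ℝ} {q : ℝ → ℝ} {T T' : hardy →L[ℂ] hardy}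
    (h : IsLaxResolvent κ q T) (h' : IsLaxResolvent κ q T') : T = T' :=
  ContinuousLinearMap.ext fun f => ((h' f (T f)).2 (h.graph f)).symm

theorem isLaxResolvent_laxResolvent {κ : ℝ} {q : ℝ → ℝ} {T : hardy →L[ℂ] hardy}
    (h : IsLaxResolvent κ q T) : IsLaxResolvent κ q (laxResolvent κ q) := by
  have hex : ∃ T, IsLaxResolvent κ q T := ⟨T, h⟩
  rw [laxResolvent, dif_pos hex]
  exact hex.choose_spec

theorem IsLaxResolvent.symm {κ : ℝ} {q : ℝ → ℝ} {T : hardy →L[ℂ] hardy}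
    (h : IsLaxResolvent κ q T) (f g : hardy) : inner ℂ (T f) g = inner ℂ f (T g) := by
  have h1 := (h.graph g).2 (T f) (h.graph f).1
  have h2 := (h.graph f).2 (T g) (h.graph g).1
  have h3 := congrArg conj h2
  have h4 : conj (inner ℂ (T g) (f - (κ : ℂ) • T f)) = inner ℂ (f - (κ : ℂ) • T f) (T g) :=
    hardy_inner_conj_symm _ _
  rw [conj_laxForm, h1, h4, hardy_inner_sub_left, hardy_inner_sub_right, hardy_inner_smul_left,
    hardy_inner_smul_right, Complex.conj_ofReal] at h3
  exact sub_left_injective h3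

/-- The equation for `S f` at `k` is an equation at `κ` with source `f + (κ - k) S f`; uniqueness of
its solution gives the identity. -/
theorem IsLaxResolvent.identity {κ k : ℝ} {q : ℝ → ℝ} {T S : hardy →L[ℂ] hardy}
    (h : IsLaxResolvent κ q T) (h' : IsLaxResolvent k q S) (f : hardy) :
    S f - T f = ((κ - k : ℝ) : ℂ) • T (S f) := by
  have h1 := h'.graph f
  have e : f - (k : ℂ) • S f = (f + ((κ - k : ℝ) : ℂ) • S f) - (κ : ℂ) • S f := by
    push_cast; rw [sub_smul]; abel
  rw [e] at h1
  have h2 := (h _ _).2 h1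
  rw [map_add, map_smul] at h2
  exact sub_eq_iff_eq_add'.2 h2.symm

theorem IsLaxResolvent.comm {κ k : ℝ} {q : ℝ → ℝ} {T S : hardy →L[ℂ] hardy}
    (h : IsLaxResolvent κ q T) (h' : IsLaxResolvent k q S) (f : hardy) :
    T (S f) = S (T f) := by
  rcases eq_or_ne κ k with rfl | hne
  · rw [h.unique h']
  · have h1 := h.identity h' f
    have h2 := h'.identity h f
    have h3 : ((κ - k : ℝ) : ℂ) • T (S f) = ((κ - k : ℝ) : ℂ) • S (T f) := by
      rw [← h1, ← neg_sub (T f), h2, ← neg_smul, ← Complex.ofReal_neg, neg_sub]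
    exact smul_right_injective hardy
      (by exact_mod_cast sub_ne_zero.2 hne : ((κ - k : ℝ) : ℂ) ≠ 0) h3

theorem laxForm_halfRes {κ : ℝ} (hκ : 1 ≤ κ) {q : ℝ → ℝ} (hq : MemLp (cx q) 2 volume)
    (v u : hardy) : laxForm q (halfRes (zero_lt_one.trans_le hκ) v)
      (halfRes (zero_lt_one.trans_le hκ) u) =
      inner ℂ v ((1 - potOp hκ hq) u) - κ * inner ℂ (halfRes (zero_lt_one.trans_le hκ) v)
        (halfRes (zero_lt_one.trans_le hκ) u) := by
  have h := kinetic_halfRes (zero_lt_one.trans_le hκ) v u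
  have h2 := inner_potOp hκ hq v u
  rw [laxForm, sub_apply, hardy_inner_sub_right, h2, one_apply_eq_self, ← h]
  simp only [cx]
  ring

/-- The resolvent `A (1 - B)⁻¹ A` with `A = (-i∂ₓ+κ)^{-1/2}` and `B = A q A`. -/
def resolventOp {κ : ℝ} (hκ : 1 ≤ κ) {q : ℝ → ℝ} (hq : MemLp (cx q) 2 volume) :
    hardy →L[ℂ] hardy :=
  (halfRes (zero_lt_one.trans_le hκ)).comp ((Ring.inverse (1 - potOp hκ hq)).comp
    (halfRes (zero_lt_one.trans_le hκ)))

/-- Testing with `A v'` and writing the unknown as `A u'` turns the form equation into `(1 - B) u' =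
A f`, which the Neumann series solves uniquely. -/
theorem isLaxResolvent_resolventOp {κ : ℝ} (hκ : 1 ≤ κ) {q : ℝ → ℝ} (hq : MemLp (cx q) 2 volume)
    (hB : ‖potOp hκ hq‖ < 1) : IsLaxResolvent κ q (resolventOp hκ hq) := by
  have hκ0 := zero_lt_one.trans_le hκ
  have hU : IsUnit (1 - potOp hκ hq) := 
    isUnit_one_sub_of_norm_lt_one (R := hardy →L[ℂ] hardy) hB
  have i1 : ∀ x, (1 - potOp hκ hq) (Ring.inverse (1 - potOp hκ hq) x) = x := fun x =>
    congrArg (fun T : hardy →L[ℂ] hardy => T x) (Ring.mul_inverse_cancel _ hU)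
  have i2 : ∀ x, Ring.inverse (1 - potOp hκ hq) ((1 - potOp hκ hq) x) = x := fun x =>
    congrArg (fun T : hardy →L[ℂ] hardy => T x) (Ring.inverse_mul_cancel _ hU)
  intro f u
  constructor
  · rintro rfl
    refine ⟨(memFormDomain_iff hκ0 _).2 ⟨_, rfl⟩, fun v hv => ?_⟩
    obtain ⟨v', rfl⟩ := (memFormDomain_iff hκ0 v).1 hv
    rw [resolventOp, ContinuousLinearMap.comp_apply, ContinuousLinearMap.comp_apply,
      laxForm_halfRes hκ hq, i1, ← halfRes_symm, hardy_inner_sub_right, hardy_inner_smul_right]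
  · rintro ⟨hu, h⟩
    obtain ⟨u', rfl⟩ := (memFormDomain_iff hκ0 u).1 hu
    have h1 : (1 - potOp hκ hq) u' = halfRes hκ0 f := by
      refine ext_inner_left ℂ fun v' => ?_
      have h2 := h (halfRes hκ0 v') ((memFormDomain_iff hκ0 _).2 ⟨v', rfl⟩)
      rw [laxForm_halfRes hκ hq, hardy_inner_sub_right, hardy_inner_smul_right, sub_left_inj,
        halfRes_symm hκ0 v' f] at h2
      exact h2
    rw [resolventOp, ContinuousLinearMap.comp_apply, ContinuousLinearMap.comp_apply, ← h1, i2]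

theorem laxResolvent_eq {κ : ℝ} (hκ : 1 ≤ κ) {q : ℝ → ℝ} (hq : MemLp (cx q) 2 volume)
    (hB : ‖potOp hκ hq‖ < 1) : laxResolvent κ q = resolventOp hκ hq :=
  have h := isLaxResolvent_resolventOp hκ hq hB
  (isLaxResolvent_laxResolvent h).unique h

/-! ### Regularity of the range of the resolvent -/

theorem HasD.memFormDomain {u u' : ℝ → ℂ} (hu : Har u) (hd : HasD u u') :
    MemFormDomain hu.toHardy := by
  have hpi := Real.pi_pos
  have i1 := (memLp_two_iff_integrable_sq_norm (memLp_FT u).1).1 (memLp_FT u)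
  have i2 := (memLp_two_iff_integrable_sq_norm (memLp_FT u').1).1 (memLp_FT u')
  have i3 := (i1.const_mul 2).add i2
  rw [MemFormDomain, sobolevNormSq]
  refine lt_of_le_of_lt (lintegral_mono_ae ?_) i3.2
  filter_upwards [hd.2.2] with η h
  change _ * ‖FT u η‖ₑ ^ 2 ≤ _
  rw [← ofReal_norm, ← ENNReal.ofReal_pow (norm_nonneg _), ← ENNReal.ofReal_mul (by positivity),
    ← ofReal_norm]
  refine ENNReal.ofReal_le_ofReal ?_
  have h0 : 0 ≤ (2 * ‖FT u η‖ ^ 2 + ‖FT u' η‖ ^ 2 : ℝ) := by positivity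
  change _ ≤ ‖2 * ‖FT u η‖ ^ 2 + ‖FT u' η‖ ^ 2‖
  rw [Real.norm_of_nonneg h0, h]
  have h2 : ‖2 * Real.pi * Complex.I * η * FT u η‖ = 2 * Real.pi * |η| * ‖FT u η‖ := by
    simp [abs_of_pos hpi]
  have h3 : (2 * Real.pi * |η| + 1) ^ (2 * (1 / 2) : ℝ) = 2 * Real.pi * |η| + 1 := by norm_num
  rw [h2, h3, mul_pow, ← add_mul]
  refine mul_le_mul_of_nonneg_right ?_ (by positivity)
  nlinarith [sq_nonneg (2 * Real.pi * |η| - 1)]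

theorem integral_cj_mul_potential {q : ℝ → ℝ} {v u : ℝ → ℂ} (hv : Har v)
    (hqu : MemLp (cx q * u) 2 volume) : ∫ x, cx q x * (conj (v x) * u x) =
      ∫ x, conj (v x) * cplus (cx q * u) x := by
  rw [integral_cj_har_mul_cplus hv hqu]
  refine integral_congr_ae (Filter.Eventually.of_forall fun x => ?_)
  simp only [Pi.mul_apply]; ring

/-- The passage from equations holding almost everywhere to the operator: for `u` in `H¹` the
product `q u` is in `L²`, and pairing with a Hardy function does not see the insertion of `C₊`. -/
theorem laxGraph_of_hasD {q : ℝ → ℝ} (hq : MemLp (cx q) 2 volume) {u u' : ℝ → ℂ}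
    (hu : Har u) (hd : HasD u u') {g : hardy}
    (h : -Complex.I • u' - cplus (cx q * u) =ᵐ[volume] ((g : L2) : ℝ → ℂ)) :
    LaxGraph q hu.toHardy g := by
  refine ⟨hd.memFormDomain hu, fun v _ => ?_⟩
  have hqu : MemLp (cx q * u) 2 volume := MemLp.mul_top hq hd.memLp_top
  have e1 : (∫ η : ℝ, ((2 * Real.pi * η : ℝ) : ℂ) * (conj ((𝓕 (v : L2) : L2) η) *
      (𝓕 (hu.toHardy : L2) : L2) η)) = ∫ x, conj ((v : L2) x) * (-Complex.I • u') x := by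
    rw [plancherel (Lp.memLp _) (hd.2.1.const_smul _), ← FT_coeFn, ← FT_coeFn,
      FT_congr hu.coeFn_toHardy]
    refine integral_congr_ae ?_
    filter_upwards [FT_smul (-Complex.I) hd.2.1, hd.2.2] with η h1 h2
    rw [h1, Pi.smul_apply, h2, smul_eq_mul]
    push_cast
    linear_combination (2 * Real.pi * η * conj (FT (v : L2) η) * FT u η) * Complex.I_sq
  have e2 : ∫ x : ℝ, (q x : ℂ) * (conj ((v : L2) x) * (hu.toHardy : L2) x) =
      ∫ x, conj ((v : L2) x) * cplus (cx q * u) x := by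
    rw [← integral_cj_mul_potential (har_coe v) hqu]
    refine integral_congr_ae ?_
    filter_upwards [hu.coeFn_toHardy] with x hx
    rw [hx]; rfl
  rw [laxForm, e1, e2, inner_hardy, ← integral_sub]
  · refine integral_congr_ae ?_
    filter_upwards [h] with x hx
    rw [← hx, Pi.sub_apply]; ring
  · exact MemLp.integrable_mul_two (MemLp.conj (Lp.memLp _)) (hd.2.1.const_smul _)
  · exact MemLp.integrable_mul_two (MemLp.conj (Lp.memLp _)) (har_cplus _).1

theorem norm_toL2_sq {f : ℝ → ℂ} (hf : MemLp f 2 volume) :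
    ‖toL2 f‖ ^ 2 = ∫ x, ‖f x‖ ^ 2 := by
  have h1 : inner ℂ (toL2 f) (toL2 f) = ((‖toL2 f‖ ^ 2 : ℝ) : ℂ) := by
    rw [Complex.ofReal_pow]
    exact inner_self_eq_norm_sq_to_K (𝕜 := ℂ) (toL2 f)
  have h2 := inner_toL2 hf hf
  rw [h1] at h2
  simp_rw [Complex.conj_mul', ← Complex.ofReal_pow] at h2
  rw [integral_complex_ofReal] at h2
  exact_mod_cast h2

theorem norm_szego_le (f : L2) : ‖szego f‖ ≤ ‖f‖ := by
  have h1 : inner ℂ (szego f : L2) (szego f : L2) = inner ℂ (szego f : L2) f := by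
    rw [inner_eq_integral, inner_eq_integral]
    have h := integral_cj_har_mul_cplus (har_coe (szego f)) (Lp.memLp f)
    rw [cplus, toL2_coeFn] at h
    exact h
  have h2 : inner ℂ (szego f : L2) (szego f : L2) = ((‖(szego f : L2)‖ ^ 2 : ℝ) : ℂ) := by
    rw [Complex.ofReal_pow]
    exact inner_self_eq_norm_sq_to_K (𝕜 := ℂ) (szego f : L2)
  have h3 := norm_inner_le_norm (𝕜 := ℂ) (szego f : L2) f
  rw [← h1, h2, Complex.norm_real, Real.norm_of_nonneg (by positivity)] at h3
  change ‖(szego f : L2)‖ ≤ ‖f‖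
  rcases eq_or_lt_of_le (norm_nonneg (szego f : L2)) with h | h
  · rw [← h]; positivity
  · exact le_of_mul_le_mul_left (by nlinarith) h

theorem szego_add (f g : L2) : szego (f + g) = szego f + szego g := by
  refine hardy_ext ?_
  have h := cplus_add (Lp.memLp f) (Lp.memLp g)
  rw [cplus, cplus, cplus, toL2_add (Lp.memLp f) (Lp.memLp g), toL2_coeFn, toL2_coeFn] at h
  exact h.trans (Lp.coeFn_add _ _).symm

theorem szego_smul (c : ℂ) (f : L2) : szego (c • f) = c • szego f := by
  refine hardy_ext ?_
  have h := cplus_smul c (Lp.memLp f)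
  rw [cplus, cplus, toL2_smul c (Lp.memLp f), toL2_coeFn] at h
  exact h.trans (Lp.coeFn_smul _ _).symm

theorem FT_halfRes_halfRes {κ : ℝ} (hκ : 0 < κ) (w : hardy) : ∀ᵐ η : ℝ, 0 < η →
    FT (halfRes hκ (halfRes hκ w) : L2) η = ((2 * Real.pi * η + κ : ℝ) : ℂ)⁻¹ * FT (w : L2) η := by
  filter_upwards [FT_halfRes hκ w, FT_halfRes hκ (halfRes hκ w)] with η h1 h2 h0
  rw [h2, Pi.mul_apply, h1, Pi.mul_apply, ← mul_assoc, halfSymbol_mul_self hκ h0]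

/-- Cauchy–Schwarz on the Fourier side; the constant is the square root of `∫ (2πη + κ)⁻² dη = κ⁻¹ /
(2π)` over `η > 0`. -/
theorem norm_halfRes_halfRes_le {κ : ℝ} (hκ : 0 < κ) (w : hardy) :
    MemLp (halfRes hκ (halfRes hκ w) : L2) ⊤ volume ∧ ∀ᵐ x,
      ‖(halfRes hκ (halfRes hκ w) : L2) x‖ ≤ Real.sqrt (κ⁻¹ / (2 * Real.pi)) * ‖w‖ := by
  have hpi := Real.pi_pos
  set u := halfRes hκ (halfRes hκ w) with hu
  have h1 : ∫⁻ η, ‖FT (u : L2) η‖ₑ ≤ ENNReal.ofReal (Real.sqrt (κ⁻¹ / (2 * Real.pi)) * ‖w‖) := by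
    have h2 : ∫⁻ η, ‖FT (u : L2) η‖ₑ = ∫⁻ η, ((fun η => (tailSymbol κ 1 η) ^ (1 / 2 : ℝ)) *
        fun η => ‖FT (w : L2) η‖ₑ) η := by
      refine lintegral_congr_ae ?_
      filter_upwards [FT_halfRes_halfRes hκ w, (har_coe u).2, Measure.ae_ne volume 0]
        with η k1 k2 k3
      rcases lt_or_gt_of_ne k3 with h0 | h0
      · rw [k2 h0, Pi.mul_apply, tailSymbol, Set.indicator_of_notMem (by simpa using h0.le)]
        simp
      · have hp := symbol_pos hκ h0
        rw [hu, k1 h0, Pi.mul_apply, tailSymbol, Set.indicator_of_mem (Set.mem_Ioi.2 h0),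
          enorm_mul, ← ofReal_norm, norm_inv, Complex.norm_real, Real.norm_of_nonneg hp.le,
          ENNReal.ofReal_rpow_of_nonneg (Real.rpow_nonneg hp.le _) (by norm_num),
          ← Real.rpow_mul hp.le]
        norm_num
        rw [Real.rpow_neg_one]
    rw [h2]
    refine (ENNReal.lintegral_mul_le_Lp_mul_Lq volume Real.HolderConjugate.two_two
      ((measurable_tailSymbol κ 1).pow_const _).aemeasurable
      (measurable_FT _).enorm.aemeasurable).trans (le_of_eq ?_)
    rw [← enorm_hardy, ENNReal.ofReal_mul (Real.sqrt_nonneg _), ofReal_norm]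
    congr 1
    simp_rw [← ENNReal.rpow_mul]
    norm_num
    rw [lintegral_tailSymbol hκ one_pos, Real.sqrt_eq_rpow,
      ENNReal.ofReal_rpow_of_nonneg (by positivity) (by norm_num), Real.rpow_neg_one]
    norm_num
  have hi : Integrable (FT (u : L2)) := ⟨(memLp_FT _).1, h1.trans_lt ENNReal.ofReal_lt_top⟩
  have hb := norm_le_integral_FT (Lp.memLp (u : L2)) hi
  refine ⟨memLp_top_of_bound (Lp.memLp (u : L2)).1 _ hb, ?_⟩
  have h3 : ∫ η, ‖FT (u : L2) η‖ ≤ Real.sqrt (κ⁻¹ / (2 * Real.pi)) * ‖w‖ := by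
    rw [integral_norm_eq_lintegral_enorm hi.1]
    exact ENNReal.toReal_le_of_le_ofReal (by positivity) h1
  filter_upwards [hb] with x hx using hx.trans h3

/-- The operator `C₊ q (-i∂ₓ+κ)^{-1}` on the Hardy space. -/
def potRes {κ : ℝ} (hκ : 0 < κ) {q : ℝ → ℝ} (hq : MemLp (cx q) 2 volume) :
    hardy →L[ℂ] hardy :=
  LinearMap.mkContinuous
    { toFun := fun w => szego (toL2 (cx q * ((halfRes hκ (halfRes hκ w) : L2) : ℝ → ℂ)))
      map_add' := fun w₁ w₂ => by
        rw [← szego_add, ← toL2_add (MemLp.mul_top hq (norm_halfRes_halfRes_le hκ w₁).1)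
          (MemLp.mul_top hq (norm_halfRes_halfRes_le hκ w₂).1), map_add, map_add]
        congr 1
        refine toL2_congr ?_
        filter_upwards [Lp.coeFn_add (halfRes hκ (halfRes hκ w₁) : L2)
          (halfRes hκ (halfRes hκ w₂) : L2)] with x hx
        rw [Pi.mul_apply, Submodule.coe_add, hx]
        simp only [Pi.add_apply, Pi.mul_apply]; ring
      map_smul' := fun c w => by
        rw [RingHom.id_apply, ← szego_smul,
          ← toL2_smul c (MemLp.mul_top hq (norm_halfRes_halfRes_le hκ w).1), map_smul, map_smul]
        congr 1
        refine toL2_congr ?_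
        filter_upwards [Lp.coeFn_smul c (halfRes hκ (halfRes hκ w) : L2)] with x hx
        rw [Pi.mul_apply, Submodule.coe_smul, hx]
        simp only [Pi.smul_apply, Pi.mul_apply, smul_eq_mul]; ring }
    (‖toL2 (cx q)‖ * Real.sqrt (κ⁻¹ / (2 * Real.pi))) (fun w => by
      obtain ⟨hm, hb⟩ := norm_halfRes_halfRes_le hκ w
      refine (norm_szego_le _).trans ?_
      have hpos : 0 ≤ ‖toL2 (cx q)‖ * Real.sqrt (κ⁻¹ / (2 * Real.pi)) * ‖w‖ := by positivity
      refine abs_le_of_sq_le_sq' ?_ hpos |>.2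
      have hm2 := MemLp.mul_top hq hm
      rw [norm_toL2_sq hm2]
      have h1 : (‖toL2 (cx q)‖ * Real.sqrt (κ⁻¹ / (2 * Real.pi)) * ‖w‖) ^ 2 =
          ∫ x, (Real.sqrt (κ⁻¹ / (2 * Real.pi)) * ‖w‖) ^ 2 * ‖cx q x‖ ^ 2 := by
        rw [integral_const_mul, ← norm_toL2_sq hq]; ring
      rw [h1]
      refine integral_mono_ae ((memLp_two_iff_integrable_sq_norm hm2.1).1 hm2)
        (((memLp_two_iff_integrable_sq_norm hq.1).1 hq).const_mul _) ?_
      filter_upwards [hb] with x hx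
      rw [Pi.mul_apply, norm_mul, mul_pow, mul_comm]
      gcongr)

theorem norm_potRes_le {κ : ℝ} (hκ : 0 < κ) {q : ℝ → ℝ} (hq : MemLp (cx q) 2 volume) :
    ‖potRes hκ hq‖ ≤ ‖toL2 (cx q)‖ * Real.sqrt (κ⁻¹ / (2 * Real.pi)) :=
  LinearMap.mkContinuous_norm_le _ (by positivity) _

/-- For large `κ` the equation `(𝓛 + κ) u = f` has a differentiable solution. -/
theorem exists_hasD_solution {κ : ℝ} (hκ : 0 < κ) {q : ℝ → ℝ} (hq : MemLp (cx q) 2 volume)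
    (hV : ‖potRes hκ hq‖ < 1) (f : hardy) : ∃ u u' : ℝ → ℂ, Har u ∧ HasD u u' ∧
      -Complex.I • u' + (κ : ℂ) • u - cplus (cx q * u) =ᵐ[volume] ((f : L2) : ℝ → ℂ) := by
  have hU : IsUnit (1 - potRes hκ hq) := 
    isUnit_one_sub_of_norm_lt_one (R := hardy →L[ℂ] hardy) hV
  set w := Ring.inverse (1 - potRes hκ hq) f with hw
  have i1 : (1 - potRes hκ hq) w = f :=
    congrArg (fun T : hardy →L[ℂ] hardy => T f) (Ring.mul_inverse_cancel _ hU)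
  obtain ⟨u, u', hu, hd, he, hF⟩ := exists_free_resolvent hκ (har_coe w)
  have e1 : u =ᵐ[volume] ((halfRes hκ (halfRes hκ w) : L2) : ℝ → ℂ) := by
    refine hu.ae_eq (har_coe _) ?_
    filter_upwards [hF, FT_halfRes_halfRes hκ w] with η h1 h2 h0
    rw [h1 h0, h2 h0]
  refine ⟨u, u', hu, hd, ?_⟩
  have e2 : cplus (cx q * u) = ((potRes hκ hq w : L2) : ℝ → ℂ) := by
    have : cplus (cx q * u) = cplus (cx q * ((halfRes hκ (halfRes hκ w) : L2) : ℝ → ℂ)) := by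
      refine cplus_congr ?_
      filter_upwards [e1] with x hx
      rw [Pi.mul_apply, Pi.mul_apply, hx]
    rw [this]; rfl
  rw [sub_apply, one_apply_eq_self] at i1
  rw [e2, ← i1]
  filter_upwards [he, Lp.coeFn_sub (w : L2) (potRes hκ hq w : L2)] with x h1 h2
  rw [Submodule.coe_sub, h2, Pi.sub_apply, Pi.sub_apply, h1]

/-- The resolvent at any admissible `κ` maps into `H¹`, where the equation holds pointwise. -/
theorem IsLaxResolvent.hasD {κ : ℝ} {q : ℝ → ℝ} (hq : MemLp (cx q) 2 volume)
    {T : hardy →L[ℂ] hardy} (h : IsLaxResolvent κ q T)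
    (hlarge : ∀ K : ℝ, ∃ κ' : ℝ, K ≤ κ' ∧ ∃ S, IsLaxResolvent κ' q S) (f : hardy) :
    ∃ u' : ℝ → ℂ, HasD (T f : L2) u' ∧
      -Complex.I • u' + (κ : ℂ) • ((T f : L2) : ℝ → ℂ) - cplus (cx q * ((T f : L2) : ℝ → ℂ))
        =ᵐ[volume] ((f : L2) : ℝ → ℂ) := by
  have hpi := Real.pi_pos
  -- The squared norm of `C₊ q (-i∂ₓ + κ')⁻¹` is at most `‖q‖² / (2πκ')`, so `κ' ≥ ‖q‖² + 1` makes
  -- its Neumann series converge.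
  obtain ⟨κ', hκ', S, hS⟩ := hlarge (‖toL2 (cx q)‖ ^ 2 + 1)
  have hκ'0 : 0 < κ' := by nlinarith [sq_nonneg ‖toL2 (cx q)‖]
  have hV : ‖potRes hκ'0 hq‖ < 1 := by
    refine (norm_potRes_le hκ'0 hq).trans_lt ?_
    refine (abs_lt_of_sq_lt_sq ?_ zero_le_one).trans_le' (le_abs_self _)
    rw [mul_pow, Real.sq_sqrt (by positivity), one_pow, ← mul_div_assoc, div_lt_one (by positivity),
      ← div_eq_mul_inv, div_lt_iff₀ hκ'0]
    nlinarith [Real.pi_gt_three, sq_nonneg ‖toL2 (cx q)‖]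
  have hid := hS.identity h f
  -- By the resolvent identity `T f = S g`, so regularity at the large parameter `κ'` transfers to
  -- `κ`.
  set g : hardy := f + ((κ' - κ : ℝ) : ℂ) • T f with hg
  have hTS : T f = S g := by
    rw [hg, map_add, map_smul, ← hid]; abel
  obtain ⟨u, u', hu, hd, he⟩ := exists_hasD_solution hκ'0 hq hV g
  have hgr : LaxGraph q hu.toHardy (g - (κ' : ℂ) • hu.toHardy) := by
    refine laxGraph_of_hasD hq hu hd ?_
    filter_upwards [he, Lp.coeFn_sub (g : L2) ((κ' : ℂ) • (hu.toHardy : L2)),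
      Lp.coeFn_smul (κ' : ℂ) (hu.toHardy : L2), hu.coeFn_toHardy] with x h1 h2 h3 h4
    rw [Submodule.coe_sub, Submodule.coe_smul, h2]
    simp only [Pi.sub_apply, Pi.add_apply, Pi.smul_apply] at h1 h3 ⊢
    rw [h3, h4, ← h1]; ring
  have hSu : T f = hu.toHardy := by rw [hTS]; exact (hS _ _).2 hgr
  have hae : ((T f : L2) : ℝ → ℂ) =ᵐ[volume] u := by rw [hSu]; exact hu.coeFn_toHardy
  refine ⟨u', hd.congr hae.symm Filter.EventuallyEq.rfl, ?_⟩
  have hc : cplus (cx q * ((T f : L2) : ℝ → ℂ)) = cplus (cx q * u) := by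
    refine cplus_congr ?_
    filter_upwards [hae] with x hx
    rw [Pi.mul_apply, Pi.mul_apply, hx]
  rw [hc]
  filter_upwards [he, hae, Lp.coeFn_add (f : L2) (((κ' - κ : ℝ) : ℂ) • (T f : L2)),
    Lp.coeFn_smul ((κ' - κ : ℝ) : ℂ) (T f : L2)] with x h1 h2 h3 h4
  rw [hg, Submodule.coe_add, Submodule.coe_smul, h3, Pi.add_apply, h4, Pi.smul_apply, h2] at h1
  simp only [Pi.sub_apply, Pi.add_apply, Pi.smul_apply, smul_eq_mul] at h1 ⊢
  rw [h2]
  push_cast at h1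
  linear_combination h1

/-! ### Admissible spectral parameters -/

/-- The perturbation series for the resolvent of the Lax operator converges at `κ`. -/
def Admissible (κ : ℝ) (q : ℝ → ℝ) : Prop :=
  ∃ (hκ : 1 ≤ κ) (hq : MemLp (cx q) 2 volume), ‖potOp hκ hq‖ < 1

theorem Admissible.isLaxResolvent {κ : ℝ} {q : ℝ → ℝ} (h : Admissible κ q) :
    IsLaxResolvent κ q (laxResolvent κ q) := by
  obtain ⟨hκ, hq, hB⟩ := h
  exact isLaxResolvent_laxResolvent (isLaxResolvent_resolventOp hκ hq hB)

theorem tendsto_potConst {s : ℝ} (hs : -(1 / 2) < s) :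
    Filter.Tendsto (potConst s) Filter.atTop (nhds 0) := by
  have h1 : Filter.Tendsto (fun κ : ℝ => κ ^ (-(1 + 2 * s)) / (Real.pi * (1 + 2 * s)))
      Filter.atTop (nhds 0) := by
    have := (tendsto_rpow_neg_atTop (y := 1 + 2 * s) (by linarith)).div_const
      (Real.pi * (1 + 2 * s))
    rwa [zero_div] at this
  have h2 := (Real.continuous_sqrt.tendsto 0).comp h1
  rw [Real.sqrt_zero] at h2
  exact h2

/-- The bound on `B` involves only `s`, `κ` and the `H^s` norm of `q`, and it tends to zero as `κ →
∞`; hence the threshold is uniform on the ball of radius `A`. -/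
theorem exists_admissible_threshold {s : ℝ} (hs : -(1 / 2) < s) (hs' : s < 0) (A : ℝ) :
    ∃ κ₁ : ℝ, 1 ≤ κ₁ ∧ ∀ q : ℝ → ℝ, MemLp (cx q) 2 volume →
      sobolevNormSq s (toL2 (cx q)) ≤ ENNReal.ofReal (A ^ 2) → ∀ κ, κ₁ ≤ κ → Admissible κ q := by
  have h1 := (tendsto_potConst hs).mul_const (Real.sqrt (2 * A ^ 2))
  rw [zero_mul] at h1
  obtain ⟨K, hK⟩ := Filter.eventually_atTop.1 (h1.eventually (gt_mem_nhds zero_lt_one))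
  refine ⟨max 1 K, le_max_left _ _, fun q hq hA κ hκ => ?_⟩
  have h2 := hK κ ((le_max_right _ _).trans hκ)
  refine ⟨(le_max_left _ _).trans hκ, hq, (norm_potOp_le hs hs' _ hq).trans_lt
    (lt_of_le_of_lt ?_ h2)⟩
  have h3 : (sobolevNormSq s (toL2 (cx q))).toReal ≤ A ^ 2 :=
    ENNReal.toReal_le_of_le_ofReal (sq_nonneg A) hA
  exact mul_le_mul_of_nonneg_left (Real.sqrt_le_sqrt (by linarith)) (Real.sqrt_nonneg _)

/-! ### The derivative of the resolvent in the potential -/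

theorem eventually_norm_add_smul_lt_one {E : Type*} [NormedAddCommGroup E] [NormedSpace ℂ E]
    {B : E} (hB : ‖B‖ < 1) (V : E) : ∀ᶠ θ : ℝ in nhds 0, ‖B + (θ : ℂ) • V‖ < 1 := by
  have hc : Continuous fun θ : ℝ => ‖B + (θ : ℂ) • V‖ := by fun_prop
  exact hc.continuousAt.eventually (gt_mem_nhds (by simpa using hB))

theorem hasDerivAt_inverse_one_sub {E : Type*} [NormedAddCommGroup E] [InnerProductSpace ℂ E]
    [CompleteSpace E] (B V : E →L[ℂ] E) (hB : ‖B‖ < 1) (y x : E) :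
    HasDerivAt (fun θ : ℝ => (inner ℂ y (Ring.inverse (1 - (B + (θ : ℂ) • V)) x) : ℂ))
      (inner ℂ y (Ring.inverse (1 - B) (V (Ring.inverse (1 - B) x)))) 0 := by
  have hlin : HasDerivAt (fun z : ℂ => (1 : E →L[ℂ] E) - (B + z • V)) (-V) 0 := by
    have := (((hasDerivAt_id (0 : ℂ)).smul_const V).const_add B).const_sub (1 : E →L[ℂ] E)
    simpa using this
  set U : (E →L[ℂ] E)ˣ := Units.oneSub B hB with hU
  have hU1 : (U : E →L[ℂ] E) = 1 - B := rfl
  have hJU : ((U⁻¹ : (E →L[ℂ] E)ˣ) : E →L[ℂ] E) = Ring.inverse (1 - B) := by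
    rw [← hU1, Ring.inverse_unit]
  have h1 := hasFDerivAt_ringInverse (𝕜 := ℂ) U
  have h2 : (U : E →L[ℂ] E) = 1 - (B + (0 : ℂ) • V) := by rw [hU1, zero_smul, add_zero]
  rw [h2] at h1
  have h3 := h1.comp_hasDerivAt (0 : ℂ) hlin
  have h4 := ((innerSL ℂ y).comp
    (ContinuousLinearMap.apply ℂ E x)).hasFDerivAt.comp_hasDerivAt (0 : ℂ) h3
  have h5 : HasDerivAt (fun z : ℂ => (inner ℂ y (Ring.inverse (1 - (B + z • V)) x) : ℂ))
      (inner ℂ y (Ring.inverse (1 - B) (V (Ring.inverse (1 - B) x)))) ((0 : ℝ) : ℂ) := by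
    refine HasDerivAt.congr_deriv (by rw [Complex.ofReal_zero]; exact h4) ?_
    simp [hJU]
  exact h5.comp_ofReal

theorem inverse_one_sub_symm {κ : ℝ} (hκ : 1 ≤ κ) {q : ℝ → ℝ} (hq : MemLp (cx q) 2 volume)
    (hB : ‖potOp hκ hq‖ < 1) (u v : hardy) :
    inner ℂ (Ring.inverse (1 - potOp hκ hq) u) v =
      inner ℂ u (Ring.inverse (1 - potOp hκ hq) v) := by
  have hU : IsUnit (1 - potOp hκ hq) :=
    isUnit_one_sub_of_norm_lt_one (R := hardy →L[ℂ] hardy) hB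
  have i1 : ∀ x, (1 - potOp hκ hq) (Ring.inverse (1 - potOp hκ hq) x) = x := fun x =>
    congrArg (fun T : hardy →L[ℂ] hardy => T x) (Ring.mul_inverse_cancel _ hU)
  have key : ∀ a b : hardy, inner ℂ a ((1 - potOp hκ hq) b) = inner ℂ ((1 - potOp hκ hq) a) b := by
    intro a b
    rw [sub_apply, sub_apply, one_apply_eq_self, one_apply_eq_self, hardy_inner_sub_left,
      hardy_inner_sub_right, potOp_symm]
  have h := key (Ring.inverse (1 - potOp hκ hq) u) (Ring.inverse (1 - potOp hκ hq) v)
  rw [i1, i1] at h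
  exact h

/-- `B = A q A` is affine in `q`, so the derivative of `A (1 - B)⁻¹ A` along `f` is formally `R f
R`. The condition `‖B‖ < 1` is open, so the factorization also holds for the perturbed potential
when `θ` is small. -/
theorem hasDerivAt_inner_laxResolvent {κ : ℝ} {q f : ℝ → ℝ} (h : Admissible κ q)
    (hf : MemLp (cx f) 2 volume) (g₁ g₂ : hardy) :
    HasDerivAt (fun θ : ℝ => (inner ℂ g₁ (laxResolvent κ (fun x => q x + θ * f x) g₂) : ℂ))
      (∫ x, cx f x * (conj ((laxResolvent κ q g₁ : L2) x) * (laxResolvent κ q g₂ : L2) x)) 0 := by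
  obtain ⟨hκ, hq, hB⟩ := h
  have hκ0 := zero_lt_one.trans_le hκ
  set J := Ring.inverse (1 - potOp hκ hq) with hJ
  have hval : (∫ x, cx f x * (conj ((laxResolvent κ q g₁ : L2) x) *
      (laxResolvent κ q g₂ : L2) x)) =
      inner ℂ (halfRes hκ0 g₁) (J (potOp hκ hf (J (halfRes hκ0 g₂)))) := by
    rw [laxResolvent_eq hκ hq hB, ← inverse_one_sub_symm hκ hq hB, inner_potOp]
    rfl
  have hsc : HasDerivAt (fun θ : ℝ => (inner ℂ (halfRes hκ0 g₁)
      (Ring.inverse ((1 : hardy →L[ℂ] hardy) - (potOp hκ hq + (θ : ℂ) • potOp hκ hf))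
        (halfRes hκ0 g₂)) : ℂ))
      (inner ℂ (halfRes hκ0 g₁) (J (potOp hκ hf (J (halfRes hκ0 g₂))))) 0 :=
    hasDerivAt_inverse_one_sub (E := hardy) _ _ hB _ _
  rw [hval]
  refine hsc.congr_of_eventuallyEq ?_
  have hev := eventually_norm_add_smul_lt_one (E := hardy →L[ℂ] hardy) hB (potOp hκ hf)
  filter_upwards [hev] with θ hθ
  have hr : MemLp (cx fun x => q x + θ * f x) 2 volume := by
    have := hq.add (hf.const_smul (θ : ℂ))
    refine this.ae_eq (Filter.Eventually.of_forall fun x => ?_)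
    simp [cx]
  have he := potOp_add_smul hκ hq hf hr θ rfl
  rw [laxResolvent_eq hκ hr (by rw [he]; exact hθ), resolventOp, he,
    ContinuousLinearMap.comp_apply, ContinuousLinearMap.comp_apply, ← halfRes_symm]

theorem hasDerivAt_inner_laxResolvent_affine {κ : ℝ} {q f : ℝ → ℝ} (h : Admissible κ q)
    (hf : MemLp (cx f) 2 volume) (g₁ f₁ g₂ f₂ : hardy) :
    HasDerivAt (fun θ : ℝ => (inner ℂ (g₁ + (θ : ℂ) • f₁)
        (laxResolvent κ (fun x => q x + θ * f x) (g₂ + (θ : ℂ) • f₂)) : ℂ))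
      (inner ℂ f₁ (laxResolvent κ q g₂) + inner ℂ g₁ (laxResolvent κ q f₂) +
        ∫ x, cx f x * (conj ((laxResolvent κ q g₁ : L2) x) * (laxResolvent κ q g₂ : L2) x)) 0 := by
  have hθ : HasDerivAt (fun θ : ℝ => (θ : ℂ)) 1 0 := Complex.ofRealCLM.hasDerivAt
  have h0 : (fun x => q x + (0 : ℝ) * f x) = q := by funext x; ring
  have e : (fun θ : ℝ => (inner ℂ (g₁ + (θ : ℂ) • f₁)
        (laxResolvent κ (fun x => q x + θ * f x) (g₂ + (θ : ℂ) • f₂)) : ℂ)) =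
      fun θ : ℝ => (inner ℂ g₁ (laxResolvent κ (fun x => q x + θ * f x) g₂) : ℂ) +
        (θ : ℂ) * (inner ℂ f₁ (laxResolvent κ (fun x => q x + θ * f x) g₂) : ℂ) +
        (θ : ℂ) * (inner ℂ g₁ (laxResolvent κ (fun x => q x + θ * f x) f₂) : ℂ) +
        (θ : ℂ) * ((θ : ℂ) * (inner ℂ f₁ (laxResolvent κ (fun x => q x + θ * f x) f₂) : ℂ)) := by
    funext θ
    rw [map_add, map_smul, hardy_inner_add_left, hardy_inner_add_right, hardy_inner_add_right,
      hardy_inner_smul_left, hardy_inner_smul_left, hardy_inner_smul_right, hardy_inner_smul_right,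
      Complex.conj_ofReal]
    ring
  rw [e]
  refine ((((hasDerivAt_inner_laxResolvent h hf g₁ g₂).add
    (hθ.mul (hasDerivAt_inner_laxResolvent h hf f₁ g₂))).add
    (hθ.mul (hasDerivAt_inner_laxResolvent h hf g₁ f₂))).add
    (hθ.mul (hθ.mul (hasDerivAt_inner_laxResolvent h hf f₁ f₂)))).congr_deriv ?_
  simp only [h0, Complex.ofReal_zero, Pi.mul_apply]
  ring

/-! ### The functional derivatives -/

theorem memLp_of_memWeightedL2 {f : ℝ → ℝ} (h : MemWeightedL2 f) :
    MemLp (cx f) 2 volume ∧ MemLp (coord * cx f) 2 volume := by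
  have hpos : ∀ x, 0 < japaneseBracket x := fun x => Real.sqrt_pos.2 (by positivity)
  have hcont : Continuous japaneseBracket := by unfold japaneseBracket; fun_prop
  have hm : AEStronglyMeasurable f volume := by
    have := (hcont.inv₀ fun x => (hpos x).ne').aestronglyMeasurable.mul
      (μ := volume) h.1
    refine this.congr (Filter.Eventually.of_forall fun x => ?_)
    simp only [Pi.mul_apply, Pi.inv_apply]
    exact inv_mul_cancel_left₀ (hpos x).ne' _
  have hmc : AEStronglyMeasurable (cx f) volume :=
    Complex.continuous_ofReal.comp_aestronglyMeasurable hm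
  refine ⟨h.of_le hmc (Filter.Eventually.of_forall fun x => ?_), h.of_le
    ((show Continuous coord from Complex.continuous_ofReal).aestronglyMeasurable.mul hmc)
    (Filter.Eventually.of_forall fun x => ?_)⟩
  · have h1 : 1 ≤ japaneseBracket x := Real.one_le_sqrt.2 (by nlinarith [sq_nonneg x])
    rw [norm_mul, cx, Complex.norm_real, Real.norm_of_nonneg (hpos x).le]
    nlinarith [norm_nonneg (f x)]
  · have h1 : |x| ≤ japaneseBracket x := Real.abs_le_sqrt (by linarith)
    rw [norm_mul, Pi.mul_apply, norm_mul, cx, coord, Complex.norm_real, Complex.norm_real,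
      Real.norm_of_nonneg (hpos x).le, Real.norm_eq_abs]
    exact mul_le_mul_of_nonneg_right h1 (norm_nonneg _)

theorem inner_szego {g : ℝ → ℂ} (hg : MemLp g 2 volume) (u : hardy) :
    inner ℂ (szego (toL2 g)) u = ∫ x, conj (g x) * (u : L2) x := by
  rw [← hardy_inner_conj_symm, inner_hardy]
  have h := integral_cj_har_mul_cplus (har_coe u) hg
  rw [cplus] at h
  rw [h, ← integral_conj]
  refine integral_congr_ae (Filter.Eventually.of_forall fun x => ?_)
  simp only [map_mul, Complex.conj_conj]; ring

theorem inner_qPlus {q : ℝ → ℝ} (hq : MemLp (cx q) 2 volume) (u : hardy) :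
    inner ℂ (qPlus q) u = ∫ x, cx q x * (u : L2) x := by
  have h := inner_szego hq u
  simp only [cx, Complex.conj_ofReal] at h
  exact h

/-- The Hardy projection of `x q`. -/
def xqPlus (q : ℝ → ℝ) : hardy := szego (toL2 (coord * cx q))

theorem inner_xqPlus {q : ℝ → ℝ} (hxq : MemLp (coord * cx q) 2 volume) (u : hardy) :
    inner ℂ (xqPlus q) u = ∫ x, (coord x * cx q x) * (u : L2) x := by
  have h := inner_szego hxq u
  simp only [cx, coord, Pi.mul_apply, map_mul, Complex.conj_ofReal] at h
  exact h

theorem szego_toL2_add_smul {f g h : ℝ → ℂ} (hf : MemLp f 2 volume) (hg : MemLp g 2 volume)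
    (c : ℂ) (e : h = f + c • g) : szego (toL2 h) = szego (toL2 f) + c • szego (toL2 g) := by
  rw [e, toL2_add hf (hg.const_smul c), toL2_smul c hg, szego_add, szego_smul]

theorem qPlus_add_smul {q f : ℝ → ℝ} (hq : MemLp (cx q) 2 volume) (hf : MemLp (cx f) 2 volume)
    (θ : ℝ) : qPlus (fun x => q x + θ * f x) = qPlus q + (θ : ℂ) • qPlus f :=
  szego_toL2_add_smul hq hf θ (by funext x; simp [cx])

theorem xqPlus_add_smul {q f : ℝ → ℝ} (hq : MemLp (coord * cx q) 2 volume)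
    (hf : MemLp (coord * cx f) 2 volume) (θ : ℝ) :
    xqPlus (fun x => q x + θ * f x) = xqPlus q + (θ : ℂ) • xqPlus f :=
  szego_toL2_add_smul hq hf θ (by funext x; simp [cx]; ring)

theorem memLp_add_smul {q f : ℝ → ℝ} (hq : MemLp (cx q) 2 volume) (hf : MemLp (cx f) 2 volume)
    (θ : ℝ) : MemLp (cx fun x => q x + θ * f x) 2 volume :=
  (hq.add (hf.const_smul (θ : ℂ))).ae_eq (Filter.Eventually.of_forall fun x => by simp [cx])

theorem beta_eq {q : ℝ → ℝ} (hq : MemLp (cx q) 2 volume) (κ : ℝ) :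
    beta κ q = inner ℂ (qPlus q) (laxResolvent κ q (qPlus q)) := by
  rw [inner_qPlus hq]; rfl

theorem cofBeta_eq {q : ℝ → ℝ} (hxq : MemLp (coord * cx q) 2 volume) (k : ℝ) :
    cofBeta k q = (1 / 2) * (inner ℂ (xqPlus q) (laxResolvent k q (qPlus q)) +
      conj (inner ℂ (xqPlus q) (laxResolvent k q (qPlus q)) : ℂ)) := by
  rw [inner_xqPlus hxq, ← integral_conj, ← integral_add, cofBeta]
  · congr 1
    refine integral_congr_ae (Filter.Eventually.of_forall fun x => ?_)
    simp only [map_mul, coord, cx, Complex.conj_ofReal, gauge]; ring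
  · exact MemLp.integrable_mul_two hxq (Lp.memLp _)
  · simpa using MemLp.integrable_mul_two (MemLp.cj hxq)
      (MemLp.cj (Lp.memLp (laxResolvent k q (qPlus q) : L2)))

/-- In `⟨q₊, R q₊⟩` the variations of the two vectors give `m` and `conj m`, and that of the
resolvent gives `|m|²`. -/
theorem isFunctionalDeriv_beta {κ : ℝ} {q : ℝ → ℝ} (h : Admissible κ q) {m : ℝ → ℂ}
    (hm : m = ((laxResolvent κ q (qPlus q) : L2) : ℝ → ℂ)) (hmt : MemLp m ⊤ volume) :
    IsFunctionalDeriv (beta κ) q (m + cj m + cj m * m) := by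
  have hm2 : MemLp m 2 volume := by rw [hm]; exact Lp.memLp _
  have hmm := MemLp.mul_top (MemLp.cj hm2) hmt
  refine ⟨(hm2.add (MemLp.cj hm2)).add hmm, fun f hf => ?_⟩
  obtain ⟨hf2, -⟩ := memLp_of_memWeightedL2 hf
  have hq := h.choose_spec.choose
  have hd := hasDerivAt_inner_laxResolvent_affine h hf2 (qPlus q) (qPlus f) (qPlus q) (qPlus f)
  have e : (fun θ : ℝ => beta κ (fun x => q x + θ * f x)) = fun θ : ℝ =>
      (inner ℂ (qPlus q + (θ : ℂ) • qPlus f) (laxResolvent κ (fun x => q x + θ * f x)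
        (qPlus q + (θ : ℂ) • qPlus f)) : ℂ) := by
    funext θ
    rw [beta_eq (memLp_add_smul hq hf2 θ), qPlus_add_smul hq hf2]
  rw [e]
  refine hd.congr_deriv ?_
  have h1 : (inner ℂ (qPlus q) (laxResolvent κ q (qPlus f)) : ℂ) = ∫ x, cj m x * cx f x := by
    rw [← h.isLaxResolvent.symm, ← hardy_inner_conj_symm, inner_qPlus hf2, ← integral_conj, ← hm]
    refine integral_congr_ae (Filter.Eventually.of_forall fun x => ?_)
    simp only [map_mul, cx, Complex.conj_ofReal, cj_apply]; ring
  have i1 := MemLp.integrable_mul_two hm2 hf2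
  have i2 := MemLp.integrable_mul_two (MemLp.cj hm2) hf2
  have i3 := MemLp.integrable_mul_two hmm hf2
  rw [h1, inner_qPlus hf2, ← hm]
  have e1 : ∫ x, cx f x * m x = ∫ x, m x * cx f x := by simp_rw [mul_comm]
  have e2 : ∫ x, cx f x * (conj (m x) * m x) = ∫ x, (cj m * m) x * cx f x := by
    refine integral_congr_ae (Filter.Eventually.of_forall fun x => ?_)
    simp only [Pi.mul_apply, cj_apply]; ring
  rw [e1, e2, ← integral_add i1 i2, ← integral_add (by exact i1.add i2) i3]
  refine integral_congr_ae (Filter.Eventually.of_forall fun x => ?_)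
  simp only [Pi.add_apply, cx, Pi.mul_apply]; ring

/-- In `⟨(xq)₊, R q₊⟩` the variations of the left vector, the right vector and the resolvent give
`xn`, `conj w` and `conj w · n`; these are then averaged with their conjugates. Square-integrability
is required only of `xn + conj (xn)`, since `xn` alone may tend to a nonzero imaginary constant. -/
theorem isFunctionalDeriv_cofBeta {k : ℝ} {q : ℝ → ℝ} (h : Admissible k q)
    (hxq : MemLp (coord * cx q) 2 volume) {n w : ℝ → ℂ}
    (hn : n = ((laxResolvent k q (qPlus q) : L2) : ℝ → ℂ))
    (hw : w = ((laxResolvent k q (xqPlus q) : L2) : ℝ → ℂ)) (hnt : MemLp n ⊤ volume)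
    (hxn : MemLp (coord * n + cj (coord * n)) 2 volume) :
    IsFunctionalDeriv (cofBeta k) q ((1 / 2 : ℂ) • ((coord * n + cj (coord * n)) +
      ((cj w + w) + (cj w * n + w * cj n)))) := by
  have hn2 : MemLp n 2 volume := by rw [hn]; exact Lp.memLp _
  have hw2 : MemLp w 2 volume := by rw [hw]; exact Lp.memLp _
  have hww := (MemLp.cj hw2).add hw2
  have hwn := (MemLp.mul_top (MemLp.cj hw2) hnt).add (MemLp.mul_top hw2 (MemLp.cj hnt))
  refine ⟨(hxn.add (hww.add hwn)).const_smul _, fun f hf => ?_⟩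
  obtain ⟨hf2, hxf⟩ := memLp_of_memWeightedL2 hf
  have hq := h.choose_spec.choose
  have hd := hasDerivAt_inner_laxResolvent_affine h hf2 (xqPlus q) (xqPlus f) (qPlus q) (qPlus f)
  have e : (fun θ : ℝ => cofBeta k (fun x => q x + θ * f x)) = fun θ : ℝ =>
      (1 / 2 : ℂ) * ((inner ℂ (xqPlus q + (θ : ℂ) • xqPlus f)
        (laxResolvent k (fun x => q x + θ * f x) (qPlus q + (θ : ℂ) • qPlus f)) : ℂ) +
        conj (inner ℂ (xqPlus q + (θ : ℂ) • xqPlus f)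
        (laxResolvent k (fun x => q x + θ * f x) (qPlus q + (θ : ℂ) • qPlus f)) : ℂ)) := by
    funext θ
    have hxr : MemLp (coord * cx fun x => q x + θ * f x) 2 volume := by
      refine (hxq.add (hxf.const_smul (θ : ℂ))).ae_eq (Filter.Eventually.of_forall fun x => ?_)
      simp [cx]; ring
    rw [cofBeta_eq hxr, qPlus_add_smul hq hf2, xqPlus_add_smul hxq hxf]
  rw [e]
  refine ((hd.add (Complex.conjCLE.hasFDerivAt.comp_hasDerivAt (0 : ℝ) hd)).const_mul
    (1 / 2 : ℂ)).congr_deriv ?_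
  have h1 : (inner ℂ (xqPlus q) (laxResolvent k q (qPlus f)) : ℂ) = ∫ x, cj w x * cx f x := by
    rw [← h.isLaxResolvent.symm, ← hardy_inner_conj_symm, inner_qPlus hf2, ← integral_conj, ← hw]
    refine integral_congr_ae (Filter.Eventually.of_forall fun x => ?_)
    simp only [map_mul, cx, Complex.conj_ofReal, cj_apply]; ring
  rw [h1, inner_xqPlus hxf, ← hn, ← hw]
  have i1 : Integrable fun x => coord x * cx f x * n x := MemLp.integrable_mul_two hxf hn2
  have i2 := MemLp.integrable_mul_two (MemLp.cj hw2) hf2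
  have i3 : Integrable fun x => cx f x * (conj (w x) * n x) :=
    MemLp.integrable_mul_two hf2 (MemLp.mul_top (MemLp.cj hw2) hnt)
  have e2 : (∫ x, coord x * cx f x * n x) + (∫ x, cj w x * cx f x) +
      (∫ x, cx f x * (conj (w x) * n x)) =
      ∫ x, (coord x * n x + cj w x + cj w x * n x) * cx f x := by
    rw [← integral_add i1 i2, ← integral_add (by exact i1.add i2) i3]
    refine integral_congr_ae (Filter.Eventually.of_forall fun x => ?_)
    simp only [cj_apply]; ring
  have i4 : Integrable fun x => (coord x * n x + cj w x + cj w x * n x) * cx f x := by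
    refine ((i1.add i2).add i3).congr (Filter.Eventually.of_forall fun x => ?_)
    simp only [cj_apply, Pi.add_apply]; ring
  have i5 : Integrable fun x => conj ((coord x * n x + cj w x + cj w x * n x) * cx f x) :=
    (Complex.conjCLE.integrable_comp_iff).2 i4
  rw [e2]
  change (1 / 2 : ℂ) * (_ + conj _) = _
  rw [← integral_conj, ← integral_add i4 i5, ← integral_const_mul]
  refine integral_congr_ae (Filter.Eventually.of_forall fun x => ?_)
  simp only [map_mul, map_add, cj_apply, Complex.conj_conj, Pi.smul_apply, Pi.add_apply,
    Pi.mul_apply, smul_eq_mul, cx, Complex.conj_ofReal]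
  ring

/-! ### The derivative in the spectral parameter -/

/-- Near `κ` the resolvent identity gives `R(κ') = (1 - (κ - κ') R(κ))⁻¹ R(κ)`, so the derivative of
the Neumann inverse applies with `B = 0` and `V = R(κ)`. -/
theorem hasDerivAt_inner_laxResolvent_param {κ₁ κ : ℝ} {q : ℝ → ℝ}
    (hA : ∀ κ', κ₁ < κ' → Admissible κ' q) (hκ : κ₁ < κ) (y f : hardy) :
    HasDerivAt (fun κ' : ℝ => (inner ℂ y (laxResolvent κ' q f) : ℂ))
      (-inner ℂ y (laxResolvent κ q (laxResolvent κ q f))) κ := by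
  set T := laxResolvent κ q with hT
  have hTr := (hA κ hκ).isLaxResolvent
  have h1 := hasDerivAt_inverse_one_sub (E := hardy) 0 T
    ((norm_zero (E := hardy →L[ℂ] hardy)).trans_lt zero_lt_one) y (T f)
  have h2 : HasDerivAt (fun κ' : ℝ => κ - κ') (-1) κ := by
    simpa using (hasDerivAt_id κ).const_sub κ
  rw [show (0 : ℝ) = κ - κ by ring] at h1
  have h3 := h1.scomp κ h2
  have h5 : Ring.inverse (1 - 0 : hardy →L[ℂ] hardy) = 1 := by rw [sub_zero, Ring.inverse_one]
  rw [h5, one_apply_eq_self, one_apply_eq_self, neg_one_smul] at h3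
  refine h3.congr_of_eventuallyEq ?_
  have hev := eventually_norm_add_smul_lt_one (E := hardy →L[ℂ] hardy) (B := 0)
    ((norm_zero (E := hardy →L[ℂ] hardy)).trans_lt zero_lt_one) T
  have hc : Filter.Tendsto (fun κ' : ℝ => κ - κ') (nhds κ) (nhds 0) := by
    have hcont : Continuous fun κ' : ℝ => κ - κ' := by fun_prop
    exact (sub_self κ) ▸ hcont.tendsto κ
  filter_upwards [hc.eventually hev, lt_mem_nhds hκ] with κ' hn hκ'
  have hU : IsUnit (1 - (0 + ((κ - κ' : ℝ) : ℂ) • T)) :=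
    isUnit_one_sub_of_norm_lt_one (R := hardy →L[ℂ] hardy) hn
  have i2 : ∀ x, Ring.inverse (1 - (0 + ((κ - κ' : ℝ) : ℂ) • T))
      ((1 - (0 + ((κ - κ' : ℝ) : ℂ) • T)) x) = x := fun x =>
    congrArg (fun T : hardy →L[ℂ] hardy => T x) (Ring.inverse_mul_cancel _ hU)
  have hid := hTr.identity (hA κ' hκ').isLaxResolvent f
  have h6 : (1 - (0 + ((κ - κ' : ℝ) : ℂ) • T)) (laxResolvent κ' q f) = T f := by
    rw [zero_add, sub_apply, one_apply_eq_self, smul_apply, ← hid]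
    abel
  change _ = inner ℂ y (Ring.inverse (1 - (0 + ((κ - κ' : ℝ) : ℂ) • T)) (T f))
  rw [← h6, i2]

/-- Off the diagonal this is the resolvent identity, on the diagonal the derivative of the resolvent
in its parameter; a single formula covers both. -/
theorem dslope_beta {κ₁ κ k : ℝ} {q : ℝ → ℝ} (hA : ∀ κ', κ₁ < κ' → Admissible κ' q)
    (hκ : κ₁ < κ) (hk : κ₁ < k) : dslope (fun κ' : ℝ => beta κ' q) k κ =
      -inner ℂ (qPlus q) (laxResolvent κ q (laxResolvent k q (qPlus q))) := by
  have hq := (hA κ hκ).choose_spec.choose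
  have hβ : (fun κ' : ℝ => beta κ' q) =
      fun κ' : ℝ => (inner ℂ (qPlus q) (laxResolvent κ' q (qPlus q)) : ℂ) := by
    funext κ'; exact beta_eq hq κ'
  rw [hβ]
  rcases eq_or_ne κ k with rfl | hne
  · rw [dslope_same, (hasDerivAt_inner_laxResolvent_param hA hκ _ _).deriv]
  · have hid := (hA κ hκ).isLaxResolvent.identity (hA k hk).isLaxResolvent (qPlus q)
    have hne' : κ - k ≠ 0 := sub_ne_zero.2 hne
    have h1 := congrArg (fun v => (inner ℂ (qPlus q) v : ℂ)) hid
    simp only [hardy_inner_sub_right, hardy_inner_smul_right] at h1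
    rw [dslope_of_ne _ hne, slope_def_module,
      ← neg_sub (inner ℂ (qPlus q) (laxResolvent k q (qPlus q))), h1, smul_neg, Complex.real_smul,
      ← mul_assoc, ← Complex.ofReal_mul, inv_mul_cancel₀ hne', Complex.ofReal_one, one_mul]

theorem hasDerivAt_dslope_beta {κ₁ κ k : ℝ} {q : ℝ → ℝ} (hA : ∀ κ', κ₁ < κ' → Admissible κ' q)
    (hκ : κ₁ < κ) (hk : κ₁ < k) : HasDerivAt (dslope (fun κ' : ℝ => beta κ' q) k)
      (inner ℂ (qPlus q) (laxResolvent κ q (laxResolvent k q (laxResolvent κ q (qPlus q))))) κ := by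
  have h1 := (hasDerivAt_inner_laxResolvent_param hA hκ (qPlus q) (laxResolvent k q (qPlus q))).neg
  rw [neg_neg, (hA κ hκ).isLaxResolvent.comm (hA k hk).isLaxResolvent] at h1
  refine h1.congr_of_eventuallyEq ?_
  filter_upwards [lt_mem_nhds hκ] with κ' hκ'
  exact dslope_beta hA hκ' hk

theorem hardy_coeFn_add (u v : hardy) :
    ∀ᵐ x, ((u + v : hardy) : L2) x = (u : L2) x + (v : L2) x :=
  Lp.coeFn_add (u : L2) (v : L2)

theorem hardy_coeFn_sub (u v : hardy) :
    ∀ᵐ x, ((u - v : hardy) : L2) x = (u : L2) x - (v : L2) x :=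
  Lp.coeFn_sub (u : L2) (v : L2)

theorem hardy_coeFn_smul (c : ℂ) (u : hardy) : ∀ᵐ x, ((c • u : hardy) : L2) x = c * (u : L2) x :=
  Lp.coeFn_smul c (u : L2)

/-! ### Calculus of the Szegő projection -/

/-- `f ∈ L²` has Szegő projection `g`. -/
def IsProj (f g : ℝ → ℂ) : Prop := MemLp f 2 volume ∧ cplus f =ᵐ[volume] g

theorem isProj_cplus {f : ℝ → ℂ} (hf : MemLp f 2 volume) : IsProj f (cplus f) :=
  ⟨hf, Filter.EventuallyEq.rfl⟩

theorem IsProj.add {f g f' g' : ℝ → ℂ} (h : IsProj f g) (h' : IsProj f' g') :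
    IsProj (f + f') (g + g') :=
  ⟨h.1.add h'.1, (cplus_add h.1 h'.1).trans (h.2.add h'.2)⟩

theorem IsProj.sub {f g f' g' : ℝ → ℂ} (h : IsProj f g) (h' : IsProj f' g') :
    IsProj (f - f') (g - g') :=
  ⟨h.1.sub h'.1, (cplus_sub h.1 h'.1).trans (h.2.sub h'.2)⟩

theorem IsProj.smul {f g : ℝ → ℂ} (c : ℂ) (h : IsProj f g) : IsProj (c • f) (c • g) :=
  ⟨h.1.const_smul c, (cplus_smul c h.1).trans (h.2.const_smul c)⟩

theorem IsProj.congr {f g f' g' : ℝ → ℂ} (h : IsProj f g) (hf : f =ᵐ[volume] f')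
    (hg : g =ᵐ[volume] g') : IsProj f' g' :=
  ⟨h.1.ae_eq hf, by rw [← cplus_congr hf]; exact h.2.trans hg⟩

theorem IsProj.unique {f g g' : ℝ → ℂ} (h : IsProj f g) (h' : IsProj f g') : g =ᵐ[volume] g' :=
  h.2.symm.trans h'.2

theorem Har.isProj {f : ℝ → ℂ} (hf : Har f) : IsProj f f := ⟨hf.1, cplus_of_har hf⟩

theorem Har.isProj_cj {f : ℝ → ℂ} (hf : Har f) : IsProj (cj f) 0 :=
  ⟨MemLp.cj hf.1, cplus_cj_of_har hf⟩

theorem integral_conj_mul_cplus {f g : ℝ → ℂ} (hf : MemLp f 2 volume) (hg : MemLp g 2 volume) :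
    ∫ x, conj (f x) * cplus g x = ∫ x, conj (cplus f x) * g x := by
  rw [← integral_cj_har_mul_cplus (har_cplus f) hg]
  have h := congrArg conj (integral_cj_har_mul_cplus (har_cplus g) hf)
  rw [← integral_conj, ← integral_conj] at h
  simp only [map_mul, Complex.conj_conj] at h
  simp_rw [mul_comm (conj _)]
  exact h.symm

/-! ### The equation satisfied by `m(κ; q)` -/

/-- The equation `-i m' = q (1 + m) - conj P - κ m` with `P = C₊ (q (1 + conj m))`. -/
structure GaugeEq (κ : ℝ) (q : ℝ → ℝ) (m m' P : ℝ → ℂ) : Prop where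
  har : Har m
  hasD : HasD m m'
  proj : IsProj (cx q + cx q * cj m) P
  harP : Har P
  har_sub : Har (cx q + cx q * m - cj P)
  eqn : -Complex.I • m' =ᵐ[volume] cx q + cx q * m - cj P - (κ : ℂ) • m

/-- Splitting `q(1 + m)` into its positive and negative frequencies and using that `q` is real,
`C₊(q(1 + m)) = q(1 + m) - conj P`. -/
theorem IsLaxResolvent.gaugeEq {κ : ℝ} {q : ℝ → ℝ} (hq : MemLp (cx q) 2 volume)
    {T : hardy →L[ℂ] hardy} (h : IsLaxResolvent κ q T)
    (hlarge : ∀ K : ℝ, ∃ κ' : ℝ, K ≤ κ' ∧ ∃ S, IsLaxResolvent κ' q S) :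
    ∃ m', GaugeEq κ q ((T (qPlus q) : L2) : ℝ → ℂ) m'
      (cplus (cx q + cx q * cj ((T (qPlus q) : L2) : ℝ → ℂ))) ∧
      -Complex.I • m' + (κ : ℂ) • ((T (qPlus q) : L2) : ℝ → ℂ) =ᵐ[volume]
        cplus (cx q + cx q * ((T (qPlus q) : L2) : ℝ → ℂ)) := by
  obtain ⟨m', hd, he⟩ := h.hasD hq hlarge (qPlus q)
  set m : ℝ → ℂ := ((T (qPlus q) : L2) : ℝ → ℂ) with hm
  have hqm : MemLp (cx q * m) 2 volume := MemLp.mul_top hq hd.memLp_top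
  have hqm' : MemLp (cx q * cj m) 2 volume := MemLp.mul_top hq (MemLp.cj hd.memLp_top)
  have e0 : ((qPlus q : L2) : ℝ → ℂ) = cplus (cx q) := rfl
  have e1 : cj (cx q + cx q * m) = cx q + cx q * cj m := by
    funext x; simp [cx]
  have e2 := cplus_add_cj_cplus_cj (hq.add hqm)
  rw [e1] at e2
  have e3 : -Complex.I • m' + (κ : ℂ) • m =ᵐ[volume] cplus (cx q + cx q * m) := by
    rw [e0] at he
    filter_upwards [he, cplus_add hq hqm] with x h1 h2
    rw [h2]
    simp only [Pi.add_apply, Pi.sub_apply] at h1 ⊢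
    linear_combination h1
  refine ⟨m', ⟨har_coe _, hd, isProj_cplus (hq.add hqm'), har_cplus _,
    (har_cplus (cx q + cx q * m)).congr ?_, ?_⟩, e3⟩
  · filter_upwards [e2] with x h1
    simp only [Pi.add_apply, Pi.sub_apply] at h1 ⊢
    linear_combination h1
  · filter_upwards [e2, e3] with x h1 h2
    simp only [Pi.add_apply, Pi.sub_apply] at h1 h2 ⊢
    linear_combination h1 + h2

/-- The derivative of `δβ/δq = m + conj m + |m|²`. -/
theorem GaugeEq.hasD_gradient {κ : ℝ} {q : ℝ → ℝ} {m m' P : ℝ → ℂ} (h : GaugeEq κ q m m' P) :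
    HasD (m + cj m + cj m * m) (Complex.I • ((P + m * P) - cj (P + m * P) -
      (κ : ℂ) • (m - cj m))) := by
  refine ((h.hasD.add h.hasD.cj).add (h.hasD.cj.mul h.hasD)).congr Filter.EventuallyEq.rfl ?_
  filter_upwards [h.eqn] with x hx
  have hx' := congrArg conj hx
  simp only [Pi.add_apply, Pi.sub_apply, Pi.mul_apply, Pi.smul_apply, smul_eq_mul, cj_apply,
    map_mul, map_add, map_sub, map_neg, Complex.conj_I, Complex.conj_conj, Complex.conj_ofReal,
    neg_neg, cx] at hx hx' ⊢
  linear_combination (Complex.I * (1 + conj (m x))) * hx - (Complex.I * (1 + m x)) * hx' +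
    (m' x * (1 + conj (m x)) + conj (m' x) * (1 + m x)) * Complex.I_sq

theorem GaugeEq.har_mul {κ : ℝ} {q : ℝ → ℝ} {m m' P : ℝ → ℂ} (h : GaugeEq κ q m m' P)
    {f : ℝ → ℂ} (hf : Har f) : Har (m * f) :=
  h.har.mul hf (MemLp.top_mul h.hasD.memLp_top hf.1)

/-- The commutator of the Lax operator with the operator `f ↦ (1 + m) C₊ ((1 + conj m) f)`,
applied to `n(k; q)`. -/
theorem GaugeEq.commutator {κ k : ℝ} {q : ℝ → ℝ}
    {m m' P n n' O h a : ℝ → ℂ} (hm : GaugeEq κ q m m' P) (hn : GaugeEq k q n n' O)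
    (hh : h = Complex.I • ((P + m * P) - cj (P + m * P) - (κ : ℂ) • (m - cj m)))
    (ha : a = cplus (n + cj m * n)) :
    ∃ b' : ℝ → ℂ, Har (a + m * a) ∧ HasD (a + m * a) b' ∧
      -Complex.I • b' - cplus (cx q * (a + m * a)) =ᵐ[volume]
        -Complex.I • cplus (h + h * n) + (κ : ℂ) • m - (k : ℂ) • (a + m * a) := by
  have hmt := hm.hasD.memLp_top
  have hnt := hn.hasD.memLp_top
  have hdA := hn.hasD.add (hm.hasD.cj.mul hn.hasD)
  set d : ℝ → ℂ := n' + (cj m' * n + cj m * n') with hd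
  have hda : HasD a (cplus d) := by rw [ha]; exact hdA.cplus
  have har_a : Har a := by rw [ha]; exact har_cplus _
  have hA : IsProj (n + cj m * n) a := by rw [ha]; exact isProj_cplus hdA.1
  have hAn : IsProj (cj m * n) (a - n) :=
    (hA.sub hn.har.isProj).congr (by rw [add_sub_cancel_left]) Filter.EventuallyEq.rfl
  have hdH := hdA.cj.cplus
  set H := cplus (cj (n + cj m * n)) with hH
  have harH : Har H := har_cplus _
  have hdec : a + cj H =ᵐ[volume] n + cj m * n := by
    rw [ha]; exact cplus_add_cj_cplus_cj hdA.1
  have hPn : Har (P * n) := hm.harP.mul hn.har (MemLp.mul_top hm.harP.1 hnt)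
  have hp1 : Har (P + m * P) := hm.harP.add (hm.har_mul hm.harP)
  have hp1n : Har ((P + m * P) * n) := hp1.mul hn.har (MemLp.mul_top hp1.1 hnt)
  have hO1 : Har (O + m * O) := hn.harP.add (hm.har_mul hn.harP)
  -- the equation for `a`
  have hproj : IsProj (-Complex.I • d) (P - 0 - (k : ℂ) • a + P * n + (κ : ℂ) • (a - n)) := by
    refine ((((hm.proj.sub hO1.isProj_cj).sub (hA.smul k)).add hPn.isProj).add
      (hAn.smul κ)).congr ?_ Filter.EventuallyEq.rfl
    -- The contributions `q(1 + conj m) n` of the two equations cancel, so every remaining term has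
    -- an explicit projection.
    filter_upwards [hm.eqn, hn.eqn] with x h1 h2
    have h1' := congrArg conj h1
    simp only [Pi.add_apply, Pi.sub_apply, Pi.mul_apply, Pi.smul_apply, smul_eq_mul, cj_apply,
      map_mul, map_add, map_sub, map_neg, Complex.conj_I, Complex.conj_conj, Complex.conj_ofReal,
      neg_neg, cx, hd] at h1' h2 ⊢
    linear_combination n x * h1' - (1 + conj (m x)) * h2
  have ea := hproj.unique ((isProj_cplus hdA.2.1).smul (-Complex.I))
  -- the projection of `q b`
  have hPA : MemLp (cj P * (n + cj m * n)) 2 volume :=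
    MemLp.mul_top (MemLp.cj hm.harP.1) hdA.memLp_top
  set z := cplus (cj P * (n + cj m * n)) with hz
  have hQa : Har ((cx q + cx q * m - cj P) * a) :=
    hm.har_sub.mul har_a (MemLp.mul_top hm.har_sub.1 hda.memLp_top)
  have hPH : Har (P * H) := hm.harP.mul harH (MemLp.mul_top hm.harP.1 hdH.memLp_top)
  have hqb : IsProj (cx q * (a + m * a)) ((cx q + cx q * m - cj P) * a + z - 0) := by
    refine ((hQa.isProj.add (isProj_cplus hPA)).sub hPH.isProj_cj).congr ?_
      Filter.EventuallyEq.rfl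
    -- `q(1 + m) - conj P` is Hardy, and in `conj P · a` the function `a` is replaced by `(1 + conj
    -- m) n - conj H`; the product `conj (P H)` projects to zero.
    filter_upwards [hdec] with x h1
    simp only [Pi.add_apply, Pi.sub_apply, Pi.mul_apply, cj_apply, map_mul] at h1 ⊢
    linear_combination -conj (P x) * h1
  -- the projection of `h (1 + n)`
  have hmn : Har (m + m * n) := hm.har.add (hm.har_mul hn.har)
  have hhn : IsProj (h + h * n) (Complex.I • (((P + m * P) + (P + m * P) * n) - (0 + z) -
      (κ : ℂ) • ((m + m * n) - (0 + (a - n))))) := by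
    refine ((((hp1.add hp1n).isProj.sub (hp1.isProj_cj.add (isProj_cplus hPA))).sub
      ((hmn.isProj.sub (hm.har.isProj_cj.add hAn)).smul κ)).smul Complex.I).congr
      (Filter.Eventually.of_forall fun x => ?_) Filter.EventuallyEq.rfl
    simp only [hh, Pi.add_apply, Pi.sub_apply, Pi.mul_apply, Pi.smul_apply, smul_eq_mul, cj_apply,
      map_mul, map_add]
    ring
  refine ⟨_, har_a.add (hm.har_mul har_a), hda.add (hm.hasD.mul hda), ?_⟩
  filter_upwards [ea, hqb.2, hhn.2, hm.eqn] with x h1 h2 h3 h4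
  simp only [Pi.add_apply, Pi.sub_apply, Pi.mul_apply, Pi.smul_apply, smul_eq_mul, cj_apply,
    Pi.zero_apply] at h1 h2 h3 h4 ⊢
  rw [h2, h3]
  linear_combination -(1 + m x) * h1 + a x * h4 + (((P x + m x * P x) + (P x + m x * P x) * n x)
    - z x - (κ : ℂ) * ((m x + m x * n x) - (a x - n x))) * Complex.I_sq

/-! ### Multiplication of `n(k; q)` by `x` -/

theorem integrable_cx {q : ℝ → ℝ} (hq : MemLp (cx q) 2 volume)
    (hxq : MemLp (coord * cx q) 2 volume) : Integrable (cx q) := by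
  have h := MemLp.integrable_mul_two memLp_cauchy (hxq.add (hq.const_smul Complex.I))
  refine h.congr (Filter.Eventually.of_forall fun x => ?_)
  have := cauchy_mul x
  simp only [Pi.add_apply, Pi.mul_apply, Pi.smul_apply, coord, smul_eq_mul]
  linear_combination cx q x * this

/-- The integral is `∫ q + ⟨q₊, T q₊⟩` with `T` symmetric. It makes the tail coefficient `ν` real.
-/
theorem IsLaxResolvent.conj_integral {κ : ℝ} {q : ℝ → ℝ} (hq : MemLp (cx q) 2 volume)
    (hxq : MemLp (coord * cx q) 2 volume) {T : hardy →L[ℂ] hardy} (h : IsLaxResolvent κ q T) :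
    conj (∫ x, (cx q + cx q * ((T (qPlus q) : L2) : ℝ → ℂ)) x) =
      ∫ x, (cx q + cx q * ((T (qPlus q) : L2) : ℝ → ℂ)) x := by
  have i1 : Integrable (cx q * ((T (qPlus q) : L2) : ℝ → ℂ)) :=
    MemLp.integrable_mul_two hq (Lp.memLp _)
  have e1 : ∫ x, (cx q * ((T (qPlus q) : L2) : ℝ → ℂ)) x = inner ℂ (qPlus q) (T (qPlus q)) :=
    (inner_qPlus hq _).symm
  rw [integral_add' (integrable_cx hq hxq) i1, e1, map_add, hardy_inner_conj_symm, h.symm,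
    ← integral_conj]
  simp only [cx, Complex.conj_ofReal]

/-- `x n = X n + i ν` where `X n ∈ L²₊` is given by the commutator of `x` with the resolvent. -/
theorem IsLaxResolvent.coord_mul {k : ℝ} (hk : 1 < k) {q : ℝ → ℝ} (hq : MemLp (cx q) 2 volume)
    (hxq : MemLp (coord * cx q) 2 volume) {S : hardy →L[ℂ] hardy} (h : IsLaxResolvent k q S)
    (hlarge : ∀ K : ℝ, ∃ κ' : ℝ, K ≤ κ' ∧ ∃ S, IsLaxResolvent κ' q S) {ν : ℂ}
    (hν : ν = (∫ x, (cx q + cx q * ((S (qPlus q) : L2) : ℝ → ℂ)) x) / (2 * Real.pi * k)) :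
    coord * ((S (qPlus q) : L2) : ℝ → ℂ) =ᵐ[volume] fun x =>
      ((S (xqPlus q) + (Complex.I * ν) • S (qPlus q) - Complex.I • S (S (qPlus q)) : hardy) : L2) x
        + Complex.I * ν := by
  obtain ⟨n', hn, he⟩ := h.gaugeEq hq hlarge
  set n : ℝ → ℂ := ((S (qPlus q) : L2) : ℝ → ℂ) with hn_def
  have hnt := hn.hasD.memLp_top
  have hG : MemLp (cx q + cx q * n) 2 volume := hq.add (MemLp.mul_top hq hnt)
  have hxG : MemLp (coord * (cx q + cx q * n)) 2 volume := by
    have := hxq.add (MemLp.mul_top hxq hnt)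
    rwa [mul_assoc, ← mul_add] at this
  -- The free equation that `xn - iν` must satisfy. The next steps identify its solution `u` with
  -- `xn - iν` and rewrite `C₊(x q(1 + n))` through `q u`, so that `(𝓛 + k) u = (xq)₊ + iν q₊ - i
  -- n`.
  obtain ⟨u, u', hu, hdu, hue, -⟩ := exists_free_resolvent (zero_lt_one.trans hk)
    ((har_cplus (coord * (cx q + cx q * n))).sub (hn.har.smul Complex.I))
  have hX := coord_mul_of_free_equation hk hn.har hn.hasD hG hxG he hu hdu hue
  rw [← hν] at hX
  have hqu : IsProj (cx q * u) (cplus (coord * (cx q + cx q * n)) - cplus (coord * cx q) -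
      (Complex.I * ν) • cplus (cx q)) := by
    refine (((isProj_cplus hxG).sub (isProj_cplus hxq)).sub
      ((isProj_cplus hq).smul (Complex.I * ν))).congr ?_ Filter.EventuallyEq.rfl
    filter_upwards [hX] with x hx
    simp only [Pi.add_apply, Pi.sub_apply, Pi.mul_apply, Pi.smul_apply, smul_eq_mul] at hx ⊢
    linear_combination cx q x * hx
  have hgr : LaxGraph q hu.toHardy ((xqPlus q + (Complex.I * ν) • qPlus q -
      Complex.I • S (qPlus q)) - (k : ℂ) • hu.toHardy) := by
    refine laxGraph_of_hasD hq hu hdu ?_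
    filter_upwards [hue, hqu.2, hardy_coeFn_sub (xqPlus q + (Complex.I * ν) • qPlus q -
      Complex.I • S (qPlus q)) ((k : ℂ) • hu.toHardy), hardy_coeFn_sub (xqPlus q +
      (Complex.I * ν) • qPlus q) (Complex.I • S (qPlus q)), hardy_coeFn_add (xqPlus q)
      ((Complex.I * ν) • qPlus q), hardy_coeFn_smul (k : ℂ) hu.toHardy,
      hardy_coeFn_smul Complex.I (S (qPlus q)), hardy_coeFn_smul (Complex.I * ν) (qPlus q),
      hu.coeFn_toHardy] with x h1 h2 k1 k2 k3 k4 k5 k6 k7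
    rw [k1, k2, k3, k4, k5, k6, k7]
    have j1 : (xqPlus q : L2) x = cplus (coord * cx q) x := rfl
    have j2 : (qPlus q : L2) x = cplus (cx q) x := rfl
    simp only [Pi.add_apply, Pi.sub_apply, Pi.smul_apply, smul_eq_mul] at h1 h2 ⊢
    rw [h2, j1, j2, ← hn_def]
    linear_combination h1
  have hS := (h _ _).2 hgr
  rw [map_sub, map_add, map_smul, map_smul] at hS
  rw [hS]
  filter_upwards [hX, hu.coeFn_toHardy] with x h1 h2
  rw [h1, h2]

/-! ### The Poisson bracket -/

theorem integral_conj_mul_eq_zero {f g : ℝ → ℂ} (hf : Har f) (hg : Har g) :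
    ∫ x, conj (f x) * conj (g x) = 0 := by
  have h := congrArg conj (hf.integral_mul_eq_zero hg)
  rw [← integral_conj, map_zero] at h
  simpa only [map_mul] using h

/-- The pairing of `δ Cofβ / δq` (before symmetrization) with the derivative of
`δβ / δq`, reduced to inner products. -/
theorem GaugeEq.integral_gradient_mul {κ k : ℝ} {q : ℝ → ℝ} (hq : MemLp (cx q) 2 volume)
    (hxq : MemLp (coord * cx q) 2 volume) {S : hardy →L[ℂ] hardy} (hS : IsLaxResolvent k q S)
    {u v X : hardy} {m' n' O P h : ℝ → ℂ} {p ν : ℂ} (hp : conj p = p)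
    (gm : GaugeEq κ q ((u : L2) : ℝ → ℂ) m' P) (gn : GaugeEq k q ((v : L2) : ℝ → ℂ) n' O)
    (hP : P = cplus (cx q + cx q * cj ((u : L2) : ℝ → ℂ)))
    (hh : h = Complex.I • ((P + ((u : L2) : ℝ → ℂ) * P) - cj (P + ((u : L2) : ℝ → ℂ) * P) -
      (κ : ℂ) • (((u : L2) : ℝ → ℂ) - cj ((u : L2) : ℝ → ℂ))))
    (hh2 : MemLp h 2 volume)
    (hX : coord * ((v : L2) : ℝ → ℂ) =ᵐ[volume] fun x => (X : L2) x + Complex.I * ν)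
    (hpP : p = (∫ x, (cx q + cx q * cj ((u : L2) : ℝ → ℂ)) x) / (2 * Real.pi)) :
    ∫ x, h x * ((X : L2) x + (conj ((S (xqPlus q) : L2) x) +
      conj ((S (xqPlus q) : L2) x) * (v : L2) x)) =
      Complex.I * κ * (inner ℂ u X - inner ℂ (S (xqPlus q)) u) - 2 * Real.pi * p * ν
        - p * inner ℂ u v := by
  set m : ℝ → ℂ := ((u : L2) : ℝ → ℂ) with hm
  set n : ℝ → ℂ := ((v : L2) : ℝ → ℂ) with hn
  set w : ℝ → ℂ := ((S (xqPlus q) : L2) : ℝ → ℂ) with hw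
  have hmt := gm.hasD.memLp_top
  have hnt := gn.hasD.memLp_top
  have hX2 : MemLp ((X : L2) : ℝ → ℂ) 2 volume := Lp.memLp _
  have hw2 : MemLp w 2 volume := Lp.memLp _
  have hmX : MemLp (fun x => conj (m x) * (X : L2) x) 2 volume :=
    MemLp.top_mul (MemLp.cj hmt) hX2
  have hmn : MemLp (fun x => conj (m x) * n x) 2 volume := MemLp.top_mul (MemLp.cj hmt) gn.har.1
  have hG : MemLp (cx q + cx q * cj m) 2 volume := gm.proj.1
  have hxG : MemLp (coord * (cx q + cx q * cj m)) 2 volume := by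
    have := hxq.add (MemLp.mul_top hxq (MemLp.cj hmt))
    rwa [mul_assoc, ← mul_add] at this
  set XP := cplus (coord * (cx q + cx q * cj m)) with hXP
  have hxP : ∀ᵐ x, coord x * P x = XP x + Complex.I * p := by
    filter_upwards [coord_mul_cplus hG hxG] with x hx
    rw [hP, hpP]
    refine hx.trans ?_
    ring
  have hxP' : ∀ᵐ x, conj (XP x) = coord x * conj (P x) + Complex.I * p := by
    filter_upwards [hxP] with x hx
    have := congrArg conj hx
    simp only [map_mul, map_add, coord, Complex.conj_ofReal, Complex.conj_I, hp] at this ⊢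
    linear_combination -this
  -- the pairing with `X`
  have j1 : Integrable fun x => conj (P x) * (X : L2) x :=
    MemLp.integrable_mul_two (MemLp.cj gm.harP.1) hX2
  have j2 : Integrable fun x => conj (P x) * (conj (m x) * (X : L2) x) :=
    MemLp.integrable_mul_two (MemLp.cj gm.harP.1) hmX
  have j3 : Integrable fun x => conj (m x) * (X : L2) x :=
    MemLp.integrable_mul_two (MemLp.cj gm.har.1) hX2
  have hp1 : Har (P + m * P) := gm.harP.add (gm.har_mul gm.harP)
  have j4 : Integrable fun x => (P + m * P) x * (X : L2) x := MemLp.integrable_mul_two hp1.1 hX2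
  have j5 : Integrable fun x => m x * (X : L2) x := MemLp.integrable_mul_two gm.har.1 hX2
  have e1 : ∫ x, h x * (X : L2) x = Complex.I * (-((∫ x, conj (P x) * (X : L2) x) +
      ∫ x, conj (P x) * (conj (m x) * (X : L2) x)) + κ * inner ℂ u X) := by
    have z1 : ∫ x, (P + m * P) x * (X : L2) x = 0 := hp1.integral_mul_eq_zero (har_coe X)
    have z2 : ∫ x, m x * (X : L2) x = 0 := gm.har.integral_mul_eq_zero (har_coe X)
    have : ∫ x, h x * (X : L2) x = ∫ x, Complex.I * (((P + m * P) x * (X : L2) x -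
        (conj (P x) * (X : L2) x + conj (P x) * (conj (m x) * (X : L2) x))) -
        κ * (m x * (X : L2) x - conj (m x) * (X : L2) x)) := by
      refine integral_congr_ae (Filter.Eventually.of_forall fun x => ?_)
      simp only [hh, Pi.add_apply, Pi.sub_apply, Pi.mul_apply, Pi.smul_apply, smul_eq_mul,
        cj_apply, map_mul, map_add]
      ring
    have k1 : Integrable fun x => conj (P x) * (X : L2) x +
        conj (P x) * (conj (m x) * (X : L2) x) := j1.add j2
    have k2 : Integrable fun x => (P + m * P) x * (X : L2) x - (conj (P x) * (X : L2) x +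
        conj (P x) * (conj (m x) * (X : L2) x)) := j4.sub k1
    have k3 : Integrable fun x => κ * (m x * (X : L2) x - conj (m x) * (X : L2) x) :=
      (j5.sub j3).const_mul (κ : ℂ)
    rw [this, integral_const_mul, integral_sub k2 k3, integral_sub j4 k1,
      integral_add j1 j2, integral_const_mul, integral_sub j5 j3, z1, z2, inner_hardy]
    ring
  -- the pairing with `w`
  have hhn : MemLp (h + h * n) 2 volume := hh2.add (MemLp.mul_top hh2 hnt)
  set Hc : hardy := szego (toL2 (h + h * n)) with hHc
  have e2 : ∫ x, h x * (conj (w x) + conj (w x) * n x) = inner ℂ (S (xqPlus q)) Hc := by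
    have := integral_cj_har_mul_cplus (har_coe (S (xqPlus q))) hhn
    rw [inner_hardy]
    refine Eq.trans ?_ this.symm
    refine integral_congr_ae (Filter.Eventually.of_forall fun x => ?_)
    simp only [Pi.add_apply, Pi.mul_apply, ← hw]
    ring
  obtain ⟨b', hb, hdb, heb⟩ := gm.commutator gn hh rfl
  set a := cplus (n + cj m * n) with ha
  have hgr : LaxGraph q hb.toHardy ((-Complex.I • Hc + (κ : ℂ) • u) - (k : ℂ) • hb.toHardy) := by
    refine laxGraph_of_hasD hq hb hdb ?_
    filter_upwards [heb, hardy_coeFn_sub (-Complex.I • Hc + (κ : ℂ) • u) ((k : ℂ) • hb.toHardy),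
      hardy_coeFn_add (-Complex.I • Hc) ((κ : ℂ) • u), hardy_coeFn_smul (-Complex.I) Hc,
      hardy_coeFn_smul (κ : ℂ) u, hardy_coeFn_smul (k : ℂ) hb.toHardy, hb.coeFn_toHardy]
      with x h1 k1 k2 k3 k4 k5 k6
    rw [h1, k1, k2, k3, k4, k5, k6]
    rfl
  -- The commutator identity, read as a resolvent equation, computes `S C₊(h(1 + n))` explicitly as
  -- `i (b - κ S m)`.
  have hSb := (hS _ _).2 hgr
  rw [map_add, map_smul, map_smul] at hSb
  have hSH : S Hc = Complex.I • (hb.toHardy - (κ : ℂ) • S u) := by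
    rw [← hSb, add_sub_cancel_right, smul_smul, mul_neg, Complex.I_mul_I, neg_neg, one_smul]
  have e3 : (inner ℂ (S (xqPlus q)) Hc : ℂ) = Complex.I * (inner ℂ (xqPlus q) hb.toHardy -
      κ * inner ℂ (S (xqPlus q)) u) := by
    rw [hS.symm, hSH, hardy_inner_smul_right, hardy_inner_sub_right, hardy_inner_smul_right,
      hS.symm]
  have hA2 : MemLp (n + cj m * n) 2 volume := gn.har.1.add hmn
  have j6 : Integrable fun x => conj (XP x) * n x :=
    MemLp.integrable_mul_two (MemLp.cj (har_cplus _).1) gn.har.1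
  have j7 : Integrable fun x => conj (XP x) * (conj (m x) * n x) :=
    MemLp.integrable_mul_two (MemLp.cj (har_cplus _).1) hmn
  -- The factor `1 + m` of `b` moves onto `xq`, and then the self-adjoint `C₊` moves off `(1 + conj
  -- m) n`.
  have e4 : (inner ℂ (xqPlus q) hb.toHardy : ℂ) = (∫ x, conj (XP x) * n x) +
      ∫ x, conj (XP x) * (conj (m x) * n x) := by
    rw [inner_xqPlus hxq, ← integral_add j6 j7]
    have := integral_conj_mul_cplus hxG hA2
    rw [← ha, ← hXP] at this
    refine Eq.trans (integral_congr_ae ?_) (this.trans (integral_congr_ae ?_))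
    · filter_upwards [hb.coeFn_toHardy] with x hx
      rw [hx]
      simp only [Pi.add_apply, Pi.mul_apply, map_mul, map_add, coord, cx, Complex.conj_ofReal,
        cj_apply, Complex.conj_conj]
      ring
    · refine Filter.Eventually.of_forall fun x => ?_
      simp only [Pi.add_apply, Pi.mul_apply, cj_apply]
      ring
  -- failure of symmetry of multiplication by `x`
  have hHX : Har (fun x => coord x * n x - Complex.I * ν) := by
    refine (har_coe X).congr ?_
    filter_upwards [hX] with x hx
    have hx' : coord x * n x = (X : L2) x + Complex.I * ν := hx
    rw [hx', add_sub_cancel_right]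
  have hHP : Har (fun x => coord x * P x - Complex.I * p) := by
    refine (har_cplus (coord * (cx q + cx q * cj m))).congr ?_
    filter_upwards [hxP] with x hx
    rw [hx, add_sub_cancel_right]
  have d1 : (∫ x, conj (P x) * (X : L2) x) - ∫ x, conj (XP x) * n x =
      -(2 * Real.pi * Complex.I) * (conj (Complex.I * p) * (Complex.I * ν)) := by
    rw [← coord_symm_defect gm.harP hHP gn.har hHX]
    congr 1 <;> refine integral_congr_ae ?_
    · filter_upwards [hX] with x hx
      have hx' : coord x * n x = (X : L2) x + Complex.I * ν := hx
      rw [hx', add_sub_cancel_right]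
    · filter_upwards [hxP] with x hx
      rw [hx, add_sub_cancel_right]
  have j8 : Integrable fun x => conj (m x) * n x :=
    MemLp.integrable_mul_two (MemLp.cj gm.har.1) gn.har.1
  have j9 : Integrable fun x => conj (m x) * conj (P x) :=
    MemLp.integrable_mul_two (MemLp.cj gm.har.1) (MemLp.cj gm.harP.1)
  -- Here `x` passes from `conj P` to `n` pointwise. The constant `iν` contributes nothing, because
  -- `conj m · conj P` has zero integral; the constant `ip` leaves `⟨m, n⟩`.
  have d2 : (∫ x, conj (XP x) * (conj (m x) * n x)) -
      ∫ x, conj (P x) * (conj (m x) * (X : L2) x) = Complex.I * p * inner ℂ u v := by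
    have : ∫ x, (conj (XP x) * (conj (m x) * n x) - conj (P x) * (conj (m x) * (X : L2) x)) =
        ∫ x, (Complex.I * p * (conj (m x) * n x) + Complex.I * ν * (conj (m x) * conj (P x))) := by
      refine integral_congr_ae ?_
      filter_upwards [hX, hxP'] with x h1 h2
      have h1' : coord x * n x = (X : L2) x + Complex.I * ν := h1
      rw [h2]
      linear_combination conj (P x) * conj (m x) * h1'
    rw [← integral_sub j7 j2, this, integral_add (j8.const_mul _) (j9.const_mul _),
      integral_const_mul, integral_const_mul, integral_conj_mul_eq_zero gm.har gm.harP, inner_hardy]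
    ring
  have j10 : Integrable fun x => h x * (X : L2) x := MemLp.integrable_mul_two hh2 hX2
  have j11 : Integrable fun x => h x * (conj (w x) + conj (w x) * n x) :=
    MemLp.integrable_mul_two hh2 ((MemLp.cj hw2).add (MemLp.mul_top (MemLp.cj hw2) hnt))
  simp_rw [mul_add (h _)  ((X : L2) _)]
  rw [integral_add j10 j11, e1, e2, e3, e4]
  simp only [map_mul, Complex.conj_I, hp] at d1
  linear_combination (-Complex.I) * d1 + Complex.I * d2 +
    (p * inner ℂ u v - 2 * Real.pi * p * ν * (Complex.I ^ 2 - 1)) * Complex.I_sq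

/-- A second symmetry defect, now for `m` and `n`, converts `⟨m, X⟩` into `⟨Y, n⟩`. Its terms in
`μν` and `μ⟨m, n⟩` cancel the tail terms of `GaugeEq.integral_gradient_mul`, because the tail
coefficient of `P` is `κ` times that of `m`. -/
theorem exists_bracket {κ k : ℝ} (hκ : 1 < κ) (hk : 1 < k) {q : ℝ → ℝ}
    (hq : MemLp (cx q) 2 volume) (hxq : MemLp (coord * cx q) 2 volume) {T S : hardy →L[ℂ] hardy}
    (hT : IsLaxResolvent κ q T) (hS : IsLaxResolvent k q S)
    (hlarge : ∀ K : ℝ, ∃ κ' : ℝ, K ≤ κ' ∧ ∃ S, IsLaxResolvent κ' q S) {m n w : ℝ → ℂ}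
    (hm : m = ((T (qPlus q) : L2) : ℝ → ℂ)) (hn : n = ((S (qPlus q) : L2) : ℝ → ℂ))
    (hw : w = ((S (xqPlus q) : L2) : ℝ → ℂ)) :
    ∃ h : ℝ → ℂ, MemLp m ⊤ volume ∧ MemLp n ⊤ volume ∧
      MemLp (coord * n + cj (coord * n)) 2 volume ∧ HasD (m + cj m + cj m * m) h ∧
      ∫ x, ((1 / 2 : ℂ) • ((coord * n + cj (coord * n)) +
        ((cj w + w) + (cj w * n + w * cj n)))) x * h x =
        -(κ : ℂ) * inner ℂ (qPlus q) (T (S (T (qPlus q)))) := by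
  have hpi : (Real.pi : ℂ) ≠ 0 := by exact_mod_cast Real.pi_ne_zero
  have hκ0 : (κ : ℂ) ≠ 0 := by exact_mod_cast (by linarith : κ ≠ 0)
  obtain ⟨m', gm, -⟩ := hT.gaugeEq hq hlarge
  obtain ⟨n', gn, -⟩ := hS.gaugeEq hq hlarge
  set ν : ℂ := (∫ x, (cx q + cx q * ((S (qPlus q) : L2) : ℝ → ℂ)) x) / (2 * Real.pi * k) with hν
  set μ : ℂ := (∫ x, (cx q + cx q * ((T (qPlus q) : L2) : ℝ → ℂ)) x) / (2 * Real.pi * κ) with hμ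
  have hνr : conj ν = ν := by
    rw [hν, map_div₀, hS.conj_integral hq hxq]
    simp only [map_mul, map_ofNat, Complex.conj_ofReal]
  have hμr : conj μ = μ := by
    rw [hμ, map_div₀, hT.conj_integral hq hxq]
    simp only [map_mul, map_ofNat, Complex.conj_ofReal]
  have hX := hS.coord_mul hk hq hxq hlarge hν
  have hXm := hT.coord_mul hκ hq hxq hlarge hμ
  set X : hardy := S (xqPlus q) + (Complex.I * ν) • S (qPlus q) - Complex.I • S (S (qPlus q))
    with hXdef
  set Y : hardy := T (xqPlus q) + (Complex.I * μ) • T (qPlus q) - Complex.I • T (T (qPlus q))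
    with hYdef
  rw [← hm] at gm hXm
  rw [← hn] at gn hX
  set P := cplus (cx q + cx q * cj m) with hP
  set h := Complex.I • ((P + m * P) - cj (P + m * P) - (κ : ℂ) • (m - cj m)) with hh
  have hgrad : HasD (m + cj m + cj m * m) h := gm.hasD_gradient
  have hp : κ * μ = (∫ x, (cx q + cx q * cj m) x) / (2 * Real.pi) := by
    have e : ∫ x, (cx q + cx q * cj m) x = ∫ x, (cx q + cx q * m) x := by
      have := hT.conj_integral hq hxq
      rw [← integral_conj, ← hm] at this
      rw [← this]
      refine integral_congr_ae (Filter.Eventually.of_forall fun x => ?_)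
      simp [cx]
    rw [hμ, ← hm, e]
    field_simp
  -- As `ν` is real, the constants `iν` and `conj (iν)` cancel.
  have hsum : coord * n + cj (coord * n) =ᵐ[volume]
      ((X : L2) : ℝ → ℂ) + cj ((X : L2) : ℝ → ℂ) := by
    filter_upwards [hX] with x hx
    simp only [Pi.add_apply, cj_apply]
    rw [hx]
    simp only [map_add, map_mul, Complex.conj_I, hνr]
    ring
  refine ⟨h, gm.hasD.memLp_top, gn.hasD.memLp_top,
    ((Lp.memLp (X : L2)).add (MemLp.cj (Lp.memLp (X : L2)))).ae_eq hsum.symm, hgrad, ?_⟩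
  have hz := GaugeEq.integral_gradient_mul (X := X) (u := T (qPlus q)) (v := S (qPlus q)) (P := P)
    (h := h) (m' := m') (n' := n') (p := κ * μ) (ν := ν) hq hxq hS
    (by rw [map_mul, Complex.conj_ofReal, hμr]) (by rw [← hm]; exact gm) (by rw [← hn]; exact gn)
    (by rw [hP, hm]) (by rw [hh, hm]) hgrad.2.1 (by rw [← hn]; exact hX) (by rw [hp, hm])
  have hfin : (inner ℂ (T (T (qPlus q))) (S (qPlus q)) : ℂ) =
      inner ℂ (qPlus q) (T (S (T (qPlus q)))) := by
    simp only [hT.symm, hT.comm hS]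
  have hreal : conj (inner ℂ (qPlus q) (T (S (T (qPlus q)))) : ℂ) =
      inner ℂ (qPlus q) (T (S (T (qPlus q)))) := by
    simp only [hardy_inner_conj_symm, hT.symm, hS.symm]
  have hHX : Har (fun x => coord x * n x - Complex.I * ν) := by
    refine (har_coe X).congr ?_
    filter_upwards [hX] with x hx
    have hx' : coord x * n x = (X : L2) x + Complex.I * ν := hx
    rw [hx', add_sub_cancel_right]
  have hHY : Har (fun x => coord x * m x - Complex.I * μ) := by
    refine (har_coe Y).congr ?_
    filter_upwards [hXm] with x hx
    have hx' : coord x * m x = (Y : L2) x + Complex.I * μ := hx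
    rw [hx', add_sub_cancel_right]
  have hdef : (inner ℂ (T (qPlus q)) X : ℂ) - inner ℂ Y (S (qPlus q)) =
      -(2 * Real.pi * Complex.I) * (conj (Complex.I * μ) * (Complex.I * ν)) := by
    rw [← coord_symm_defect gm.har hHY gn.har hHX, inner_hardy, inner_hardy, ← hm, ← hn]
    congr 1 <;> refine integral_congr_ae ?_
    · filter_upwards [hX] with x hx
      have hx' : coord x * n x = (X : L2) x + Complex.I * ν := hx
      rw [hx', add_sub_cancel_right]
    · filter_upwards [hXm] with x hx
      have hx' : coord x * m x = (Y : L2) x + Complex.I * μ := hx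
      rw [hx', add_sub_cancel_right]
  have hY : (inner ℂ Y (S (qPlus q)) : ℂ) = inner ℂ (S (xqPlus q)) (T (qPlus q)) -
      Complex.I * μ * inner ℂ (T (qPlus q)) (S (qPlus q)) +
      Complex.I * inner ℂ (qPlus q) (T (S (T (qPlus q)))) := by
    have e : (inner ℂ (T (xqPlus q)) (S (qPlus q)) : ℂ) =
        inner ℂ (S (xqPlus q)) (T (qPlus q)) := by
      rw [hT.symm, hS.symm, hT.comm hS]
    rw [hYdef, hardy_inner_sub_left, hardy_inner_add_left, hardy_inner_smul_left,
      hardy_inner_smul_left, hfin, e, map_mul, Complex.conj_I, hμr]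
    ring
  simp only [map_mul, Complex.conj_I, hμr] at hdef
  have hz' : ∫ x, h x * ((X : L2) x + (conj (w x) + conj (w x) * n x)) =
      -(κ : ℂ) * inner ℂ (qPlus q) (T (S (T (qPlus q)))) := by
    rw [hw, hn, hz]
    linear_combination Complex.I * κ * hdef + Complex.I * κ * hY +
      (κ * inner ℂ (qPlus q) (T (S (T (qPlus q)))) -
        κ * μ * inner ℂ (T (qPlus q)) (S (qPlus q)) +
        2 * Real.pi * κ * μ * ν * (Complex.I ^ 2 - 1)) * Complex.I_sq
  have hX2 : MemLp ((X : L2) : ℝ → ℂ) 2 volume := Lp.memLp _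
  have hw2 : MemLp w 2 volume := by rw [hw]; exact Lp.memLp _
  have hF : MemLp (fun x => (X : L2) x + (conj (w x) + conj (w x) * n x)) 2 volume :=
    hX2.add ((MemLp.cj hw2).add (MemLp.mul_top (MemLp.cj hw2) gn.hasD.memLp_top))
  have i1 : Integrable fun x => h x * ((X : L2) x + (conj (w x) + conj (w x) * n x)) :=
    MemLp.integrable_mul_two hgrad.2.1 hF
  have i2 : Integrable fun x => conj (h x * ((X : L2) x + (conj (w x) + conj (w x) * n x))) :=
    (Complex.conjCLE.integrable_comp_iff).2 i1
  -- Since `h` is real, the symmetrized gradient pairs with it to the average of the integral `hz'`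
  -- and its conjugate. The value of `hz'` is real, so symmetrizing does not change it.
  have hhr : ∀ x, conj (h x) = h x := fun x => by
    simp only [hh, Pi.add_apply, Pi.sub_apply, Pi.mul_apply, Pi.smul_apply, smul_eq_mul, cj_apply,
      map_mul, map_add, map_sub, Complex.conj_I, Complex.conj_conj, Complex.conj_ofReal]
    ring
  have hsplit : ∫ x, ((1 / 2 : ℂ) • ((coord * n + cj (coord * n)) +
      ((cj w + w) + (cj w * n + w * cj n)))) x * h x =
      ∫ x, (1 / 2 : ℂ) * (h x * ((X : L2) x + (conj (w x) + conj (w x) * n x)) +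
        conj (h x * ((X : L2) x + (conj (w x) + conj (w x) * n x)))) := by
    refine integral_congr_ae ?_
    filter_upwards [hsum] with x hx
    rw [map_mul, hhr]
    simp only [Pi.add_apply, Pi.mul_apply, Pi.smul_apply, smul_eq_mul, cj_apply,
      map_mul, map_add, Complex.conj_conj] at hx ⊢
    linear_combination (1 / 2 : ℂ) * h x * hx
  rw [hsplit, integral_const_mul, integral_add i1 i2, integral_conj, hz', map_mul, map_neg,
    Complex.conj_ofReal, hreal]
  ring

end BenjaminOno

end

/-! ### The virial identities. -/

open BenjaminOno in
/-- Virial identities for the Benjamin–Ono hierarchy on the line.  `k₀ = k₀(s, A)` is the threshold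
for the spectral parameters on the ball of radius `A` in `H^s`, and `k` is the parameter `ϰ`.
`dslope β k` is the difference quotient `κ ↦ (β κ - β k) / (κ - k)`, extended by the derivative of
`β` at the point `κ = k`. -/
theorem theorem6p5 (s : ℝ) (hs : -(1 / 2) < s) (hs' : s < 0) (A : ℝ) (hA : 0 < A) :
    ∃ k₀ : ℝ, 0 < k₀ ∧ ∀ q : ℝ → ℝ, MemWeightedL2 q →
      sobolevNormSq s (toL2 fun x => (q x : ℂ)) ≤ ENNReal.ofReal (A ^ 2) →
      ∀ κ k : ℝ, k₀ ≤ κ → k₀ ≤ k →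
        IsLaxResolvent κ q (laxResolvent κ q) ∧ IsLaxResolvent k q (laxResolvent k q) ∧
        HasPoissonBracket (cofBeta k) (beta κ) q
          (-(κ : ℂ) * inner ℂ (qPlus q)
            (laxResolvent κ q (laxResolvent k q (laxResolvent κ q (qPlus q))))) ∧
        ∃ D : ℂ, HasDerivAt (dslope (fun κ' : ℝ => beta κ' q) k) D κ ∧
          -(κ : ℂ) * inner ℂ (qPlus q)
            (laxResolvent κ q (laxResolvent k q (laxResolvent κ q (qPlus q)))) = -(κ : ℂ) * D := by
  obtain ⟨κ₁, hκ₁, hadm⟩ := exists_admissible_threshold hs hs' A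
  -- The margin `1` makes `κ₁ < κ` strict, so a neighbourhood of `κ` is admissible for
  -- differentiation in `κ`; as `κ₁ ≥ 1`, it also gives `κ, k > 1`, which the tail expansions need.
  refine ⟨κ₁ + 1, by linarith, fun q hw hq κ k hκ hk => ?_⟩
  obtain ⟨hq2, hxq⟩ := memLp_of_memWeightedL2 hw
  have hadm₁ : ∀ κ', κ₁ < κ' → Admissible κ' q := fun κ' h => hadm q hq2 hq κ' h.le
  have aκ := hadm₁ κ (by linarith)
  have ak := hadm₁ k (by linarith)
  -- The `H¹` regularity needs a parameter that is large relative to the `L²` norm of `q`, which `s`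
  -- and `A` do not control; hence all large parameters are supplied.
  have hlarge : ∀ K : ℝ, ∃ κ' : ℝ, K ≤ κ' ∧ ∃ S, IsLaxResolvent κ' q S := fun K =>
    ⟨max K (κ₁ + 1), le_max_left _ _, _,
      (hadm₁ _ (lt_of_lt_of_le (by linarith) (le_max_right _ _))).isLaxResolvent⟩
  obtain ⟨h, hmt, hnt, hxn, hD, hI⟩ := exists_bracket (by linarith) (by linarith) hq2 hxq
    aκ.isLaxResolvent ak.isLaxResolvent hlarge rfl rfl rfl
  exact ⟨aκ.isLaxResolvent, ak.isLaxResolvent,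
    ⟨_, _, h, isFunctionalDeriv_cofBeta ak hxq rfl rfl hnt hxn, isFunctionalDeriv_beta aκ rfl hmt,
      hD.isWeakDeriv, hI⟩,
    _, hasDerivAt_dslope_beta hadm₁ (by linarith) (by linarith), rfl⟩
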